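/- \textbf{Setting.} Let $n\ge 2$, let $U\subset\mathbb R^n$ be a bounded domain (for instance with $C^1$ boundary), $\Gamma=\partial U$. Let $N\ge1$ and $0=\alpha_0<\alpha_1<\dots<\alpha_N$ be fixed, and put $$a=\frac{\alpha_N}{\alpha_N+1}\in(0,1),\qquad \kappa_0=\frac{a}{2-a}+\frac12 .$$ Let $\phi:U\to(0,1]$ and $a_0,\dots,a_N:U\to[0,\infty)$ be measurable with $a_0,a_N>0$ and $B_1=\int_U a_N\,dx<\infty$; put $g(x,s)=\sum_{j=0}^N a_j(x)s^{\alpha_j}$, and let $K(x,\xi)=1/g(x,s(x,\xi))$, where $s=s(x,\xi)\ge0$ is the unique solution of $s\,g(x,s)=\xi$, $\xi\ge 0$. Let $W_1=a_N^a/(2N\max_j a_j)$, $B_*=\max\{B_1,1\}$ and $\|u\|_{L^2_\phi}^2=\int_U\phi u^2dx$. For $i=1,2$ let $p_i$ be a solution of $$\phi\,p_t=\nabla\cdot\big(K(x,|\nabla p|)\nabla p\big)\ \text{ on }U\times(0,\infty),\qquad p_i=\Psi_i\ \text{ on }\Gamma\times(0,\infty),$$ where $\Psi_i(x,t)$ is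 a given extension to $U$ of the boundary data. The regularity that is assumed is the following. The functions $p_i,\partial_tp_i,\Psi_i,\partial_t\Psi_i$ are continuous on $\overline U\times(0,\infty)$ and, for each $t>0$, locally Lipschitz in $x\in U$; $\partial_t^2\Psi_i$ exists in $U\times(0,\infty)$. The equation holds for every $t>0$ in the weak form $$\int_U\phi\,\partial_tp_i\,v\,dx=-\int_U K(x,|\nabla p_i|)\nabla p_i\cdot\nabla v\,dx$$ for all $v\in C(\overline U)$ that are locally Lipschitz in $U$, vanish on $\Gamma$ and make the right-hand integrand integrable. For every $t>0$, $\int_UK(x,|\nabla p_i|)|\nabla p_i|^2dx<\infty$; for almost every $x\in U$, $\nabla p_i(x,t)$ is differentiable in $t>0$ with derivative $\nabla \partial_tp_i$; and, locally uniformly in $t>0$, $K(x,|\nabla p_i|)|\nabla p_i||\nabla\partial_tp_i|$ is dominated by an integrable function of $x$. For $\Psi\in\{\Psi_1,\Psi_2\}$ the integrals in $$G[\Psi](t)=B_*+\int_U a_0^{-1}|\nabla\Psi|^2dx+\int_UW_1|\nabla\Psi|^{2-a}dx+\Big(\int_U|\Psi_t|^2\phi\,dx\Big)^{\frac{2-a}{2(1-a)}},$$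 $$G_1[\Psi](t)=\int_Ua_0^{-1}|\nabla\Psi_t|^2dx,\qquad G_2[\Psi](t)=\int_U|\Psi_{tt}|^2\phi\,dx$$ are finite and these functions are continuous for $t>0$. Put $$\bar P=(p_1-\Psi_1)-(p_2-\Psi_2),\qquad \Phi=\Psi_1-\Psi_2,$$ and assume that for some $c_P>0$ the inequality $$\Big(\int_U|u|^2\phi\,dx\Big)^{1/2}\le c_P\Big(\int_UW_1|\nabla u|^{2-a}dx\Big)^{\frac1{2-a}}$$ holds, at each time $t>0$, for $u=p_1-\Psi_1$, $u=p_2-\Psi_2$ and $u=\bar P$. Put $\tilde G=G[\Psi_1]+G[\Psi_2]$, $\tilde G_k=G_k[\Psi_1]+G_k[\Psi_2]$ $(k=1,2)$, $$\tilde{\mathcal A}=\sum_{i=1}^2\limsup_{t\to\infty}G[\Psi_i](t),\qquad \tilde{\mathcal B}=\sum_{i=1}^2\limsup_{t\to\infty}\big[G[\Psi_i]'(t)\big]^-,$$ where $[z]^-=\max\{-z,0\}$ and $\tilde{\mathcal B}$ is considered when $G[\Psi_1],G[\Psi_2]\in C^1((0,\infty))$, and $$D(t)=\int_Ua_0^{-1}|\nabla\Phi|^2dx+\Big(\int_Ua_0^{-1}|\nabla\Phi|^2dx\Big)^{1/2}+\Big(\int_U|\Phi_t|^2\phi\,dx\Big)^{1/2}.$$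 Let $V$ be one of the following two functions: either $$V(t)=\big(\mathcal M_1(t)+\mathcal M_2(t)\big)^{\frac2{2-a}}+\int_{t-1}^t(\tilde G_1+\tilde G_2)\,d\tau,$$ where $\mathcal M_i$ is any continuous increasing function on $[0,\infty)$ with $\mathcal M_i\ge G[\Psi_i]$ on $(0,\infty)$; or, provided that $\tilde{\mathcal B}<\infty$, $$V(t)=\tilde{\mathcal B}^{\frac1{1-a}}+\tilde G(t)^{\frac2{2-a}}+\int_{t-1}^t(\tilde G_1+\tilde G_2)\,d\tau .$$ \textbf{Theorem.} Assume $\tilde{\mathcal A}=\infty$. If $\int_1^\infty V(t)^{-\frac a{2-a}}dt=\infty$, then $$\limsup_{t\to\infty}\|\bar P(t)\|_{L^2_\phi}^2\le C\limsup_{t\to\infty}\Big(V(t)^{\kappa_0}D(t)\Big),$$ where both sides take values in $[0,\infty]$ and the constant $C>0$ depends only on $n$, $U$, the exponents $N,\alpha_0,\dots,\alpha_N$ and $c_P$; in particular it depends neither on $\phi$ and the $a_j$ nor on the initial and boundary data. -/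

import Mathlib

open MeasureTheory Set Filter Topology
open scoped ENNReal

namespace Forchheimer

noncomputable section

/-- The Euclidean space of dimension `n`. -/
abbrev E (n : ℕ) : Type := EuclideanSpace ℝ (Fin n)

/-! ### The Forchheimer polynomial and the nonlinear conductivity -/

/-- The generalized polynomial `g(s) = ∑ c_j s ^ α_j` with coefficients `c`
(the values `a_j(x)` at one point `x`). -/
def g {N : ℕ} (α c : Fin (N + 1) → ℝ) (s : ℝ) : ℝ :=
  ∑ j, c j * s ^ α j

theorem existsUnique_root {N : ℕ} {α c : Fin (N + 1) → ℝ} (hα0 : α 0 = 0)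
    (hα : StrictMono α) (hc0 : 0 < c 0) (hc : ∀ j, 0 ≤ c j) {ξ : ℝ} (hξ : 0 ≤ ξ) :
    ∃! s : ℝ, 0 ≤ s ∧ s * g α c s = ξ := by
  have hαn : ∀ j, 0 ≤ α j := fun j => by
    have := hα.monotone (Fin.zero_le j)
    rwa [hα0] at this
  have hcont : Continuous (fun s : ℝ => s * g α c s) := by
    unfold g
    refine continuous_id.mul (continuous_finsetSum _ fun j _ => ?_)
    exact continuous_const.mul (Real.continuous_rpow_const (hαn j))
  have hge : ∀ s : ℝ, 0 ≤ s → c 0 ≤ g α c s := fun s hs => by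
    have h := Finset.single_le_sum (f := fun j => c j * s ^ α j)
      (fun j _ => mul_nonneg (hc j) (Real.rpow_nonneg hs _)) (Finset.mem_univ 0)
    simpa [g, hα0] using h
  have hmono : ∀ s r : ℝ, 0 ≤ s → s < r → s * g α c s < r * g α c r := fun s r hs hsr => by
    have h1 : g α c s ≤ g α c r := Finset.sum_le_sum fun j _ =>
      mul_le_mul_of_nonneg_left (Real.rpow_le_rpow hs hsr.le (hαn j)) (hc j)
    have h2 := hge r (hs.trans hsr.le)
    nlinarith
  have hb : 0 ≤ ξ / c 0 := div_nonneg hξ hc0.le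
  have hup : ξ ≤ (ξ / c 0) * g α c (ξ / c 0) := by
    have h := mul_le_mul_of_nonneg_left (hge _ hb) hb
    rwa [div_mul_cancel₀ _ hc0.ne'] at h
  obtain ⟨s, hs, hsξ⟩ := intermediate_value_Icc hb hcont.continuousOn
    (show ξ ∈ Icc _ _ from ⟨by simpa using hξ, hup⟩)
  refine ⟨s, ⟨hs.1, hsξ⟩, fun r hr => ?_⟩
  rcases lt_trichotomy r s with h | h | h
  · have := hmono r s hr.1 h
    have h3 : s * g α c s = ξ := hsξ
    linarith [hr.2]
  · exact h
  · have := hmono s r hs.1 h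
    have h3 : s * g α c s = ξ := hsξ
    linarith [hr.2]

open Classical in
/-- The non-negative solution `s` of `s g(s) = ξ`; by `existsUnique_root` it exists and is
unique for all coefficients and all `ξ ≥ 0` that occur (otherwise the value is `0`). -/
def root {N : ℕ} (α c : Fin (N + 1) → ℝ) (ξ : ℝ) : ℝ :=
  if h : ∃ s : ℝ, 0 ≤ s ∧ s * g α c s = ξ then h.choose else 0

/-- `K(x, ξ) = 1 / g(x, s(x, ξ))`. -/
def K {n N : ℕ} (α : Fin (N + 1) → ℝ) (a : Fin (N + 1) → E n → ℝ) (x : E n) (ξ : ℝ) : ℝ :=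
  1 / g α (fun j => a j x) (root α (fun j => a j x) ξ)

/-- The exponent `a = α_N / (α_N + 1)`. -/
def expo {N : ℕ} (α : Fin (N + 1) → ℝ) : ℝ :=
  α (Fin.last N) / (α (Fin.last N) + 1)

/-- The exponent `κ₀ = a / (2 - a) + 1 / 2`. -/
def kappa {N : ℕ} (α : Fin (N + 1) → ℝ) : ℝ :=
  expo α / (2 - expo α) + 1 / 2

/-- The weight `W₁ = a_N ^ a / (2 N max_j a_j)`. -/
def W1 {n N : ℕ} (α : Fin (N + 1) → ℝ) (a : Fin (N + 1) → E n → ℝ) (x : E n) : ℝ :=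
  a (Fin.last N) x ^ expo α /
    (2 * N * Finset.univ.sup' Finset.univ_nonempty (fun j => a j x))

/-- The porosity `φ` has values in `(0, 1]`, the coefficients are non-negative, the first and
the last are positive, and the last has a finite integral. -/
structure IsMedium {n N : ℕ} (U : Set (E n)) (φ : E n → ℝ) (a : Fin (N + 1) → E n → ℝ) :
    Prop where
  measurable_porosity : Measurable φ
  porosity_mem : ∀ x ∈ U, φ x ∈ Ioc (0 : ℝ) 1
  measurable_coeff : ∀ j, Measurable (a j)
  coeff_nonneg : ∀ j, ∀ x ∈ U, 0 ≤ a j x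
  coeff_zero_pos : ∀ x ∈ U, 0 < a 0 x
  coeff_last_pos : ∀ x ∈ U, 0 < a (Fin.last N) x
  integrable_coeff_last : IntegrableOn (a (Fin.last N)) U

/-! ### Functions of time and space, weighted norms -/

/-- The time derivative of `u = u(t, x)`. -/
def dt {n : ℕ} (u : ℝ → E n → ℝ) (t : ℝ) (x : E n) : ℝ :=
  deriv (fun s => u s x) t

/-- The weighted norm `(∫_U f |u|^q dx)^(1/q)`, for scalar and for vector valued `u`. -/
def wnorm {n : ℕ} {F : Type} [NormedAddCommGroup F] (U : Set (E n)) (f : E n → ℝ) (q : ℝ)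
    (u : E n → F) : ℝ :=
  (∫ x in U, f x * ‖u x‖ ^ q) ^ (1 / q)

/-- The two-weight Poincaré-Sobolev inequality with constant `cP` for the function `u`. -/
def PoincareSobolev {n N : ℕ} (U : Set (E n)) (φ : E n → ℝ) (α : Fin (N + 1) → ℝ)
    (a : Fin (N + 1) → E n → ℝ) (cP : ℝ) (u : E n → ℝ) : Prop :=
  wnorm U φ 2 u ≤ cP * wnorm U (W1 α a) (2 - expo α) (gradient u)

/-- Regularity for positive times: `u` and `u_t` exist and are continuous on
`(0, ∞) × closure U`, and locally Lipschitz in `x ∈ U` (so that the gradients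
`∇u` and `∇u_t` exist almost everywhere). -/
structure Regular {n : ℕ} (U : Set (E n)) (u : ℝ → E n → ℝ) : Prop where
  cont : ContinuousOn (Function.uncurry u) (Ioi 0 ×ˢ closure U)
  diff_time : ∀ t > 0, ∀ x ∈ closure U, DifferentiableAt ℝ (fun s => u s x) t
  cont_dt : ContinuousOn (Function.uncurry (dt u)) (Ioi 0 ×ˢ closure U)
  lip : ∀ t > 0, LocallyLipschitzOn U (u t)
  lip_dt : ∀ t > 0, LocallyLipschitzOn U (dt u t)

/-! ### Solutions -/

/-- Regular solutions `p` of `φ p_t = ∇ · (K(x, |∇p|) ∇p)` on `U × (0, ∞)` whose boundary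
values on `∂U × (0, ∞)` are those of `Ψ`. The equation is understood in the weak form, at every
time `t > 0`, with all test functions that are continuous on `closure U`, locally Lipschitz
in `U`, zero on the boundary, and whose pairing with the flux is integrable; classical solutions
satisfy it by integration by parts. The fields `energy`, `energy_dt` and `grad_dt` are the
regularity in time that allows one to differentiate `∫ H(x, |∇p|) dx` under the integral sign. -/
structure IsSolution {n N : ℕ} (U : Set (E n)) (φ : E n → ℝ) (α : Fin (N + 1) → ℝ)
    (a : Fin (N + 1) → E n → ℝ) (p Ψ : ℝ → E n → ℝ) : Prop where
  regular : Regular U p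
  boundary : ∀ t > 0, ∀ x ∈ frontier U, p t x = Ψ t x
  weak : ∀ t > 0, ∀ v : E n → ℝ, ContinuousOn v (closure U) → LocallyLipschitzOn U v →
    (∀ x ∈ frontier U, v x = 0) →
    IntegrableOn
      (fun x => K α a x ‖gradient (p t) x‖ * inner ℝ (gradient (p t) x) (gradient v x)) U →
    ∫ x in U, φ x * dt p t x * v x =
      -∫ x in U, K α a x ‖gradient (p t) x‖ * inner ℝ (gradient (p t) x) (gradient v x)
  energy : ∀ t > 0,
    IntegrableOn (fun x => K α a x ‖gradient (p t) x‖ * ‖gradient (p t) x‖ ^ 2) U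
  energy_dt : ∀ t > 0, ∃ ε > 0, ∃ b : E n → ℝ, IntegrableOn b U ∧
    ∀ᵐ x ∂(volume.restrict U), ∀ s ∈ Ioo (t - ε) (t + ε),
      K α a x ‖gradient (p s) x‖ * ‖gradient (p s) x‖ * ‖gradient (dt p s) x‖ ≤ b x
  grad_dt : ∀ᵐ x ∂(volume.restrict U), ∀ t > 0,
    HasDerivAt (fun s => gradient (p s) x) (gradient (dt p t) x) t

/-! ### Quantities built from the boundary data -/

/-- `G[Ψ](t)`. -/
def G {n N : ℕ} (U : Set (E n)) (φ : E n → ℝ) (α : Fin (N + 1) → ℝ)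
    (a : Fin (N + 1) → E n → ℝ) (Ψ : ℝ → E n → ℝ) (t : ℝ) : ℝ :=
  max (∫ x in U, a (Fin.last N) x) 1
    + (∫ x in U, (a 0 x)⁻¹ * ‖gradient (Ψ t) x‖ ^ 2)
    + (∫ x in U, W1 α a x * ‖gradient (Ψ t) x‖ ^ (2 - expo α))
    + (∫ x in U, |dt Ψ t x| ^ 2 * φ x) ^ ((2 - expo α) / (2 * (1 - expo α)))

/-- `G₁[Ψ](t)`. -/
def G1 {n N : ℕ} (U : Set (E n)) (a : Fin (N + 1) → E n → ℝ) (Ψ : ℝ → E n → ℝ) (t : ℝ) : ℝ :=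
  ∫ x in U, (a 0 x)⁻¹ * ‖gradient (dt Ψ t) x‖ ^ 2

/-- `G₂[Ψ](t)`. -/
def G2 {n : ℕ} (U : Set (E n)) (φ : E n → ℝ) (Ψ : ℝ → E n → ℝ) (t : ℝ) : ℝ :=
  ∫ x in U, |dt (dt Ψ) t x| ^ 2 * φ x

/-- Regularity of an extension `Ψ` of the boundary data: the integrals in `G`, `G₁`, `G₂` are
finite and these three quantities are continuous in time. -/
structure IsBoundaryData {n N : ℕ} (U : Set (E n)) (φ : E n → ℝ) (α : Fin (N + 1) → ℝ)
    (a : Fin (N + 1) → E n → ℝ) (Ψ : ℝ → E n → ℝ) : Prop where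
  regular : Regular U Ψ
  diff_dt : ∀ t > 0, ∀ x ∈ U, DifferentiableAt ℝ (fun s => dt Ψ s x) t
  integrable_grad : ∀ t > 0, IntegrableOn (fun x => (a 0 x)⁻¹ * ‖gradient (Ψ t) x‖ ^ 2) U
  integrable_grad_W1 : ∀ t > 0,
    IntegrableOn (fun x => W1 α a x * ‖gradient (Ψ t) x‖ ^ (2 - expo α)) U
  integrable_grad_dt : ∀ t > 0,
    IntegrableOn (fun x => (a 0 x)⁻¹ * ‖gradient (dt Ψ t) x‖ ^ 2) U
  integrable_dt_dt : ∀ t > 0, IntegrableOn (fun x => |dt (dt Ψ) t x| ^ 2 * φ x) U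
  cont_G : ContinuousOn (G U φ α a Ψ) (Ioi 0)
  cont_G1 : ContinuousOn (G1 U a Ψ) (Ioi 0)
  cont_G2 : ContinuousOn (G2 U φ Ψ) (Ioi 0)

/-- `M` is a continuous increasing function on `[0, ∞)` that bounds `f` from above. -/
structure IsMajorant (M f : ℝ → ℝ) : Prop where
  cont : ContinuousOn M (Ici 0)
  mono : MonotoneOn M (Ici 0)
  le : ∀ t > 0, f t ≤ M t

/-- `limsup f(t)` as `t → ∞`, for `f ≥ 0`, with values in `[0, ∞]`. -/
def limsupInf (f : ℝ → ℝ) : ℝ≥0∞ :=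
  limsup (fun t => ENNReal.ofReal (f t)) atTop

/-- `𝓐[Ψ₁] + 𝓐[Ψ₂]`, where `𝓐[Ψ] = limsup G[Ψ](t)`. -/
def Atilde {n N : ℕ} (U : Set (E n)) (φ : E n → ℝ) (α : Fin (N + 1) → ℝ)
    (a : Fin (N + 1) → E n → ℝ) (Ψ₁ Ψ₂ : ℝ → E n → ℝ) : ℝ≥0∞ :=
  limsupInf (G U φ α a Ψ₁) + limsupInf (G U φ α a Ψ₂)

/-- `𝓑[Ψ₁] + 𝓑[Ψ₂]`, where `𝓑[Ψ] = limsup [G[Ψ]'(t)]⁻` (negative part). -/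
def Btilde {n N : ℕ} (U : Set (E n)) (φ : E n → ℝ) (α : Fin (N + 1) → ℝ)
    (a : Fin (N + 1) → E n → ℝ) (Ψ₁ Ψ₂ : ℝ → E n → ℝ) : ℝ≥0∞ :=
  limsupInf (fun t => max (-deriv (G U φ α a Ψ₁) t) 0)
    + limsupInf (fun t => max (-deriv (G U φ α a Ψ₂) t) 0)

/-- `∫_{t-1}^t (G̃₁ + G̃₂) dτ`, where `G̃_k = G_k[Ψ₁] + G_k[Ψ₂]`. -/
def window {n N : ℕ} (U : Set (E n)) (φ : E n → ℝ) (a : Fin (N + 1) → E n → ℝ)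
    (Ψ₁ Ψ₂ : ℝ → E n → ℝ) (t : ℝ) : ℝ :=
  ∫ τ in (t - 1)..t, ((G1 U a Ψ₁ τ + G1 U a Ψ₂ τ) + (G2 U φ Ψ₁ τ + G2 U φ Ψ₂ τ))

/-- The growth function `V` in the general case; `M₁`, `M₂` are the majorants of
`G[Ψ₁]`, `G[Ψ₂]`. -/
def Vgen {n N : ℕ} (U : Set (E n)) (φ : E n → ℝ) (α : Fin (N + 1) → ℝ)
    (a : Fin (N + 1) → E n → ℝ) (Ψ₁ Ψ₂ : ℝ → E n → ℝ) (M₁ M₂ : ℝ → ℝ) (t : ℝ) : ℝ :=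
  (M₁ t + M₂ t) ^ (2 / (2 - expo α)) + window U φ a Ψ₁ Ψ₂ t

/-- The growth function `V` that is used when `Btilde` is finite. -/
def Vfin {n N : ℕ} (U : Set (E n)) (φ : E n → ℝ) (α : Fin (N + 1) → ℝ)
    (a : Fin (N + 1) → E n → ℝ) (Ψ₁ Ψ₂ : ℝ → E n → ℝ) (t : ℝ) : ℝ :=
  (Btilde U φ α a Ψ₁ Ψ₂).toReal ^ (1 / (1 - expo α))
    + (G U φ α a Ψ₁ t + G U φ α a Ψ₂ t) ^ (2 / (2 - expo α)) + window U φ a Ψ₁ Ψ₂ t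

/-- The size `D(t)` of the difference `Φ` of the boundary data. -/
def D {n N : ℕ} (U : Set (E n)) (φ : E n → ℝ) (a : Fin (N + 1) → E n → ℝ)
    (Φ : ℝ → E n → ℝ) (t : ℝ) : ℝ :=
  (∫ x in U, (a 0 x)⁻¹ * ‖gradient (Φ t) x‖ ^ 2)
    + (∫ x in U, (a 0 x)⁻¹ * ‖gradient (Φ t) x‖ ^ 2) ^ (1 / 2 : ℝ)
    + (∫ x in U, |dt Φ t x| ^ 2 * φ x) ^ (1 / 2 : ℝ)

/-- `∫_1^∞ V(t) ^ (-a / (2 - a)) dt = ∞`. -/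
def DivergentIntegral {N : ℕ} (α : Fin (N + 1) → ℝ) (V : ℝ → ℝ) : Prop :=
  ∫⁻ t in Ici (1 : ℝ), ENNReal.ofReal (V t ^ (-(expo α / (2 - expo α)))) = ⊤

end

end Forchheimer

namespace Forchheimer

noncomputable section

/-! ### Pointwise properties of the conductivity -/

/-! The difference `P = (p₁ - Ψ₁) - (p₂ - Ψ₂)` vanishes on the boundary, so it may be tested against
the difference of the two equations. The flux `K(|y|) y` is monotone, but only with the degenerate
weight `K` evaluated at the larger gradient, and this weight has no positive lower bound.
`IsCoeff.flux_monotone` and `IsCoeff.weight_mul_rpow_le_mul` (pointwise), then Hölder's inequality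
and the Poincaré-Sobolev inequality (`Setting.mass_le_of_coercivity`), still give `‖P‖² ≤ C
Λ^(a/(2-a)) ∫ K |∇P|²`, where `Λ` bounds the energies `∫ K(|∇pᵢ|) |∇pᵢ|²` plus `B₁`. If `Λ` also
bounds `‖P‖²`, the boundary terms cost `4 Λ^(1/2) D`. Thus `Setting.difference_inequality` says `Y'
≤ -c Λ^(-a/(2-a)) Y + 4 Λ^(1/2) D` for `Y = ‖P‖²`.

It remains to see that `Λ` can be taken as a constant times `V`. Testing with `p - Ψ` yields `y' ≤
-c y^θ - E/2 + C G` for `y = ‖p - Ψ‖²`, with `E` the energy and `θ = (2-a)/2`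
(`Setting.energy_inequality`). A barrier argument then bounds `y` eventually by a multiple of `V`:
the barrier is a power of an increasing majorant of `G` (`eventually_le_of_majorant`), or of `G`
plus a constant when `G'` is bounded below (`eventually_le_of_deriv_ge`). Testing with `∂ₜ(p - Ψ)`
controls the growth of `J = ∫ H(x, |∇p|)`, a convex potential comparable to `E`
(`Setting.potential_inequality`). Combining both inequalities on `[t-1, t]` bounds `E(t)` by
`y(t-1)` and integrals of `G` and `G₁` over that unit window (`le_add_integral_of_deriv_le`), which
explains the window integral in `V`.

With `Λ = C V` the inequality for `Y` is linear with damping rate `c V^(-a/(2-a))`, whose integral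
diverges, so the initial value is forgotten and `limsup Y` is at most the limsup of forcing over
damping. That quotient is a multiple of `V^(a/(2-a) + 1/2) D = V^κ₀ D`
(`limsupInf_le_of_differential_inequality`). -/

/-- Admissible exponents and coefficients of the Forchheimer polynomial at one point. -/
structure IsCoeff {N : ℕ} (α c : Fin (N + 1) → ℝ) : Prop where
  zero : α 0 = 0
  mono : StrictMono α
  pos : 0 < c 0
  nonneg : ∀ j, 0 ≤ c j
  last_pos : 0 < c (Fin.last N)
  one_le : 1 ≤ N

/-- The conductivity `ξ ↦ 1 / g(s(ξ))` at one point. -/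
def cond {N : ℕ} (α c : Fin (N + 1) → ℝ) (ξ : ℝ) : ℝ :=
  1 / g α c (root α c ξ)

/-- The potential `H(ξ) = 2 ∫₀^ξ K(σ) σ dσ`, written in terms of `s(ξ)`. -/
def potential {N : ℕ} (α c : Fin (N + 1) → ℝ) (ξ : ℝ) : ℝ :=
  ∑ j, 2 * c j * ((α j + 1) / (α j + 2)) * root α c ξ ^ (α j + 2)

/-- The weight `W₁` at one point. -/
def weight {N : ℕ} (α c : Fin (N + 1) → ℝ) : ℝ :=
  c (Fin.last N) ^ expo α / (2 * N * Finset.univ.sup' Finset.univ_nonempty c)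

theorem root_nonneg {N : ℕ} (α c : Fin (N + 1) → ℝ) (ξ : ℝ) : 0 ≤ root α c ξ := by
  unfold root
  split_ifs with h
  · exact h.choose_spec.1
  · exact le_rfl

/-- Bernoulli's inequality for `(y / x) ^ p`, multiplied by `x ^ p`. -/
theorem rpow_sub_rpow_le {x y p : ℝ} (hy : 0 ≤ y) (hyx : y ≤ x) (hp : 1 ≤ p) :
    x ^ p - y ^ p ≤ p * x ^ (p - 1) * (x - y) := by
  rcases (hy.trans hyx).eq_or_lt with h0 | h0
  · have : y = x := le_antisymm hyx (h0 ▸ hy)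
    simp [this]
  · have hs : -1 ≤ (y - x) / x := by
      rw [le_div_iff₀ h0]; linarith
    have h := one_add_mul_self_le_rpow_one_add hs hp
    have h1 : 1 + (y - x) / x = y / x := by field_simp; ring
    rw [h1, Real.div_rpow hy h0.le, le_div_iff₀ (Real.rpow_pos_of_pos h0 _)] at h
    have h2 : x ^ p = x ^ (p - 1) * x := by
      rw [← Real.rpow_add_one h0.ne']; congr 1; ring
    have h3 : (1 + p * ((y - x) / x)) * x ^ p = x ^ p - p * x ^ (p - 1) * (x - y) := by
      rw [h2]; field_simp; ring
    linarith

namespace IsCoeff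

variable {N : ℕ} {α c : Fin (N + 1) → ℝ} (h : IsCoeff α c)
include h

theorem exponent_nonneg (j : Fin (N + 1)) : 0 ≤ α j := by
  have := h.mono.monotone (Fin.zero_le j)
  rwa [h.zero] at this

theorem exponent_le_last (j : Fin (N + 1)) : α j ≤ α (Fin.last N) :=
  h.mono.monotone (Fin.le_last j)

theorem last_exponent_pos : 0 < α (Fin.last N) := by
  have h1 : (0 : Fin (N + 1)) < Fin.last N := by
    rw [Fin.lt_def]; have := h.one_le; simp; omega
  simpa [h.zero] using h.mono h1

theorem coeff_zero_le_g {s : ℝ} (hs : 0 ≤ s) : c 0 ≤ g α c s := by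
  have h1 := Finset.single_le_sum (f := fun j => c j * s ^ α j)
    (fun j _ => mul_nonneg (h.nonneg j) (Real.rpow_nonneg hs _)) (Finset.mem_univ 0)
  simpa [g, h.zero] using h1

theorem last_term_le_g {s : ℝ} (hs : 0 ≤ s) :
    c (Fin.last N) * s ^ α (Fin.last N) ≤ g α c s :=
  Finset.single_le_sum (f := fun j => c j * s ^ α j)
    (fun j _ => mul_nonneg (h.nonneg j) (Real.rpow_nonneg hs _)) (Finset.mem_univ _)

theorem g_pos {s : ℝ} (hs : 0 ≤ s) : 0 < g α c s := h.pos.trans_le (h.coeff_zero_le_g hs)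

theorem g_mono {r s : ℝ} (hr : 0 ≤ r) (hrs : r ≤ s) : g α c r ≤ g α c s :=
  Finset.sum_le_sum fun j _ =>
    mul_le_mul_of_nonneg_left (Real.rpow_le_rpow hr hrs (h.exponent_nonneg j)) (h.nonneg j)

theorem root_mul_g {ξ : ℝ} (hξ : 0 ≤ ξ) : root α c ξ * g α c (root α c ξ) = ξ := by
  have hex := (existsUnique_root h.zero h.mono h.pos h.nonneg hξ).exists
  unfold root
  rw [dif_pos hex]
  exact hex.choose_spec.2

theorem g_root_pos (ξ : ℝ) : 0 < g α c (root α c ξ) := h.g_pos (root_nonneg _ _ _)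

theorem cond_pos (ξ : ℝ) : 0 < cond α c ξ := one_div_pos.2 (h.g_root_pos ξ)

theorem cond_le (ξ : ℝ) : cond α c ξ ≤ (c 0)⁻¹ := by
  unfold cond
  rw [one_div]
  exact inv_anti₀ h.pos (h.coeff_zero_le_g (root_nonneg _ _ _))

theorem cond_mul {ξ : ℝ} (hξ : 0 ≤ ξ) : cond α c ξ * ξ = root α c ξ := by
  have := h.root_mul_g hξ
  have h1 := h.g_root_pos ξ
  unfold cond
  rw [one_div, inv_mul_eq_div, div_eq_iff h1.ne', this]

theorem mul_g_eq {s : ℝ} (hs : 0 ≤ s) : s * g α c s = ∑ j, c j * s ^ (α j + 1) := by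
  rw [g, Finset.mul_sum]
  refine Finset.sum_congr rfl fun j _ => ?_
  rw [Real.rpow_add_one' hs (by have := h.exponent_nonneg j; positivity)]
  ring

theorem sub_mul_le {r s : ℝ} (hr : 0 ≤ r) (hrs : r ≤ s) :
    (s - r) * g α c s ≤ s * g α c s - r * g α c r := by
  have := mul_le_mul_of_nonneg_left (h.g_mono hr hrs) hr
  linarith

/-- Each power `s ^ (α j + 1)` has slope at most `(α_N + 1) s ^ α j`. The factor `α_N + 1 = 1 / (1 -
a)` is the source of the monotonicity constant `1 - a`. -/
theorem mul_g_sub_le {r s : ℝ} (hr : 0 ≤ r) (hrs : r ≤ s) :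
    s * g α c s - r * g α c r ≤ (α (Fin.last N) + 1) * g α c s * (s - r) := by
  rw [h.mul_g_eq hr, h.mul_g_eq (hr.trans hrs), ← Finset.sum_sub_distrib, g, Finset.mul_sum,
    Finset.sum_mul]
  refine Finset.sum_le_sum fun j _ => ?_
  have h1 := rpow_sub_rpow_le hr hrs (p := α j + 1) (by linarith [h.exponent_nonneg j])
  rw [add_sub_cancel_right] at h1
  have h2 : (α j + 1) * (s ^ α j * (s - r)) ≤ (α (Fin.last N) + 1) * (s ^ α j * (s - r)) :=
    mul_le_mul_of_nonneg_right (by linarith [h.exponent_le_last j])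
      (mul_nonneg (Real.rpow_nonneg (hr.trans hrs) _) (by linarith))
  have h3 := mul_le_mul_of_nonneg_left (h1.trans (by linarith :
    (α j + 1) * s ^ α j * (s - r) ≤ (α (Fin.last N) + 1) * (s ^ α j * (s - r)))) (h.nonneg j)
  linarith

/-- Since `s ↦ s g(s)` is strictly increasing, inequalities for the implicit root become explicit
ones. Monotonicity and measurability of the root both rest on this. -/
theorem root_le_iff {ξ s : ℝ} (hξ : 0 ≤ ξ) (hs : 0 ≤ s) :
    root α c ξ ≤ s ↔ ξ ≤ s * g α c s := by
  have h1 := h.root_mul_g hξ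
  have h0 := root_nonneg α c ξ
  constructor
  · intro hle
    have := h.sub_mul_le h0 hle
    have h2 := mul_nonneg (sub_nonneg.2 hle) (h.g_pos hs).le
    linarith
  · intro hle
    by_contra! hlt
    have := h.sub_mul_le hs hlt.le
    have h2 := mul_pos (sub_pos.2 hlt) (h.g_pos h0)
    linarith

theorem root_mono {ξ η : ℝ} (hξ : 0 ≤ ξ) (hle : ξ ≤ η) : root α c ξ ≤ root α c η := by
  rw [h.root_le_iff hξ (root_nonneg _ _ _), h.root_mul_g (hξ.trans hle)]
  exact hle

theorem cond_anti {ξ η : ℝ} (hξ : 0 ≤ ξ) (hle : ξ ≤ η) : cond α c η ≤ cond α c ξ := by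
  unfold cond
  exact one_div_le_one_div_of_le (h.g_root_pos _)
    (h.g_mono (root_nonneg _ _ _) (h.root_mono hξ hle))

theorem root_sub_le {ξ η : ℝ} (hξ : 0 ≤ ξ) (hle : ξ ≤ η) :
    root α c η - root α c ξ ≤ (c 0)⁻¹ * (η - ξ) := by
  have h1 := h.sub_mul_le (root_nonneg α c ξ) (h.root_mono hξ hle)
  rw [h.root_mul_g hξ, h.root_mul_g (hξ.trans hle)] at h1
  have h2 := mul_le_mul_of_nonneg_left (h.coeff_zero_le_g (root_nonneg α c η))
    (sub_nonneg.2 (h.root_mono hξ hle))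
  rw [inv_mul_eq_div, le_div_iff₀ h.pos]
  linarith

theorem continuousOn_root : ContinuousOn (root α c) (Ici 0) := by
  have hl : LipschitzOnWith (Real.toNNReal (c 0)⁻¹) (root α c) (Ici 0) := by
    refine LipschitzOnWith.of_le_add_mul _ fun x hx y hy => ?_
    rw [Real.coe_toNNReal _ (inv_nonneg.2 h.pos.le), Real.dist_eq]
    have h0 : 0 ≤ (c 0)⁻¹ := inv_nonneg.2 h.pos.le
    rcases le_total x y with hxy | hxy
    · have := h.root_mono hx hxy
      have := mul_nonneg h0 (abs_nonneg (x - y))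
      linarith
    · have := h.root_sub_le hy hxy
      rw [abs_of_nonneg (by linarith)]
      linarith
  exact hl.continuousOn

theorem continuous_g : Continuous (g α c) := by
  unfold g
  exact continuous_finsetSum _ fun j _ =>
    continuous_const.mul (Real.continuous_rpow_const (h.exponent_nonneg j))

theorem continuousOn_cond : ContinuousOn (cond α c) (Ici 0) := by
  unfold cond
  exact continuousOn_const.div (h.continuous_g.comp_continuousOn h.continuousOn_root)
    fun x _ => (h.g_root_pos x).ne'

/-! #### The potential -/

theorem cond_mul_sq {ξ : ℝ} (hξ : 0 ≤ ξ) :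
    cond α c ξ * ξ ^ 2 = ∑ j, c j * root α c ξ ^ (α j + 2) := by
  have h0 := root_nonneg α c ξ
  have h1 : cond α c ξ * ξ ^ 2 = root α c ξ * (root α c ξ * g α c (root α c ξ)) := by
    rw [h.root_mul_g hξ, sq, ← mul_assoc, h.cond_mul hξ]
  rw [h1, h.mul_g_eq h0, Finset.mul_sum]
  refine Finset.sum_congr rfl fun j _ => ?_
  have := h.exponent_nonneg j
  rw [show α j + 2 = (α j + 1) + 1 by ring, Real.rpow_add_one' h0 (by positivity) (y := α j + 1)]
  ring

/-- Both sides are sums of `c j * s ^ (α j + 2)`; the coefficient ratios `2 (α j + 1) / (α j + 2)`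
lie in `[1, 2]`, which gives this bound and `potential_le`. -/
theorem cond_mul_sq_le_potential {ξ : ℝ} (hξ : 0 ≤ ξ) :
    cond α c ξ * ξ ^ 2 ≤ potential α c ξ := by
  rw [h.cond_mul_sq hξ, potential]
  refine Finset.sum_le_sum fun j _ => ?_
  have hj := h.exponent_nonneg j
  refine mul_le_mul_of_nonneg_right ?_ (Real.rpow_nonneg (root_nonneg _ _ _) _)
  have : 1 ≤ 2 * ((α j + 1) / (α j + 2)) := by
    rw [← mul_div_assoc, le_div_iff₀ (by positivity)]; linarith
  nlinarith [h.nonneg j]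

theorem potential_le {ξ : ℝ} (hξ : 0 ≤ ξ) :
    potential α c ξ ≤ 2 * (cond α c ξ * ξ ^ 2) := by
  rw [h.cond_mul_sq hξ, potential, Finset.mul_sum]
  refine Finset.sum_le_sum fun j _ => ?_
  have hj := h.exponent_nonneg j
  rw [← mul_assoc]
  refine mul_le_mul_of_nonneg_right ?_ (Real.rpow_nonneg (root_nonneg _ _ _) _)
  have : (α j + 1) / (α j + 2) ≤ 1 := by
    rw [div_le_one (by positivity)]; linarith
  nlinarith [h.nonneg j]

theorem potential_nonneg {ξ : ℝ} (hξ : 0 ≤ ξ) : 0 ≤ potential α c ξ :=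
  (mul_nonneg (h.cond_pos ξ).le (sq_nonneg ξ)).trans (h.cond_mul_sq_le_potential hξ)

/-- Tangent line inequality for the convex potential, whose slope is `2 K(ξ) ξ = 2 s(ξ)`. The root
is never differentiated: term by term this is Young's inequality for `s` and `r ^ (α j + 1)` with
exponents `α j + 2` and `(α j + 2) / (α j + 1)`. -/
theorem potential_sub_ge {ξ η : ℝ} (hξ : 0 ≤ ξ) (hη : 0 ≤ η) :
    2 * root α c ξ * (η - ξ) ≤ potential α c η - potential α c ξ := by
  set s := root α c ξ with hs
  set r := root α c η with hr
  have hs0 : 0 ≤ s := root_nonneg _ _ _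
  have hr0 : 0 ≤ r := root_nonneg _ _ _
  have e1 : η = ∑ j, c j * r ^ (α j + 1) := by rw [← h.mul_g_eq hr0, h.root_mul_g hη]
  have e2 : ξ = ∑ j, c j * s ^ (α j + 1) := by rw [← h.mul_g_eq hs0, h.root_mul_g hξ]
  have e3 : 2 * s * (η - ξ) = ∑ j, 2 * s * (c j * r ^ (α j + 1) - c j * s ^ (α j + 1)) := by
    conv_lhs => rw [e1, e2]
    rw [← Finset.sum_sub_distrib, Finset.mul_sum]
  rw [e3, potential, potential, ← hs, ← hr, ← Finset.sum_sub_distrib]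
  refine Finset.sum_le_sum fun j _ => ?_
  have hj := h.exponent_nonneg j
  have hpq : (α j + 2).HolderConjugate ((α j + 2) / (α j + 1)) := by
    rw [Real.holderConjugate_iff]
    refine ⟨by linarith, ?_⟩
    field_simp
    ring
  have hy := Real.young_inequality_of_nonneg hs0 (Real.rpow_nonneg hr0 (α j + 1)) hpq
  rw [← Real.rpow_mul hr0, mul_div_cancel₀ _ (by positivity)] at hy
  have e4 : s ^ (α j + 2) = s * s ^ (α j + 1) := by
    rw [show α j + 2 = (α j + 1) + 1 by ring, Real.rpow_add_one' hs0 (by positivity)]; ring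
  have e5 : s * r ^ (α j + 1) - s * s ^ (α j + 1) ≤
      (α j + 1) / (α j + 2) * r ^ (α j + 2) - (α j + 1) / (α j + 2) * s ^ (α j + 2) := by
    have e6 : s ^ (α j + 2) / (α j + 2) =
        s ^ (α j + 2) - (α j + 1) / (α j + 2) * s ^ (α j + 2) := by
      field_simp; ring
    have e7 : r ^ (α j + 2) / ((α j + 2) / (α j + 1)) =
        (α j + 1) / (α j + 2) * r ^ (α j + 2) := by
      field_simp
    rw [e6, e7] at hy
    linarith
  have := mul_le_mul_of_nonneg_left e5 (mul_nonneg zero_le_two (h.nonneg j))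
  linarith

theorem potential_sub_ge_inner {F : Type*} [NormedAddCommGroup F] [InnerProductSpace ℝ F]
    (y z : F) : 2 * (cond α c ‖y‖ * inner ℝ y (z - y)) ≤
      potential α c ‖z‖ - potential α c ‖y‖ := by
  refine le_trans ?_ (h.potential_sub_ge (norm_nonneg y) (norm_nonneg z))
  have h1 := real_inner_le_norm y z
  rw [inner_sub_right, real_inner_self_eq_norm_sq, ← h.cond_mul (norm_nonneg y)]
  have := mul_le_mul_of_nonneg_left h1 (h.cond_pos ‖y‖).le
  linarith

/-- The tangent inequalities at `y t` and at `y s` squeeze the difference quotient between two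
expressions with the same limit. This also covers `y t = 0`, where the norm is not differentiable.
-/
theorem hasDerivAt_potential {F : Type*} [NormedAddCommGroup F] [InnerProductSpace ℝ F]
    {y : ℝ → F} {y' : F} {t : ℝ} (hy : HasDerivAt y y' t) :
    HasDerivAt (fun s => potential α c ‖y s‖) (2 * (cond α c ‖y t‖ * inner ℝ (y t) y')) t := by
  rw [hasDerivAt_iff_tendsto_slope]
  have hsl := hasDerivAt_iff_tendsto_slope.1 hy
  have hyc : Tendsto y (𝓝[≠] t) (𝓝 (y t)) := hy.continuousAt.tendsto.mono_left nhdsWithin_le_nhds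
  have hcc : Tendsto (fun s => cond α c ‖y s‖) (𝓝[≠] t) (𝓝 (cond α c ‖y t‖)) := by
    have h1 := h.continuousOn_cond ‖y t‖ (norm_nonneg _)
    refine h1.tendsto.comp (tendsto_nhdsWithin_iff.2 ⟨hyc.norm, ?_⟩)
    exact Eventually.of_forall fun s => norm_nonneg _
  have hl : Tendsto (fun s => 2 * (cond α c ‖y t‖ * inner ℝ (y t) (slope y t s))) (𝓝[≠] t)
      (𝓝 (2 * (cond α c ‖y t‖ * inner ℝ (y t) y'))) :=
    ((tendsto_const_nhds.inner hsl).const_mul _).const_mul _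
  have hu : Tendsto (fun s => 2 * (cond α c ‖y s‖ * inner ℝ (y s) (slope y t s))) (𝓝[≠] t)
      (𝓝 (2 * (cond α c ‖y t‖ * inner ℝ (y t) y'))) :=
    (hcc.mul (hyc.inner hsl)).const_mul _
  -- Which of the two expressions is the lower bound depends on the sign of `s - t`; minimum and
  -- maximum treat both signs at once.
  have hmin := hl.min hu
  have hmax := hl.max hu
  rw [min_self] at hmin
  rw [max_self] at hmax
  refine tendsto_of_tendsto_of_tendsto_of_le_of_le' hmin hmax ?_ ?_
  all_goals
    filter_upwards [self_mem_nhdsWithin] with s hs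
    have hst : s - t ≠ 0 := sub_ne_zero.2 hs
    have k1 := h.potential_sub_ge_inner (y t) (y s)
    have k2 := h.potential_sub_ge_inner (y s) (y t)
    have e0 : y s - y t = (s - t) • slope y t s := by
      rw [slope_def_module, smul_smul, mul_inv_cancel₀ hst, one_smul]
    have e1 : y t - y s = -((s - t) • slope y t s) := by rw [← e0]; abel
    rw [e0, inner_smul_right] at k1
    rw [e1, inner_neg_right, inner_smul_right] at k2
    set A := inner ℝ (y t) (slope y t s)
    set B := inner ℝ (y s) (slope y t s)
    rw [slope_def_field]
    rcases lt_or_gt_of_ne hst with hneg | hpos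
    · first
      | (refine min_le_iff.2 (Or.inr ?_)
         rw [le_div_iff_of_neg hneg]; linarith)
      | (refine le_max_iff.2 (Or.inl ?_)
         rw [div_le_iff_of_neg hneg]; linarith)
    · first
      | (refine min_le_iff.2 (Or.inl ?_)
         rw [le_div_iff₀ hpos]; linarith)
      | (refine le_max_iff.2 (Or.inr ?_)
         rw [div_le_iff₀ hpos]; linarith)

/-! #### Monotonicity and degenerate coercivity -/

theorem expo_pos : 0 < expo α := by
  have := h.last_exponent_pos
  unfold expo; positivity

theorem expo_lt_one : expo α < 1 := by
  have := h.last_exponent_pos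
  unfold expo
  rw [div_lt_one (by positivity)]; linarith

theorem one_sub_expo : 1 - expo α = (α (Fin.last N) + 1)⁻¹ := by
  have := h.last_exponent_pos
  unfold expo; field_simp; ring

/-- Right side minus left side is affine and decreasing in `⟪y, z⟫`, because `K(|y|) ≤ K(|z|)` and
`1 - a ≤ 1`. The worst case is therefore `⟪y, z⟫ = |y| |z|`, where the claim reduces to the scalar
bound of `mul_g_sub_le` for the roots. -/
theorem flux_monotone_of_le {F : Type*} [NormedAddCommGroup F] [InnerProductSpace ℝ F]
    {y z : F} (hle : ‖z‖ ≤ ‖y‖) :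
    (1 - expo α) * (cond α c ‖y‖ * ‖y - z‖ ^ 2) ≤
      inner ℝ (cond α c ‖y‖ • y - cond α c ‖z‖ • z) (y - z) := by
  have hA := h.last_exponent_pos
  set k := cond α c ‖y‖ with hk
  set l := cond α c ‖z‖ with hl
  have hk0 : 0 < k := h.cond_pos _
  have hkl : k ≤ l := h.cond_anti (norm_nonneg z) hle
  have hc : 1 - expo α = (α (Fin.last N) + 1)⁻¹ := h.one_sub_expo
  have hc0 : 0 < 1 - expo α := by linarith [h.expo_lt_one]
  have hc1 : 1 - expo α ≤ 1 := by linarith [h.expo_pos]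
  have e1 : inner ℝ (k • y - l • z) (y - z) = k * ‖y‖ ^ 2 + l * ‖z‖ ^ 2 - (k + l) * inner ℝ y z := by
    simp only [inner_sub_left, inner_sub_right, real_inner_smul_left, real_inner_self_eq_norm_sq,
      real_inner_comm z y]
    rw [real_inner_comm y z]
    ring
  have e2 : ‖y - z‖ ^ 2 = ‖y‖ ^ 2 + ‖z‖ ^ 2 - 2 * inner ℝ y z := by
    rw [norm_sub_sq_real]; ring
  rw [e1, e2]
  have hin := real_inner_le_norm y z
  have hcoef : 0 ≤ k + l - 2 * ((1 - expo α) * k) := by nlinarith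
  have h1 := mul_le_mul_of_nonneg_left hin hcoef
  have h2 : (1 - expo α) * (k * (‖y‖ - ‖z‖)) ≤ root α c ‖y‖ - root α c ‖z‖ := by
    have h3 := h.mul_g_sub_le (root_nonneg α c ‖z‖) (h.root_mono (norm_nonneg z) hle)
    rw [h.root_mul_g (norm_nonneg z), h.root_mul_g (norm_nonneg y)] at h3
    have h4 := mul_le_mul_of_nonneg_left h3 (mul_pos hc0 hk0).le
    have h5 : (1 - expo α) * k * ((α (Fin.last N) + 1) * g α c (root α c ‖y‖) *
        (root α c ‖y‖ - root α c ‖z‖)) = root α c ‖y‖ - root α c ‖z‖ := by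
      rw [hc, hk, cond]
      have := (h.g_root_pos ‖y‖).ne'
      field_simp
    linarith
  rw [← h.cond_mul (norm_nonneg y), ← h.cond_mul (norm_nonneg z), ← hk, ← hl] at h2
  have h6 := mul_le_mul_of_nonneg_right h2 (sub_nonneg.2 hle)
  nlinarith

theorem flux_monotone {F : Type*} [NormedAddCommGroup F] [InnerProductSpace ℝ F] (y z : F) :
    (1 - expo α) * (cond α c (max ‖y‖ ‖z‖) * ‖y - z‖ ^ 2) ≤
      inner ℝ (cond α c ‖y‖ • y - cond α c ‖z‖ • z) (y - z) := by
  rcases le_total ‖z‖ ‖y‖ with hle | hle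
  · rw [max_eq_left hle]; exact h.flux_monotone_of_le hle
  · rw [max_eq_right hle, norm_sub_rev]
    refine (h.flux_monotone_of_le hle).trans_eq ?_
    rw [← inner_neg_neg]; congr 1 <;> abel

theorem sup_pos : 0 < Finset.univ.sup' Finset.univ_nonempty c :=
  h.pos.trans_le (Finset.le_sup' c (Finset.mem_univ 0))

theorem weight_pos : 0 < weight α c := by
  have h1 := h.sup_pos
  have h2 : (0 : ℝ) < N := by exact_mod_cast h.one_le
  have h3 := h.last_pos
  unfold weight; positivity

theorem g_le_sup {s : ℝ} (hs : 0 ≤ s) :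
    g α c s ≤ (2 * N * Finset.univ.sup' Finset.univ_nonempty c) * max 1 (s ^ α (Fin.last N)) := by
  have hM := h.sup_pos
  set M := Finset.univ.sup' Finset.univ_nonempty c
  have hN : (1 : ℝ) ≤ N := by exact_mod_cast h.one_le
  have h1 : ∀ j ∈ Finset.univ, c j * s ^ α j ≤ M * max 1 (s ^ α (Fin.last N)) := fun j _ => by
    refine mul_le_mul (Finset.le_sup' c (Finset.mem_univ j)) ?_ (Real.rpow_nonneg hs _) hM.le
    rcases le_total s 1 with h1 | h1
    · exact (Real.rpow_le_one hs h1 (h.exponent_nonneg j)).trans (le_max_left _ _)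
    · exact (Real.rpow_le_rpow_of_exponent_le h1 (h.exponent_le_last j)).trans (le_max_right _ _)
  have h2 := Finset.sum_le_card_nsmul _ _ _ h1
  rw [Finset.card_univ, Fintype.card_fin, nsmul_eq_mul] at h2
  -- There are `N + 1` terms, and `N + 1 ≤ 2 * N` since `N ≥ 1`; hence the `2 N` in the weight.
  refine h2.trans ?_
  push_cast
  have h3 : 0 < M * max 1 (s ^ α (Fin.last N)) := mul_pos hM (by positivity)
  nlinarith

/-- With `a = α_N / (α_N + 1)` one has `c_N ^ a * s ^ α_N = (c_N s ^ (α_N + 1)) ^ a ≤ ξ ^ a`, as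
`c_N s ^ (α_N + 1)` is one term of `s g(s) = ξ`. Together with `g_le_sup` this bounds `g(s)` from
above, that is, `K` from below. -/
theorem weight_le {ξ : ℝ} (hξ : 0 ≤ ξ) :
    weight α c ≤ cond α c ξ * max (c (Fin.last N)) ξ ^ expo α := by
  set s := root α c ξ with hs
  have hs0 : 0 ≤ s := root_nonneg _ _ _
  have hA := h.last_exponent_pos
  have hg := h.g_le_sup hs0
  have hg0 := h.g_root_pos ξ
  have hM := h.sup_pos
  have hN : (0 : ℝ) < N := by exact_mod_cast h.one_le
  have hd : 0 < 2 * N * Finset.univ.sup' Finset.univ_nonempty c := by positivity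
  have hl := h.last_pos
  have key : c (Fin.last N) ^ expo α * max 1 (s ^ α (Fin.last N)) ≤
      max (c (Fin.last N)) ξ ^ expo α := by
    rw [mul_max_of_nonneg _ _ (Real.rpow_nonneg hl.le _), mul_one]
    refine max_le (Real.rpow_le_rpow hl.le (le_max_left _ _) h.expo_pos.le) ?_
    have e1 : s ^ α (Fin.last N) = (s ^ (α (Fin.last N) + 1)) ^ expo α := by
      rw [← Real.rpow_mul hs0, expo, mul_div_cancel₀ _ (by positivity)]
    rw [e1, ← Real.mul_rpow hl.le (Real.rpow_nonneg hs0 _)]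
    refine Real.rpow_le_rpow (by positivity) (le_max_of_le_right ?_) h.expo_pos.le
    have h2 := mul_le_mul_of_nonneg_left (h.last_term_le_g hs0) hs0
    rw [hs, h.root_mul_g hξ, ← hs] at h2
    rw [Real.rpow_add_one' hs0 (by positivity)]
    linarith
  unfold weight cond
  rw [← hs, one_div, inv_mul_eq_div, div_le_div_iff₀ hd (h.g_pos hs0)]
  calc c (Fin.last N) ^ expo α * g α c s
      ≤ c (Fin.last N) ^ expo α * ((2 * N * Finset.univ.sup' Finset.univ_nonempty c) *
          max 1 (s ^ α (Fin.last N))) :=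
        mul_le_mul_of_nonneg_left hg (Real.rpow_nonneg hl.le _)
    _ = (c (Fin.last N) ^ expo α * max 1 (s ^ α (Fin.last N))) *
          (2 * N * Finset.univ.sup' Finset.univ_nonempty c) := by ring
    _ ≤ _ := mul_le_mul_of_nonneg_right key hd.le

/-- For `ξ ≥ c_N`, `weight_le` times `ξ ^ (2 - a)` gives `K ξ ^ 2`. For smaller `ξ` the left side is
`c_N ^ 2 / (2 N max c_j) ≤ c_N`. -/
theorem weight_mul_max_le {ξ : ℝ} (hξ : 0 ≤ ξ) :
    weight α c * max (c (Fin.last N)) ξ ^ (2 - expo α) ≤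
      cond α c ξ * ξ ^ 2 + c (Fin.last N) := by
  have hl := h.last_pos
  have ha := h.expo_lt_one
  have ha0 := h.expo_pos
  rcases le_total (c (Fin.last N)) ξ with hle | hle
  · have hξ0 : 0 < ξ := hl.trans_le hle
    have h1 := mul_le_mul_of_nonneg_right (h.weight_le hξ) (Real.rpow_nonneg hξ (2 - expo α))
    rw [max_eq_right hle] at h1 ⊢
    rw [mul_assoc, ← Real.rpow_add hξ0, add_sub_cancel, Real.rpow_two] at h1
    linarith
  · rw [max_eq_left hle]
    have h2 : weight α c * c (Fin.last N) ^ (2 - expo α) ≤ c (Fin.last N) := by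
      have hM : c (Fin.last N) ≤ Finset.univ.sup' Finset.univ_nonempty c :=
        Finset.le_sup' c (Finset.mem_univ _)
      have hN : (1 : ℝ) ≤ N := by exact_mod_cast h.one_le
      have hM0 := h.sup_pos
      unfold weight
      rw [div_mul_eq_mul_div, ← Real.rpow_add hl, add_sub_cancel, Real.rpow_two,
        div_le_iff₀ (by positivity), sq]
      refine mul_le_mul_of_nonneg_left ?_ hl.le
      nlinarith
    have := mul_nonneg (h.cond_pos ξ).le (sq_nonneg ξ)
    linarith

theorem weight_mul_rpow_le {ξ : ℝ} (hξ : 0 ≤ ξ) :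
    weight α c * ξ ^ (2 - expo α) ≤ cond α c ξ * ξ ^ 2 + c (Fin.last N) := by
  refine le_trans ?_ (h.weight_mul_max_le hξ)
  exact mul_le_mul_of_nonneg_left (Real.rpow_le_rpow hξ (le_max_right _ _)
    (by linarith [h.expo_lt_one])) h.weight_pos.le

/-- The pointwise form of the degenerate coercivity. -/
theorem weight_mul_rpow_le_mul {ξ z : ℝ} (hξ : 0 ≤ ξ) (hz : 0 ≤ z) :
    weight α c * z ^ (2 - expo α) ≤
      (cond α c ξ * z ^ 2) ^ ((2 - expo α) / 2) *
        (cond α c ξ * ξ ^ 2 + c (Fin.last N)) ^ (expo α / 2) := by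
  have hw := h.weight_pos
  have ha := h.expo_lt_one
  have ha0 := h.expo_pos
  have hk := h.cond_pos ξ
  set m := max (c (Fin.last N)) ξ with hm
  have hm0 : 0 < m := h.last_pos.trans_le (le_max_left _ _)
  set A := expo α
  -- Only the first factor of `W = W ^ ((2-a)/2) * W ^ (a/2)` is estimated by `weight_le`; the power
  -- of `m` thus released completes the second factor to `(W m ^ (2-a)) ^ (a/2)`.
  have h1 : weight α c ≤ cond α c ξ ^ ((2 - A) / 2) * (weight α c * m ^ (2 - A)) ^ (A / 2) := by
    calc weight α c = weight α c ^ ((2 - A) / 2) * weight α c ^ (A / 2) := by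
          rw [← Real.rpow_add hw]; ring_nf; rw [Real.rpow_one]
      _ ≤ (cond α c ξ * m ^ A) ^ ((2 - A) / 2) * weight α c ^ (A / 2) :=
          mul_le_mul_of_nonneg_right (Real.rpow_le_rpow hw.le (h.weight_le hξ) (by linarith))
            (Real.rpow_nonneg hw.le _)
      _ = _ := by
          rw [Real.mul_rpow hk.le (by positivity), Real.mul_rpow hw.le (by positivity),
            ← Real.rpow_mul hm0.le, ← Real.rpow_mul hm0.le]
          ring_nf
  have h2 : z ^ (2 - A) = (z ^ 2) ^ ((2 - A) / 2) := by
    rw [← Real.rpow_natCast, ← Real.rpow_mul hz]; congr 1; push_cast; ring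
  rw [Real.mul_rpow hk.le (by positivity), h2]
  calc weight α c * (z ^ 2) ^ ((2 - A) / 2)
      ≤ (cond α c ξ ^ ((2 - A) / 2) * (weight α c * m ^ (2 - A)) ^ (A / 2)) *
          (z ^ 2) ^ ((2 - A) / 2) := mul_le_mul_of_nonneg_right h1 (by positivity)
    _ ≤ (cond α c ξ ^ ((2 - A) / 2) * (cond α c ξ * ξ ^ 2 + c (Fin.last N)) ^ (A / 2)) *
          (z ^ 2) ^ ((2 - A) / 2) := by
        gcongr
        exact h.weight_mul_max_le hξ
    _ = _ := by ring

end IsCoeff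

/-! ### Measurability of the root in the space variable -/

theorem aemeasurable_root {X : Type*} [MeasurableSpace X] {μ : Measure X} {U : Set X}
    (hU : MeasurableSet U) {N : ℕ} {α : Fin (N + 1) → ℝ} {c : Fin (N + 1) → X → ℝ}
    (hc : ∀ x ∈ U, IsCoeff α (fun j => c j x)) (hm : ∀ j, Measurable (c j)) {ξ : X → ℝ}
    (hξ : Measurable ξ) (hξ0 : ∀ x, 0 ≤ ξ x) :
    AEMeasurable (fun x => root α (fun j => c j x) (ξ x)) (μ.restrict U) := by
  refine aemeasurable_restrict_of_measurable_subtype hU (measurable_of_Iic fun s => ?_)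
  rcases lt_or_ge s 0 with hs | hs
  · convert MeasurableSet.empty
    ext x
    simp only [mem_preimage, mem_Iic, mem_empty_iff_false, iff_false, not_le]
    exact hs.trans_le (root_nonneg _ _ _)
  -- For fixed `s` the sublevel set of the root is described by an inequality between explicit
  -- measurable functions.
  · have : ((fun x : U => root α (fun j => c j x) (ξ x)) ⁻¹' Iic s) =
        {x : U | ξ x ≤ s * g α (fun j => c j x) s} := by
      ext x
      exact (hc x x.2).root_le_iff (hξ0 x) hs
    rw [this]
    refine measurableSet_le (hξ.comp measurable_subtype_coe) (measurable_const.mul ?_)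
    unfold g
    exact Finset.measurable_sum _ fun j _ =>
      ((hm j).comp measurable_subtype_coe).mul_const _

/-! ### Differential inequalities -/

theorem sub_le_of_hasDerivAt_le {w w' : ℝ → ℝ} {s t m : ℝ} (hst : s ≤ t)
    (hw : ∀ τ ∈ Icc s t, HasDerivAt w (w' τ) τ) (hm : ∀ τ ∈ Icc s t, w' τ ≤ m) :
    w t - w s ≤ m * (t - s) := by
  have h := intervalIntegral.sub_le_integral_of_hasDeriv_right_of_le (φ := fun _ => m) hst
    (fun τ hτ => (hw τ hτ).continuousAt.continuousWithinAt)
    (fun τ hτ => (hw τ (Ioo_subset_Icc_self hτ)).hasDerivWithinAt)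
    (by simp) (fun τ hτ => hm τ (Ioo_subset_Icc_self hτ))
  simpa [mul_comm] using h

/-- A continuous function that decreases at a fixed rate wherever it is positive is eventually
non-positive. -/
theorem eventually_nonpos_of_decrease {w : ℝ → ℝ} {T m : ℝ} (hm : 0 < m)
    (hw : ContinuousOn w (Ici T))
    (h : ∀ s t, T ≤ s → s ≤ t → (∀ τ ∈ Icc s t, 0 < w τ) → w t ≤ w s - m * (t - s)) :
    ∀ᶠ t in atTop, w t ≤ 0 := by
  obtain ⟨t₀, ht₀, hw₀⟩ : ∃ t₀, T ≤ t₀ ∧ w t₀ ≤ 0 := by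
    by_contra! hcon
    have h1 := hcon T le_rfl
    have h2 : T ≤ T + w T / m := by have := div_pos h1 hm; linarith
    have h3 := h T _ le_rfl h2 fun τ hτ => hcon τ hτ.1
    have h4 := hcon _ h2
    rw [add_sub_cancel_left, mul_div_cancel₀ _ hm.ne'] at h3
    linarith
  filter_upwards [eventually_ge_atTop t₀] with t ht
  by_contra! hpos
  have hc : ContinuousOn w (Icc t₀ t) := hw.mono fun τ hτ => ht₀.trans hτ.1
  have hcl : IsClosed (Icc t₀ t ∩ w ⁻¹' Iic 0) := hc.preimage_isClosed_of_isClosed isClosed_Icc isClosed_Iic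
  have hcp : IsCompact (Icc t₀ t ∩ w ⁻¹' Iic 0) :=
    isCompact_Icc.of_isClosed_subset hcl inter_subset_left
  -- `s` is the last time in `[t₀, t]` with `w s ≤ 0`. On `(s, t]` the function is positive and
  -- decreases, so `w t ≤ w τ`, and `τ ↓ s` gives `w t ≤ w s ≤ 0`.
  obtain ⟨s, ⟨hs1, hs2⟩, hs3⟩ := hcp.exists_isGreatest ⟨t₀, ⟨le_rfl, ht⟩, hw₀⟩
  have hst : s < t := by
    refine lt_of_le_of_ne hs1.2 fun he => ?_
    rw [he] at hs2
    exact absurd hs2 (not_le.2 hpos)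
  have hgt : ∀ τ ∈ Ioc s t, 0 < w τ := fun τ hτ => by
    by_contra! hle
    exact absurd (hs3 ⟨⟨hs1.1.trans hτ.1.le, hτ.2⟩, hle⟩) (not_le.2 hτ.1)
  have hlim : Tendsto w (𝓝[>] s) (𝓝 (w s)) :=
    (hw s (ht₀.trans hs1.1)).mono_left (nhdsWithin_mono _ fun τ hτ =>
      (ht₀.trans hs1.1).trans (le_of_lt hτ))
  have hle : ∀ᶠ τ in 𝓝[>] s, w t ≤ w τ := by
    filter_upwards [Ioo_mem_nhdsGT hst] with τ hτ
    have := h τ t (ht₀.trans (hs1.1.trans hτ.1.le)) hτ.2.le fun σ hσ =>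
      hgt σ ⟨hτ.1.trans_le hσ.1, hσ.2⟩
    have := mul_nonneg hm.le (sub_nonneg.2 hτ.2.le)
    linarith
  have := ge_of_tendsto hlim hle
  have : w s ≤ 0 := hs2
  linarith

/-- Above the barrier `((C + 1) / c * M) ^ (1 / θ)` the damping is at least `(C + 1) M`, so `y' ≤ -M
≤ -1`. The barrier increases, hence need not be differentiable; the `+ 1` in `C + 1` provides the
decay rate. -/
theorem eventually_le_of_majorant {y y' G M : ℝ → ℝ} {θ c C : ℝ} (hθ : 0 < θ) (hc : 0 < c)
    (hC : 0 ≤ C) (hy : ∀ t > 0, HasDerivAt y (y' t) t)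
    (hG : ∀ t > 0, 1 ≤ G t) (hM : IsMajorant M G)
    (hy' : ∀ t > 0, y' t ≤ -(c * y t ^ θ) + C * G t) :
    ∀ᶠ t in atTop, y t ≤ ((C + 1) / c * M t) ^ (1 / θ) := by
  have hκ : 0 < (C + 1) / c := by positivity
  have hM1 : ∀ t > 0, 1 ≤ M t := fun t ht => (hG t ht).trans (hM.le t ht)
  have key := eventually_nonpos_of_decrease (w := fun t => y t - ((C + 1) / c * M t) ^ (1 / θ))
    (T := 1) (m := 1) one_pos ?_ ?_
  · filter_upwards [key] with t ht
    linarith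
  · have hMc : ContinuousOn M (Ici 1) := hM.cont.mono (Ici_subset_Ici.2 zero_le_one)
    have hZc : ContinuousOn (fun t => ((C + 1) / c * M t) ^ (1 / θ)) (Ici 1) :=
      ContinuousOn.rpow_const (ContinuousOn.mul continuousOn_const hMc)
        fun t _ => Or.inr (by positivity)
    exact ContinuousOn.sub
      (fun t ht => (hy t (one_pos.trans_le ht)).continuousAt.continuousWithinAt) hZc
  · intro s t hs hst hpos
    have h1 := sub_le_of_hasDerivAt_le (m := -1) hst
      (fun τ hτ => hy τ (by linarith [hτ.1])) (fun τ hτ => ?_)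
    · have h2 : ((C + 1) / c * M s) ^ (1 / θ) ≤ ((C + 1) / c * M t) ^ (1 / θ) := by
        have h3 : M s ≤ M t := hM.mono (show (0:ℝ) ≤ s by linarith) (show (0:ℝ) ≤ t by linarith) hst
        have h4 := hM1 s (by linarith)
        exact Real.rpow_le_rpow (by positivity) (by gcongr) (by positivity)
      linarith
    · have hτ0 : 0 < τ := by linarith [hτ.1]
      have hMτ := hM1 τ hτ0
      have h2 : ((C + 1) / c * M τ) ^ (1 / θ) ≤ y τ := by
        have := hpos τ hτ; linarith
      have h3 := Real.rpow_le_rpow (by positivity) h2 hθ.le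
      rw [← Real.rpow_mul (by positivity), one_div_mul_cancel hθ.ne', Real.rpow_one] at h3
      have h4 := mul_le_mul_of_nonneg_left h3 hc.le
      have h5 : c * ((C + 1) / c * M τ) = (C + 1) * M τ := by field_simp
      have h6 := mul_le_mul_of_nonneg_left (hM.le τ hτ0) hC
      have := hy' τ hτ0
      linarith

/-- Put `r = 1 / θ`, `κ = (C + 1) / c` and `u = G + L`. Above the barrier `(κ u) ^ r` one has `y' ≤
-u`, while the barrier falls at rate at most `r κ ^ r u ^ (r - 1) β`. The shift `L` solves `L ^ (2 -
r) = 2 r κ ^ r β`, which makes this rate at most `u / 2`, so `y` minus the barrier decreases at rate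
at least `1 / 2`. The assumption `θ > 1 / 2` is `r < 2`. -/
theorem eventually_le_of_deriv_ge {y y' G G' : ℝ → ℝ} {θ c C β : ℝ} (hθ : 1 / 2 < θ) (hθ1 : θ ≤ 1)
    (hc : 0 < c) (hC : 0 ≤ C) (hβ : 0 ≤ β) (hy : ∀ t > 0, HasDerivAt y (y' t) t)
    (hG : ∀ t > 0, 1 ≤ G t) (hGd : ∀ t > 0, HasDerivAt G (G' t) t)
    (hG' : ∀ᶠ t in atTop, -β ≤ G' t) (hy' : ∀ t > 0, y' t ≤ -(c * y t ^ θ) + C * G t) :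
    ∀ᶠ t in atTop, y t ≤ ((C + 1) / c * (G t +
      (2 * (1 / θ) * ((C + 1) / c) ^ (1 / θ) * β) ^ (1 / (2 - 1 / θ)))) ^ (1 / θ) := by
  have hθ0 : 0 < θ := by linarith
  set κ := (C + 1) / c with hκd
  have hκ : 0 < κ := by positivity
  set r := 1 / θ with hr
  have hr1 : 1 ≤ r := by rw [hr, le_div_iff₀ hθ0]; linarith
  have hr2 : r < 2 := by rw [hr, div_lt_iff₀ hθ0]; linarith
  have hB : 0 ≤ 2 * r * κ ^ r * β := by positivity
  set L := (2 * r * κ ^ r * β) ^ (1 / (2 - r)) with hL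
  have hL0 : 0 ≤ L := Real.rpow_nonneg hB _
  have hLr : L ^ (2 - r) = 2 * r * κ ^ r * β := by
    rw [hL, ← Real.rpow_mul hB, one_div_mul_cancel (by linarith), Real.rpow_one]
  obtain ⟨T, hT⟩ := eventually_atTop.1 hG'
  have hZd : ∀ t > 0, HasDerivAt (fun t => (κ * (G t + L)) ^ r)
      (κ * G' t * r * (κ * (G t + L)) ^ (r - 1)) t := fun t ht =>
    (((hGd t ht).add_const L).const_mul κ).rpow_const (Or.inr hr1)
  have key := eventually_nonpos_of_decrease (w := fun t => y t - (κ * (G t + L)) ^ r)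
    (T := max T 1) (m := 1 / 2) (by norm_num) ?_ ?_
  · filter_upwards [key] with t ht
    linarith
  · intro t ht
    have ht0 : 0 < t := one_pos.trans_le ((le_max_right _ _).trans ht)
    exact ((hy t ht0).sub (hZd t ht0)).continuousAt.continuousWithinAt
  · intro s t hs hst hpos
    have hs1 : 1 ≤ s := (le_max_right _ _).trans hs
    have hsT : T ≤ s := (le_max_left _ _).trans hs
    have h1 := sub_le_of_hasDerivAt_le (w := fun t => y t - (κ * (G t + L)) ^ r) (m := -(1 / 2)) hst
      (fun τ hτ => (hy τ (by linarith [hτ.1])).sub (hZd τ (by linarith [hτ.1])))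
      (fun τ hτ => ?_)
    · linarith
    · have hτ0 : 0 < τ := by linarith [hτ.1]
      have hGτ := hG τ hτ0
      set u := G τ + L with hu
      have hu1 : 1 ≤ u := by linarith
      have h2 : (κ * u) ^ r ≤ y τ := by
        have := hpos τ hτ; linarith
      have h3 := Real.rpow_le_rpow (by positivity) h2 hθ0.le
      rw [← Real.rpow_mul (by positivity), hr, one_div_mul_cancel hθ0.ne', Real.rpow_one] at h3
      have h4 := mul_le_mul_of_nonneg_left h3 hc.le
      have h5 : c * (κ * u) = (C + 1) * u := by rw [hκd]; field_simp
      have h6 : C * G τ ≤ C * u := mul_le_mul_of_nonneg_left (by linarith) hC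
      have h7 := hy' τ hτ0
      have h8 : κ * G' τ * r * (κ * u) ^ (r - 1) = (r * κ ^ r * u ^ (r - 1)) * G' τ := by
        rw [Real.mul_rpow hκ.le (by linarith), show κ ^ r = κ ^ (r - 1) * κ by
          rw [← Real.rpow_add_one hκ.ne']; congr 1; ring]
        ring
      have h9 : 2 * r * κ ^ r * β * u ^ (r - 1) ≤ u := by
        calc 2 * r * κ ^ r * β * u ^ (r - 1) = L ^ (2 - r) * u ^ (r - 1) := by rw [hLr]
          _ ≤ u ^ (2 - r) * u ^ (r - 1) := by
            gcongr
            linarith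
          _ = u := by
            rw [← Real.rpow_add (by linarith)]
            rw [show 2 - r + (r - 1) = 1 by ring, Real.rpow_one]
      have h10 : -((r * κ ^ r * u ^ (r - 1)) * β) ≤ (r * κ ^ r * u ^ (r - 1)) * G' τ := by
        have := mul_le_mul_of_nonneg_left (hT τ (hsT.trans hτ.1))
          (show 0 ≤ r * κ ^ r * u ^ (r - 1) by positivity)
        linarith
      rw [h8]
      linarith

/-- The combination of the energy inequality and the inequality for the time derivative of the
potential that bounds the potential without reference to its past. -/
theorem le_add_integral_of_deriv_le {J J' y y' A B : ℝ → ℝ} {t : ℝ} (ht : 1 < t)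
    (hJ : ∀ s > 0, HasDerivAt J (J' s) s) (hy : ∀ s > 0, HasDerivAt y (y' s) s)
    (hJ0 : ∀ s > 0, 0 ≤ J s) (hy0 : ∀ s > 0, 0 ≤ y s) (hA0 : ∀ s > 0, 0 ≤ A s)
    (hJ' : ∀ s > 0, J' s ≤ J s + A s) (hy' : ∀ s > 0, y' s ≤ -(1 / 4 * J s) + B s)
    (hA : ContinuousOn A (Ioi 0)) (hB : ContinuousOn B (Ioi 0)) :
    J t ≤ 8 * y (t - 1) + ∫ s in (t - 1)..t, (A s + 8 * B s) := by
  have hpos : ∀ s ∈ Icc (t - 1) t, 0 < s := fun s hs => by linarith [hs.1]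
  -- The weight `s - (t - 1)` removes the unknown `J (t - 1)` and equals `1` at time `t`. The
  -- derivative of the weighted `J` is at most `2 J + A`, and `8 * (1 / 4) = 2` absorbs `2 J`.
  have hQ : ∀ s > 0, HasDerivAt (fun s => (s - (t - 1)) * J s + 8 * y s)
      (1 * J s + (s - (t - 1)) * J' s + 8 * y' s) s := fun s hs =>
    (((hasDerivAt_id s).sub_const (t - 1)).mul (hJ s hs)).add ((hy s hs).const_mul 8)
  have h := intervalIntegral.sub_le_integral_of_hasDeriv_right_of_le
    (g := fun s => (s - (t - 1)) * J s + 8 * y s)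
    (φ := fun s => A s + 8 * B s) (show t - 1 ≤ t by linarith)
    (fun s hs => (hQ s (hpos s hs)).continuousAt.continuousWithinAt)
    (fun s hs => (hQ s (hpos s (Ioo_subset_Icc_self hs))).hasDerivWithinAt) ?_ ?_
  · simp only [sub_self, zero_mul, zero_add, sub_sub_cancel, one_mul] at h
    have := hy0 t (by linarith)
    linarith
  · refine ContinuousOn.integrableOn_Icc ?_
    exact (hA.mono hpos).add (continuousOn_const.mul (hB.mono hpos))
  · intro s hs
    have hs0 := hpos s (Ioo_subset_Icc_self hs)
    have h1 := mul_le_mul_of_nonneg_left (hJ' s hs0) (show 0 ≤ s - (t - 1) by linarith [hs.1])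
    have h2 : (s - (t - 1)) * (J s + A s) ≤ 1 * (J s + A s) :=
      mul_le_mul_of_nonneg_right (by linarith [hs.2]) (add_nonneg (hJ0 s hs0) (hA0 s hs0))
    have := hy' s hs0
    linarith

/-- Young's inequality with an explicit constant. If `b ≤ ε X ^ ((q-1)/q)`, the first term suffices;
otherwise `X ^ (1/q) ≤ (b/ε) ^ (1/(q-1))` and the second does. -/
theorem mul_rpow_le_add {b X q ε : ℝ} (hb : 0 ≤ b) (hX : 0 ≤ X) (hq : 1 < q) (hε : 0 < ε) :
    b * X ^ (1 / q) ≤ ε * X + (1 / ε) ^ (1 / (q - 1)) * b ^ (q / (q - 1)) := by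
  have hq1 : 0 < q - 1 := by linarith
  set u := X ^ (1 / q) with hu
  have hu0 : 0 ≤ u := Real.rpow_nonneg hX _
  have hXu : X = u ^ (q - 1) * u := by
    rw [← Real.rpow_add_one' hu0 (by linarith), sub_add_cancel, hu, ← Real.rpow_mul hX,
      one_div_mul_cancel (by linarith), Real.rpow_one]
  rcases le_total b (ε * u ^ (q - 1)) with h | h
  · have h1 := mul_le_mul_of_nonneg_right h hu0
    have h2 : 0 ≤ (1 / ε) ^ (1 / (q - 1)) * b ^ (q / (q - 1)) := by positivity
    nlinarith
  · have h1 : u ≤ (1 / ε * b) ^ (1 / (q - 1)) := by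
      have h2 : u ^ (q - 1) ≤ 1 / ε * b := by
        rw [one_div, inv_mul_eq_div, le_div_iff₀ hε]; linarith
      have h3 := Real.rpow_le_rpow (by positivity) h2 (show 0 ≤ 1 / (q - 1) by positivity)
      rwa [← Real.rpow_mul hu0, mul_one_div_cancel hq1.ne', Real.rpow_one] at h3
    have h2 := mul_le_mul_of_nonneg_left h1 hb
    have h3 : b ^ (q / (q - 1)) = b * b ^ (1 / (q - 1)) := by
      rw [show q / (q - 1) = 1 / (q - 1) + 1 by field_simp; ring,
        Real.rpow_add_one' hb (by positivity), mul_comm]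
    rw [Real.mul_rpow (by positivity) hb] at h2
    have h4 : 0 ≤ ε * X := by positivity
    rw [h3]
    linarith

theorem exists_integral_ge {h : ℝ → ℝ} {T : ℝ} (hc : ContinuousOn h (Ici T))
    (h0 : ∀ t ≥ T, 0 ≤ h t) (hdiv : ∫⁻ t in Ici T, ENNReal.ofReal (h t) = ⊤) (R : ℝ) :
    ∃ t₀ ≥ T, ∀ t ≥ t₀, R ≤ ∫ s in T..t, h s := by
  have hint : ∀ t, IntegrableOn h (Icc T t) := fun t =>
    (hc.mono fun s hs => hs.1).integrableOn_Icc
  have hex : ∃ t₀ ≥ T, R ≤ ∫ s in T..t₀, h s := by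
    by_contra! hcon
    have hI : IntegrableOn h (Ioi T) := by
      refine integrableOn_Ioi_of_intervalIntegral_norm_bounded (b := id) (l := atTop) R T
        (fun t => (hint t).mono_set Ioc_subset_Icc_self) tendsto_id ?_
      filter_upwards [eventually_ge_atTop T] with t ht
      refine le_trans (le_of_eq ?_) (hcon t ht).le
      refine intervalIntegral.integral_congr fun s hs => ?_
      rw [id, uIcc_of_le ht] at hs
      exact Real.norm_of_nonneg (h0 s hs.1)
    have hlt := hI.lintegral_lt_top
    rw [restrict_Ioi_eq_restrict_Ici] at hlt
    exact hlt.ne hdiv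
  obtain ⟨t₀, ht₀, hR⟩ := hex
  refine ⟨t₀, ht₀, fun t ht => hR.trans ?_⟩
  refine intervalIntegral.integral_mono_interval le_rfl ht₀ ht ?_ ?_
  · exact (ae_restrict_iff' measurableSet_Ioc).2 (Eventually.of_forall fun s hs => h0 s hs.1.le)
  · rw [intervalIntegrable_iff_integrableOn_Icc_of_le (ht₀.trans ht)]
    exact hint t

/-- With the integrating factor `exp (c ∫ h)`, the product `(Y - b₁) exp (c ∫ h)` is eventually
non-increasing, hence bounded above; since `∫ h` diverges, `Y - b₁` eventually drops below any
positive number, in particular below `b - b₁`. -/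
theorem eventually_le_of_linear_inequality {Y Y' h : ℝ → ℝ} {c b b₁ : ℝ} (hc : 0 < c)
    (hb : b₁ < b) (hY : ∀ t > 0, HasDerivAt Y (Y' t) t) (hh : ContinuousOn h (Ioi 1))
    (h0 : ∀ t ≥ 1, 0 ≤ h t) (h1 : ∀ t ≥ 1, h t ≤ 1)
    (hdiv : ∫⁻ t in Ici (1 : ℝ), ENNReal.ofReal (h t) = ⊤)
    (hY' : ∀ᶠ t in atTop, Y' t ≤ -(c * h t * (Y t - b₁))) : ∀ᶠ t in atTop, Y t ≤ b := by
  obtain ⟨T₀, hT₀⟩ := eventually_atTop.1 hY'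
  -- `T > 1` puts `[T, ∞)` inside the open half-line where `h` is continuous. Discarding `[1, T)`
  -- keeps the integral infinite because `h ≤ 1`.
  set T := max T₀ 2 with hT
  have hT1 : 1 < T := one_lt_two.trans_le (le_max_right _ _)
  have hdivT : ∫⁻ t in Ici T, ENNReal.ofReal (h t) = ⊤ := by
    rw [← Ico_union_Ici_eq_Ici hT1.le, lintegral_union measurableSet_Ici
      (Set.disjoint_left.2 fun t ht ht' => absurd ht.2 (not_lt.2 ht'))] at hdiv
    refine (ENNReal.add_eq_top.1 hdiv).resolve_left (ne_of_lt ?_)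
    calc ∫⁻ t in Ico 1 T, ENNReal.ofReal (h t) ≤ ∫⁻ t in Ico 1 T, 1 := by
          refine setLIntegral_mono measurable_const fun t ht => ?_
          exact ENNReal.ofReal_le_one.2 (h1 t ht.1)
      _ < ⊤ := by simp
  have hcT : ContinuousOn h (Ici T) := hh.mono fun t ht => hT1.trans_le ht
  have hId : ∀ t > T, HasDerivAt (fun t => ∫ s in T..t, h s) (h t) t := fun t ht => by
    have hct : ContinuousAt h t := hh.continuousAt (Ioi_mem_nhds (hT1.trans ht))
    refine intervalIntegral.integral_hasDerivAt_right ?_ ?_ hct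
    · exact ContinuousOn.intervalIntegrable_of_Icc ht.le (hcT.mono fun s hs => hs.1)
    · exact hh.stronglyMeasurableAtFilter isOpen_Ioi t (hT1.trans ht)
  set I := fun t => ∫ s in T..t, h s with hI
  set f := fun t => (Y t - b₁) * Real.exp (c * I t) with hf
  have hfd : ∀ t > T, HasDerivAt f (Y' t * Real.exp (c * I t) +
      (Y t - b₁) * (Real.exp (c * I t) * (c * h t))) t := fun t ht =>
    ((hY t (by linarith)).sub_const b₁).mul (((hId t ht).const_mul c).exp)
  have hanti : ∀ t > T + 1, f t ≤ f (T + 1) := fun t ht => by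
    have := sub_le_of_hasDerivAt_le (m := 0) ht.le
      (fun τ hτ => hfd τ (by linarith [hτ.1])) fun τ hτ => ?_
    · linarith
    · have h2 := hT₀ τ ((le_max_left _ _).trans (by linarith [hτ.1] : T ≤ τ))
      have h3 : Y' τ * Real.exp (c * I τ) + (Y τ - b₁) * (Real.exp (c * I τ) * (c * h τ)) =
          (Y' τ + c * h τ * (Y τ - b₁)) * Real.exp (c * I τ) := by ring
      rw [h3]
      exact mul_nonpos_of_nonpos_of_nonneg (by linarith) (Real.exp_pos _).le
  obtain ⟨t₀, -, ht₀⟩ := exists_integral_ge hcT (fun t ht => h0 t (hT1.le.trans ht)) hdivT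
    (|f (T + 1)| / (b - b₁) / c)
  filter_upwards [eventually_gt_atTop (T + 1), eventually_ge_atTop t₀] with t ht htt
  have h4 := ht₀ t htt
  rw [div_le_iff₀ hc] at h4
  have h5 : |f (T + 1)| / (b - b₁) ≤ Real.exp (c * I t) := by
    have := Real.add_one_le_exp (c * I t)
    have h6 : I t * c = c * I t := mul_comm _ _
    linarith
  rw [div_le_iff₀ (by linarith)] at h5
  have h6 := (hanti t ht).trans ((le_abs_self _).trans h5)
  simp only [hf] at h6
  rw [mul_comm (Real.exp _)] at h6
  have := le_of_mul_le_mul_right h6 (Real.exp_pos _)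
  linarith

theorem limsupInf_le_of_differential_inequality {Y Y' V D : ℝ → ℝ} {σ c C : ℝ} (hc : 0 < c)
    (hC : 0 < C) (hσ : 0 ≤ σ) (hY : ∀ t > 0, HasDerivAt Y (Y' t) t)
    (hV : ContinuousOn V (Ioi 1)) (hV1 : ∀ t ≥ 1, 1 ≤ V t)
    (hdiv : ∫⁻ t in Ici (1 : ℝ), ENNReal.ofReal (V t ^ (-σ)) = ⊤)
    (hY' : ∀ᶠ t in atTop, Y' t ≤ -(c * V t ^ (-σ) * Y t) + C * (V t ^ (1 / 2 : ℝ) * D t)) :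
    limsupInf Y ≤ ENNReal.ofReal (C / c) * limsupInf (fun t => V t ^ (σ + 1 / 2) * D t) := by
  have hK : 0 < C / c := by positivity
  set L := limsupInf (fun t => V t ^ (σ + 1 / 2) * D t) with hL
  rcases eq_or_ne L ⊤ with hLt | hLt
  · rw [hLt, ENNReal.mul_top (by simpa using hK)]
    exact le_top
  refine le_of_forall_gt_imp_ge_of_dense fun b hb => ?_
  rcases eq_or_ne b ⊤ with hbt | hbt
  · rw [hbt]; exact le_top
  obtain ⟨b₁, hb₁, hb₁b⟩ := exists_between hb
  have hb₁t : b₁ ≠ ⊤ := (hb₁b.trans_le le_top).ne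
  have hlt : L < ENNReal.ofReal (b₁.toReal / (C / c)) := by
    rw [ENNReal.ofReal_div_of_pos hK, ENNReal.ofReal_toReal hb₁t, ENNReal.lt_div_iff_mul_lt
      (Or.inl (by simpa using hK)) (Or.inl ENNReal.ofReal_ne_top), mul_comm]
    exact hb₁
  have hev := eventually_lt_of_limsup_lt hlt
  have hfin := eventually_le_of_linear_inequality (Y := Y) (h := fun t => V t ^ (-σ)) hc
    (ENNReal.toReal_strict_mono hbt hb₁b) hY ?_ ?_ ?_ hdiv ?_
  · unfold limsupInf
    refine limsup_le_of_le (by isBoundedDefault) ?_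
    filter_upwards [hfin] with t ht
    exact ENNReal.ofReal_le_of_le_toReal ht
  · exact hV.rpow_const fun t ht => Or.inl (by have := hV1 t (le_of_lt ht); positivity)
  · intro t ht
    have := hV1 t ht
    positivity
  · intro t ht
    exact Real.rpow_le_one_of_one_le_of_nonpos (hV1 t ht) (by linarith)
  · filter_upwards [hY', hev, eventually_ge_atTop 1] with t h1 h2 h3
    have hVt : 0 < V t := one_pos.trans_le (hV1 t h3)
    refine h1.trans ?_
    -- The forcing is rewritten as the damping coefficient `V ^ (-σ)` times the quantity whose
    -- limsup is known.
    have h4 : V t ^ (1 / 2 : ℝ) * D t = V t ^ (-σ) * (V t ^ (σ + 1 / 2) * D t) := by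
      rw [← mul_assoc, ← Real.rpow_add hVt]; congr 2; ring
    have h5 : V t ^ (σ + 1 / 2) * D t ≤ b₁.toReal / (C / c) := by
      have h6 := (ENNReal.ofReal_lt_ofReal_iff' .. |>.1 h2)
      exact h6.1.le
    have h6 := mul_le_mul_of_nonneg_left h5 (show 0 ≤ C * V t ^ (-σ) by positivity)
    have h7 : C * V t ^ (-σ) * (b₁.toReal / (C / c)) = c * V t ^ (-σ) * b₁.toReal := by
      field_simp
    rw [h4]
    nlinarith

/-! ### Integral inequalities -/

/-- Hölder's inequality for a geometric mean: normalise `f` and `g` by their integrals and apply the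
weighted arithmetic-geometric mean inequality. If one integral vanishes, that function and with it
`F` is zero almost everywhere. -/
theorem integral_le_rpow_mul_rpow {X : Type*} [MeasurableSpace X] {μ : Measure X} {F f g : X → ℝ}
    {w : ℝ} (hw0 : 0 < w) (hw1 : w < 1) (hF : AEStronglyMeasurable F μ) (hF0 : ∀ᵐ x ∂μ, 0 ≤ F x)
    (hf : Integrable f μ) (hg : Integrable g μ) (hf0 : ∀ᵐ x ∂μ, 0 ≤ f x)
    (hg0 : ∀ᵐ x ∂μ, 0 ≤ g x) (hle : ∀ᵐ x ∂μ, F x ≤ f x ^ w * g x ^ (1 - w)) :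
    Integrable F μ ∧ ∫ x, F x ∂μ ≤ (∫ x, f x ∂μ) ^ w * (∫ x, g x ∂μ) ^ (1 - w) := by
  have hw1' : 0 < 1 - w := by linarith
  have hint : Integrable F μ := by
    refine Integrable.mono' ((hf.const_mul w).add (hg.const_mul (1 - w))) hF ?_
    filter_upwards [hF0, hf0, hg0, hle] with x h1 h2 h3 h4
    rw [Real.norm_of_nonneg h1]
    exact h4.trans (Real.geom_mean_le_arith_mean2_weighted hw0.le hw1'.le h2 h3 (by ring))
  refine ⟨hint, ?_⟩
  have hA0 : 0 ≤ ∫ x, f x ∂μ := integral_nonneg_of_ae hf0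
  have hB0 : 0 ≤ ∫ x, g x ∂μ := integral_nonneg_of_ae hg0
  have hzero : (∀ᵐ x ∂μ, F x = 0) → ∫ x, F x ∂μ ≤ (∫ x, f x ∂μ) ^ w * (∫ x, g x ∂μ) ^ (1 - w) := by
    intro h
    rw [integral_eq_zero_of_ae h]
    positivity
  rcases hA0.eq_or_lt with hA | hA
  · apply hzero
    filter_upwards [(integral_eq_zero_iff_of_nonneg_ae hf0 hf).1 hA.symm, hF0, hle] with x h1 h2 h3
    simp only [Pi.zero_apply] at h1
    rw [h1, Real.zero_rpow hw0.ne', zero_mul] at h3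
    exact le_antisymm h3 h2
  rcases hB0.eq_or_lt with hB | hB
  · apply hzero
    filter_upwards [(integral_eq_zero_iff_of_nonneg_ae hg0 hg).1 hB.symm, hF0, hle] with x h1 h2 h3
    simp only [Pi.zero_apply] at h1
    rw [h1, Real.zero_rpow hw1'.ne', mul_zero] at h3
    exact le_antisymm h3 h2
  set A := ∫ x, f x ∂μ with hAd
  set B := ∫ x, g x ∂μ with hBd
  calc ∫ x, F x ∂μ ≤ ∫ x, A ^ w * B ^ (1 - w) * (w * (f x / A) + (1 - w) * (g x / B)) ∂μ := by
        refine integral_mono_ae hint ?_ ?_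
        · exact (((hf.div_const A).const_mul w).add ((hg.div_const B).const_mul (1 - w))).const_mul _
        · filter_upwards [hf0, hg0, hle] with x h2 h3 h4
          refine h4.trans ?_
          have h5 := Real.geom_mean_le_arith_mean2_weighted hw0.le hw1'.le (div_nonneg h2 hA.le)
            (div_nonneg h3 hB.le) (by ring)
          refine le_trans (le_of_eq ?_) (mul_le_mul_of_nonneg_left h5
            (by positivity : 0 ≤ A ^ w * B ^ (1 - w)))
          rw [Real.div_rpow h2 hA.le, Real.div_rpow h3 hB.le]
          have := (Real.rpow_pos_of_pos hA w).ne'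
          have := (Real.rpow_pos_of_pos hB (1 - w)).ne'
          field_simp
    _ = A ^ w * B ^ (1 - w) := by
        rw [integral_const_mul, integral_add ((hf.div_const A).const_mul w)
          ((hg.div_const B).const_mul (1 - w)), integral_const_mul, integral_const_mul,
          integral_div, integral_div, ← hAd, ← hBd, div_self hA.ne', div_self hB.ne']
        ring

/-! ### Gradients of locally Lipschitz functions -/

theorem measurable_gradient {n : ℕ} (u : E n → ℝ) : Measurable (gradient u) :=
  (InnerProductSpace.toDual ℝ (E n)).symm.continuous.measurable.comp (measurable_fderiv ℝ u)

/-- Rademacher's theorem near each point; a set that is locally null is null. -/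
theorem ae_differentiableAt_of_locallyLipschitzOn {n : ℕ} {U : Set (E n)} (hU : IsOpen U)
    {u : E n → ℝ} (hu : LocallyLipschitzOn U u) :
    ∀ᵐ x ∂(volume.restrict U), DifferentiableAt ℝ u x := by
  rw [ae_restrict_iff' hU.measurableSet, ae_iff]
  refine measure_null_of_locally_null _ fun x hx => ?_
  have hxU : x ∈ U := by
    by_contra h
    exact hx fun h' => absurd h' h
  obtain ⟨C, s, hs, hC⟩ := hu hxU
  rw [hU.nhdsWithin_eq hxU] at hs
  obtain ⟨v, hvs, hv, hxv⟩ := mem_nhds_iff.1 hs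
  refine ⟨v ∩ {x | ¬(x ∈ U → DifferentiableAt ℝ u x)},
    inter_mem (mem_nhdsWithin_of_mem_nhds (hv.mem_nhds hxv)) self_mem_nhdsWithin, ?_⟩
  have h1 := (hC.mono hvs).ae_differentiableWithinAt (μ := volume) hv.measurableSet
  rw [ae_restrict_iff' hv.measurableSet, ae_iff] at h1
  refine measure_mono_null ?_ h1
  rintro y ⟨hyv, hy⟩ h2
  exact hy fun _ => (h2 hyv).differentiableAt (hv.mem_nhds hyv)

theorem ae_gradient_sub {n : ℕ} {U : Set (E n)} (hU : IsOpen U) {u v : E n → ℝ}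
    (hu : LocallyLipschitzOn U u) (hv : LocallyLipschitzOn U v) :
    ∀ᵐ x ∂(volume.restrict U), gradient (u - v) x = gradient u x - gradient v x := by
  filter_upwards [ae_differentiableAt_of_locallyLipschitzOn hU hu,
    ae_differentiableAt_of_locallyLipschitzOn hU hv] with x h1 h2
  unfold gradient
  rw [fderiv_sub h1 h2, map_sub]

/-! ### Regularity in time -/

/-- The part of `Regular` that concerns the dependence on time. -/
structure TimeRegular {n : ℕ} (U : Set (E n)) (u : ℝ → E n → ℝ) : Prop where
  cont : ContinuousOn (Function.uncurry u) (Ioi 0 ×ˢ closure U)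
  diff_time : ∀ t > 0, ∀ x ∈ closure U, DifferentiableAt ℝ (fun s => u s x) t
  cont_dt : ContinuousOn (Function.uncurry (dt u)) (Ioi 0 ×ˢ closure U)

theorem Regular.timeRegular {n : ℕ} {U : Set (E n)} {u : ℝ → E n → ℝ} (h : Regular U u) :
    TimeRegular U u := ⟨h.cont, h.diff_time, h.cont_dt⟩

theorem TimeRegular.dt_sub {n : ℕ} {U : Set (E n)} {u v : ℝ → E n → ℝ} (hu : TimeRegular U u)
    (hv : TimeRegular U v) {t : ℝ} (ht : 0 < t) {x : E n} (hx : x ∈ closure U) :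
    dt (u - v) t x = dt u t x - dt v t x :=
  deriv_fun_sub (hu.diff_time t ht x hx) (hv.diff_time t ht x hx)

theorem TimeRegular.sub {n : ℕ} {U : Set (E n)} {u v : ℝ → E n → ℝ} (hu : TimeRegular U u)
    (hv : TimeRegular U v) : TimeRegular U (u - v) where
  cont := hu.cont.sub hv.cont
  diff_time t ht x hx := (hu.diff_time t ht x hx).fun_sub (hv.diff_time t ht x hx)
  cont_dt := (hu.cont_dt.sub hv.cont_dt).congr fun _ hz => hu.dt_sub hv hz.1 hz.2

theorem continuousOn_slice {n : ℕ} {U : Set (E n)} {u : ℝ → E n → ℝ}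
    (hu : ContinuousOn (Function.uncurry u) (Ioi 0 ×ˢ closure U)) {t : ℝ} (ht : 0 < t) :
    ContinuousOn (u t) (closure U) :=
  hu.comp (f := fun x => (t, x)) (by fun_prop) fun _ hx => ⟨ht, hx⟩

theorem TimeRegular.continuousOn {n : ℕ} {U : Set (E n)} {u : ℝ → E n → ℝ} (hu : TimeRegular U u)
    {t : ℝ} (ht : 0 < t) : ContinuousOn (u t) (closure U) := continuousOn_slice hu.cont ht

theorem TimeRegular.continuousOn_dt {n : ℕ} {U : Set (E n)} {u : ℝ → E n → ℝ}
    (hu : TimeRegular U u) {t : ℝ} (ht : 0 < t) : ContinuousOn (dt u t) (closure U) :=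
  continuousOn_slice hu.cont_dt ht

/-! ### The setting: domain and medium -/

/-- An open bounded set, admissible exponents and an admissible medium. -/
structure Setting {n N : ℕ} (U : Set (E n)) (φ : E n → ℝ) (α : Fin (N + 1) → ℝ)
    (a : Fin (N + 1) → E n → ℝ) : Prop where
  isOpen : IsOpen U
  isBounded : Bornology.IsBounded U
  zero : α 0 = 0
  mono : StrictMono α
  one_le : 1 ≤ N
  medium : IsMedium U φ a

/-- The square `∫_U φ u² dx` of the weighted norm. -/
def mass {n : ℕ} (U : Set (E n)) (φ : E n → ℝ) (u : E n → ℝ) : ℝ :=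
  ∫ x in U, φ x * u x ^ 2

/-- The energy `∫_U K(x, |y|) |y|² dx` of a vector field. -/
def energy {n N : ℕ} (U : Set (E n)) (α : Fin (N + 1) → ℝ) (a : Fin (N + 1) → E n → ℝ)
    (y : E n → E n) : ℝ :=
  ∫ x in U, K α a x ‖y x‖ * ‖y x‖ ^ 2

/-- The integral `∫_U a₀⁻¹ |z|² dx`. -/
def dual {n N : ℕ} (U : Set (E n)) (a : Fin (N + 1) → E n → ℝ) (z : E n → E n) : ℝ :=
  ∫ x in U, (a 0 x)⁻¹ * ‖z x‖ ^ 2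

theorem wnorm_eq {n : ℕ} (U : Set (E n)) (φ : E n → ℝ) (u : E n → ℝ) : wnorm U φ 2 u = mass U φ u ^ (1 / 2 : ℝ) := by
  unfold wnorm mass
  congr 2
  ext x
  rw [Real.rpow_two, Real.norm_eq_abs, sq_abs]

namespace Setting

variable {n N : ℕ} {U : Set (E n)} {φ : E n → ℝ} {α : Fin (N + 1) → ℝ}
  {a : Fin (N + 1) → E n → ℝ} (S : Setting U φ α a)
include S

theorem coeff {x : E n} (hx : x ∈ U) : IsCoeff α (fun j => a j x) where
  zero := S.zero
  mono := S.mono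
  pos := S.medium.coeff_zero_pos x hx
  nonneg j := S.medium.coeff_nonneg j x hx
  last_pos := S.medium.coeff_last_pos x hx
  one_le := S.one_le

theorem ae_mem : ∀ᵐ x ∂(volume.restrict U), x ∈ U := ae_restrict_mem S.isOpen.measurableSet

theorem ae_coeff : ∀ᵐ x ∂(volume.restrict U), IsCoeff α (fun j => a j x) :=
  S.ae_mem.mono fun _ hx => S.coeff hx

theorem expo_mem : expo α ∈ Ioo (0 : ℝ) 1 := by
  have h : IsCoeff α (fun _ => 1) := ⟨S.zero, S.mono, one_pos, fun _ => zero_le_one, one_pos, S.one_le⟩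
  exact ⟨h.expo_pos, h.expo_lt_one⟩

theorem isCompact_closure : IsCompact (closure U) := S.isBounded.isCompact_closure

theorem volume_lt_top : volume U < ⊤ := S.isBounded.measure_lt_top

theorem integrableOn_of_continuousOn {f : E n → ℝ} (hf : ContinuousOn f (closure U)) :
    IntegrableOn f U :=
  (hf.integrableOn_compact S.isCompact_closure).mono_set subset_closure

theorem integrableOn_porosity_mul {f : E n → ℝ} (hf : ContinuousOn f (closure U)) :
    IntegrableOn (fun x => φ x * f x) U := by
  refine Integrable.bdd_mul (c := 1) (S.integrableOn_of_continuousOn hf)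
    S.medium.measurable_porosity.aestronglyMeasurable ?_
  filter_upwards [S.ae_mem] with x hx
  have := S.medium.porosity_mem x hx
  rw [Real.norm_of_nonneg this.1.le]
  exact this.2

theorem ae_porosity_nonneg : ∀ᵐ x ∂(volume.restrict U), 0 ≤ φ x :=
  S.ae_mem.mono fun x hx => (S.medium.porosity_mem x hx).1.le

theorem mass_nonneg (u : E n → ℝ) : 0 ≤ mass U φ u :=
  integral_nonneg_of_ae (S.ae_porosity_nonneg.mono fun _ hx => mul_nonneg hx (sq_nonneg _))

theorem energy_nonneg (y : E n → E n) : 0 ≤ energy U α a y :=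
  integral_nonneg_of_ae (S.ae_coeff.mono fun _ hx =>
    mul_nonneg (hx.cond_pos _).le (sq_nonneg _))

theorem dual_nonneg (z : E n → E n) : 0 ≤ dual U a z :=
  integral_nonneg_of_ae (S.ae_coeff.mono fun _ hx =>
    mul_nonneg (inv_nonneg.2 hx.pos.le) (sq_nonneg _))

/-! #### Measurability -/

theorem aemeasurable_root {ξ : E n → ℝ} (hξ : Measurable ξ) (hξ0 : ∀ x, 0 ≤ ξ x) :
    AEMeasurable (fun x => root α (fun j => a j x) (ξ x)) (volume.restrict U) :=
  Forchheimer.aemeasurable_root S.isOpen.measurableSet (fun _ hx => S.coeff hx)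
    S.medium.measurable_coeff hξ hξ0

theorem aestronglyMeasurable_K {ξ : E n → ℝ} (hξ : Measurable ξ) (hξ0 : ∀ x, 0 ≤ ξ x) :
    AEStronglyMeasurable (fun x => K α a x (ξ x)) (volume.restrict U) := by
  have hr := S.aemeasurable_root hξ hξ0
  refine AEMeasurable.aestronglyMeasurable ?_
  unfold K g
  refine AEMeasurable.const_div (Finset.aemeasurable_fun_sum _ fun j _ => ?_) 1
  exact (S.medium.measurable_coeff j).aemeasurable.mul (hr.pow_const _)

theorem aestronglyMeasurable_potential {ξ : E n → ℝ} (hξ : Measurable ξ) (hξ0 : ∀ x, 0 ≤ ξ x) :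
    AEStronglyMeasurable (fun x => potential α (fun j => a j x) (ξ x)) (volume.restrict U) := by
  have hr := S.aemeasurable_root hξ hξ0
  refine AEMeasurable.aestronglyMeasurable ?_
  unfold potential
  refine Finset.aemeasurable_fun_sum _ fun j _ => ?_
  exact (((S.medium.measurable_coeff j).aemeasurable.const_mul 2).mul_const _).mul (hr.pow_const _)

theorem measurable_W1 : Measurable (W1 α a) := by
  unfold W1
  refine ((S.medium.measurable_coeff _).pow_const _).div (measurable_const.mul ?_)
  have := Finset.measurable_sup' (f := a) Finset.univ_nonempty (fun j _ => S.medium.measurable_coeff j)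
  convert this using 1
  ext x
  rw [Finset.sup'_apply]

theorem aestronglyMeasurable_flux_inner {y z : E n → E n} (hy : Measurable y) (hz : Measurable z) :
    AEStronglyMeasurable (fun x => K α a x ‖y x‖ * inner ℝ (y x) (z x)) (volume.restrict U) :=
  (S.aestronglyMeasurable_K hy.norm fun _ => norm_nonneg _).mul
    (hy.inner hz).aestronglyMeasurable

/-! #### Products of the flux with another field -/

/-- Since `K ≤ a₀⁻¹`, the integrand is at most the geometric mean of `K |y|²` and `a₀⁻¹ |z|²`. -/
theorem integral_flux_norm_le {y z : E n → E n} (hy : Measurable y) (hz : Measurable z)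
    (hyE : IntegrableOn (fun x => K α a x ‖y x‖ * ‖y x‖ ^ 2) U)
    (hzD : IntegrableOn (fun x => (a 0 x)⁻¹ * ‖z x‖ ^ 2) U) :
    IntegrableOn (fun x => K α a x ‖y x‖ * (‖y x‖ * ‖z x‖)) U ∧
      ∫ x in U, K α a x ‖y x‖ * (‖y x‖ * ‖z x‖) ≤
        energy U α a y ^ (1 / 2 : ℝ) * dual U a z ^ (1 / 2 : ℝ) := by
  have h := integral_le_rpow_mul_rpow (w := 1 / 2) (by norm_num) (by norm_num)
    (F := fun x => K α a x ‖y x‖ * (‖y x‖ * ‖z x‖))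
    ((S.aestronglyMeasurable_K hy.norm fun _ => norm_nonneg _).mul
      (hy.norm.mul hz.norm).aestronglyMeasurable)
    (S.ae_coeff.mono fun x hx => mul_nonneg (hx.cond_pos _).le (by positivity)) hyE hzD
    (S.ae_coeff.mono fun x hx => mul_nonneg (hx.cond_pos _).le (sq_nonneg _))
    (S.ae_coeff.mono fun x hx => mul_nonneg (inv_nonneg.2 hx.pos.le) (sq_nonneg _)) ?_
  · norm_num at h ⊢
    exact h
  · filter_upwards [S.ae_coeff] with x hx
    have hk : 0 < K α a x ‖y x‖ := hx.cond_pos _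
    have hkl : K α a x ‖y x‖ ≤ (a 0 x)⁻¹ := hx.cond_le _
    rw [show (1 : ℝ) - 1 / 2 = 1 / 2 by norm_num, ← Real.sqrt_eq_rpow, ← Real.sqrt_eq_rpow,
      ← Real.sqrt_mul (by positivity)]
    refine Real.le_sqrt_of_sq_le ?_
    have := mul_le_mul_of_nonneg_left hkl
      (show 0 ≤ K α a x ‖y x‖ * (‖y x‖ ^ 2 * ‖z x‖ ^ 2) by positivity)
    nlinarith

theorem integrableOn_flux_inner {y z : E n → E n} (hy : Measurable y) (hz : Measurable z)
    (hyE : IntegrableOn (fun x => K α a x ‖y x‖ * ‖y x‖ ^ 2) U)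
    (hzD : IntegrableOn (fun x => (a 0 x)⁻¹ * ‖z x‖ ^ 2) U) :
    IntegrableOn (fun x => K α a x ‖y x‖ * inner ℝ (y x) (z x)) U := by
  refine (S.integral_flux_norm_le hy hz hyE hzD).1.mono'
    (S.aestronglyMeasurable_flux_inner hy hz) ?_
  filter_upwards [S.ae_coeff] with x hx
  have hk : 0 < K α a x ‖y x‖ := hx.cond_pos _
  rw [norm_mul, Real.norm_of_nonneg hk.le]
  exact mul_le_mul_of_nonneg_left (norm_inner_le_norm _ _) hk.le

theorem integral_flux_inner_le {y z : E n → E n} (hy : Measurable y) (hz : Measurable z)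
    (hyE : IntegrableOn (fun x => K α a x ‖y x‖ * ‖y x‖ ^ 2) U)
    (hzD : IntegrableOn (fun x => (a 0 x)⁻¹ * ‖z x‖ ^ 2) U) :
    2 * ∫ x in U, K α a x ‖y x‖ * inner ℝ (y x) (z x) ≤ energy U α a y + dual U a z := by
  rw [← integral_const_mul, energy, dual, ← integral_add hyE hzD]
  refine integral_mono_ae ((S.integrableOn_flux_inner hy hz hyE hzD).const_mul 2)
    (hyE.add hzD) ?_
  filter_upwards [S.ae_coeff] with x hx
  have hk : 0 < K α a x ‖y x‖ := hx.cond_pos _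
  have hkl : K α a x ‖y x‖ ≤ (a 0 x)⁻¹ := hx.cond_le _
  have h1 := mul_le_mul_of_nonneg_left (real_inner_le_norm (y x) (z x)) hk.le
  have h2 := mul_le_mul_of_nonneg_right hkl (sq_nonneg ‖z x‖)
  have h3 := mul_nonneg hk.le (sq_nonneg (‖y x‖ - ‖z x‖))
  nlinarith

/-- `K(ξ) ξ` is increasing, so `K(|y|) |y| |z| ≤ K(m) m²` with `m` the larger norm. This pairs the
flux of one solution with the gradient of the other, for which no bound with weight `a₀⁻¹` is
available. -/
theorem integrableOn_flux_inner_of_energy {y z : E n → E n} (hy : Measurable y) (hz : Measurable z)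
    (hyE : IntegrableOn (fun x => K α a x ‖y x‖ * ‖y x‖ ^ 2) U)
    (hzE : IntegrableOn (fun x => K α a x ‖z x‖ * ‖z x‖ ^ 2) U) :
    IntegrableOn (fun x => K α a x ‖y x‖ * inner ℝ (y x) (z x)) U := by
  refine (hyE.add hzE).mono' (S.aestronglyMeasurable_flux_inner hy hz) ?_
  filter_upwards [S.ae_coeff] with x hx
  have hk : 0 < K α a x ‖y x‖ := hx.cond_pos _
  have hl : 0 < K α a x ‖z x‖ := hx.cond_pos _
  rw [norm_mul, Real.norm_of_nonneg hk.le]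
  refine (mul_le_mul_of_nonneg_left (norm_inner_le_norm _ _) hk.le).trans ?_
  have e1 : K α a x ‖y x‖ * ‖y x‖ = root α (fun j => a j x) ‖y x‖ := hx.cond_mul (norm_nonneg _)
  have e2 : K α a x ‖z x‖ * ‖z x‖ = root α (fun j => a j x) ‖z x‖ := hx.cond_mul (norm_nonneg _)
  have h0 := mul_nonneg hk.le (sq_nonneg ‖y x‖)
  have h0' := mul_nonneg hl.le (sq_nonneg ‖z x‖)
  simp only [Pi.add_apply]
  rcases le_total ‖y x‖ ‖z x‖ with hle | hle
  · have h1 := hx.root_mono (norm_nonneg _) hle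
    rw [← e1, ← e2] at h1
    have h2 := mul_le_mul_of_nonneg_right h1 (norm_nonneg (z x))
    nlinarith
  · have h2 := mul_le_mul_of_nonneg_left hle (mul_nonneg hk.le (norm_nonneg (y x)))
    nlinarith

/-! #### Weighted norms -/

theorem integral_porosity_mul_le {u v : E n → ℝ} (hu : ContinuousOn u (closure U))
    (hv : ContinuousOn v (closure U)) :
    |∫ x in U, φ x * (u x * v x)| ≤ mass U φ u ^ (1 / 2 : ℝ) * mass U φ v ^ (1 / 2 : ℝ) := by
  have hI := S.integrableOn_porosity_mul (f := fun x => u x * v x) (hu.mul hv)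
  have h := integral_le_rpow_mul_rpow (w := 1 / 2) (by norm_num) (by norm_num)
    (F := fun x => |φ x * (u x * v x)|) hI.abs.aestronglyMeasurable
    (Eventually.of_forall fun x => abs_nonneg _)
    (S.integrableOn_porosity_mul (f := fun x => u x ^ 2) (hu.pow 2))
    (S.integrableOn_porosity_mul (f := fun x => v x ^ 2) (hv.pow 2))
    (S.ae_porosity_nonneg.mono fun _ hx => mul_nonneg hx (sq_nonneg _))
    (S.ae_porosity_nonneg.mono fun _ hx => mul_nonneg hx (sq_nonneg _)) ?_
  · refine (abs_integral_le_integral_abs).trans ?_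
    norm_num at h ⊢
    exact h.2
  · filter_upwards [S.ae_porosity_nonneg] with x hx
    rw [show (1 : ℝ) - 1 / 2 = 1 / 2 by norm_num, ← Real.sqrt_eq_rpow, ← Real.sqrt_eq_rpow,
      ← Real.sqrt_mul (by positivity)]
    refine Real.le_sqrt_of_sq_le ?_
    rw [sq_abs]
    exact le_of_eq (by ring)

theorem mass_sub_le {u v : E n → ℝ} (hu : ContinuousOn u (closure U))
    (hv : ContinuousOn v (closure U)) :
    mass U φ (u - v) ≤ 2 * (mass U φ u + mass U φ v) := by
  have h1 := S.integrableOn_porosity_mul (f := fun x => u x ^ 2) (hu.pow 2)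
  have h2 := S.integrableOn_porosity_mul (f := fun x => v x ^ 2) (hv.pow 2)
  unfold mass
  rw [← integral_add h1 h2, ← integral_const_mul]
  refine integral_mono_ae (S.integrableOn_porosity_mul ((hu.sub hv).pow 2))
    ((h1.add h2).const_mul 2) ?_
  filter_upwards [S.ae_porosity_nonneg] with x hx
  have := mul_nonneg hx (sq_nonneg (u x + v x))
  simp only [Pi.sub_apply]
  nlinarith

theorem wnorm_sq (u : E n → ℝ) : wnorm U φ 2 u ^ 2 = mass U φ u := by
  rw [wnorm_eq, ← Real.sqrt_eq_rpow, Real.sq_sqrt (S.mass_nonneg u)]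

theorem mass_rpow_le {cP X : ℝ} (hcP : 0 < cP) {u : E n → ℝ} (h : PoincareSobolev U φ α a cP u)
    (hX : ∫ x in U, W1 α a x * ‖gradient u x‖ ^ (2 - expo α) ≤ X) :
    mass U φ u ^ (1 / 2 : ℝ) ≤ cP * X ^ (1 / (2 - expo α)) := by
  rw [PoincareSobolev, wnorm_eq] at h
  refine h.trans (mul_le_mul_of_nonneg_left ?_ hcP.le)
  refine Real.rpow_le_rpow (integral_nonneg_of_ae ?_) hX ?_
  · filter_upwards [S.ae_coeff] with x hx
    exact mul_nonneg hx.weight_pos.le (Real.rpow_nonneg (norm_nonneg _) _)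
  · have := S.expo_mem.2
    exact one_div_nonneg.2 (by linarith)

/-! #### Differentiation of integrals in time -/

/-- `u u_t` is bounded on the compact set `[t/2, 2t] × closure U` and `φ ≤ 1`, so a constant
dominates the derivative. -/
theorem hasDerivAt_mass {u : ℝ → E n → ℝ} (hu : TimeRegular U u) {t : ℝ} (ht : 0 < t) :
    HasDerivAt (fun s => mass U φ (u s)) (2 * ∫ x in U, φ x * (u t x * dt u t x)) t := by
  have hcomp : IsCompact (Icc (t / 2) (2 * t) ×ˢ closure U) := isCompact_Icc.prod S.isCompact_closure
  have hsub : Icc (t / 2) (2 * t) ×ˢ closure U ⊆ Ioi 0 ×ˢ closure U :=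
    prod_mono (fun s hs => (half_pos ht).trans_le hs.1) Subset.rfl
  obtain ⟨B, hB⟩ := hcomp.exists_bound_of_continuousOn ((hu.cont.mul hu.cont_dt).mono hsub)
  have hs : Ioo (t / 2) (2 * t) ∈ 𝓝 t := Ioo_mem_nhds (by linarith) (by linarith)
  have hd := hasDerivAt_integral_of_dominated_loc_of_deriv_le (μ := volume.restrict U)
    (F := fun s x => φ x * u s x ^ 2) (F' := fun s x => φ x * (2 * (u s x * dt u s x)))
    (bound := fun _ => 2 * B) hs ?_ ?_ ?_ ?_ ?_ ?_
  · have he : 2 * ∫ x in U, φ x * (u t x * dt u t x) =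
        ∫ x in U, φ x * (2 * (u t x * dt u t x)) := by
      rw [← integral_const_mul]
      congr 1
      ext x
      ring
    rw [he]
    exact hd.2
  · filter_upwards [lt_mem_nhds ht] with s hs
    exact (S.integrableOn_porosity_mul ((hu.continuousOn hs).pow 2)).aestronglyMeasurable
  · exact S.integrableOn_porosity_mul ((hu.continuousOn ht).pow 2)
  · exact (S.integrableOn_porosity_mul (continuousOn_const.mul
      ((hu.continuousOn ht).mul (hu.continuousOn_dt ht)))).aestronglyMeasurable
  · filter_upwards [S.ae_mem] with x hx s hs
    have h1 := hB (s, x) ⟨⟨hs.1.le, hs.2.le⟩, subset_closure hx⟩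
    have h2 := S.medium.porosity_mem x hx
    rw [norm_mul, norm_mul, Real.norm_of_nonneg h2.1.le, Real.norm_of_nonneg zero_le_two]
    have h3 : ‖u s x * dt u s x‖ ≤ B := h1
    have h4 := norm_nonneg (u s x * dt u s x)
    have := mul_le_mul_of_nonneg_right h2.2 (show 0 ≤ 2 * ‖u s x * dt u s x‖ by positivity)
    linarith
  · exact integrableOn_const S.volume_lt_top.ne
  · filter_upwards [S.ae_mem] with x hx s hs
    have h1 := (hu.diff_time s (by linarith [hs.1]) x (subset_closure hx)).hasDerivAt
    have h2 := (h1.fun_pow 2).const_mul (φ x)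
    have he : φ x * (2 * (u s x * dt u s x)) =
        φ x * ((2 : ℕ) * u s x ^ (2 - 1) * deriv (fun s => u s x) s) := by
      simp only [dt, Nat.cast_ofNat, Nat.add_one_sub_one, pow_one]
      ring
    rw [he]
    exact h2

theorem integrableOn_potential {y : E n → E n} (hy : Measurable y)
    (hyE : IntegrableOn (fun x => K α a x ‖y x‖ * ‖y x‖ ^ 2) U) :
    IntegrableOn (fun x => potential α (fun j => a j x) ‖y x‖) U := by
  refine (hyE.const_mul 2).mono'
    (S.aestronglyMeasurable_potential hy.norm fun _ => norm_nonneg _) ?_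
  filter_upwards [S.ae_coeff] with x hx
  rw [Real.norm_of_nonneg (hx.potential_nonneg (norm_nonneg _))]
  exact hx.potential_le (norm_nonneg _)

theorem energy_le_integral_potential {y : E n → E n} (hy : Measurable y)
    (hyE : IntegrableOn (fun x => K α a x ‖y x‖ * ‖y x‖ ^ 2) U) :
    energy U α a y ≤ ∫ x in U, potential α (fun j => a j x) ‖y x‖ :=
  integral_mono_ae hyE (S.integrableOn_potential hy hyE)
    (S.ae_coeff.mono fun _ hx => hx.cond_mul_sq_le_potential (norm_nonneg _))

theorem integral_potential_le {y : E n → E n} (hy : Measurable y)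
    (hyE : IntegrableOn (fun x => K α a x ‖y x‖ * ‖y x‖ ^ 2) U) :
    ∫ x in U, potential α (fun j => a j x) ‖y x‖ ≤ 2 * energy U α a y := by
  rw [energy, ← integral_const_mul]
  exact integral_mono_ae (S.integrableOn_potential hy hyE) (hyE.const_mul 2)
    (S.ae_coeff.mono fun _ hx => hx.potential_le (norm_nonneg _))

theorem hasDerivAt_integral_potential {p Ψ : ℝ → E n → ℝ} (hp : IsSolution U φ α a p Ψ) {t : ℝ}
    (ht : 0 < t) :
    IntegrableOn (fun x => K α a x ‖gradient (p t) x‖ *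
        inner ℝ (gradient (p t) x) (gradient (dt p t) x)) U ∧
      HasDerivAt (fun s => ∫ x in U, potential α (fun j => a j x) ‖gradient (p s) x‖)
        (2 * ∫ x in U, K α a x ‖gradient (p t) x‖ *
          inner ℝ (gradient (p t) x) (gradient (dt p t) x)) t := by
  obtain ⟨ε, hε, b, hb, hbound⟩ := hp.energy_dt t ht
  have hs : Ioo (t - ε) (t + ε) ∩ Ioi 0 ∈ 𝓝 t :=
    inter_mem (Ioo_mem_nhds (by linarith) (by linarith)) (Ioi_mem_nhds ht)
  have hle : ∀ᵐ x ∂(volume.restrict U), ∀ s ∈ Ioo (t - ε) (t + ε) ∩ Ioi 0,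
      ‖K α a x ‖gradient (p s) x‖ * inner ℝ (gradient (p s) x) (gradient (dt p s) x)‖ ≤ b x := by
    filter_upwards [S.ae_coeff, hbound] with x hx hbx s hs
    have h1 := hbx s hs.1
    have hk : 0 < K α a x ‖gradient (p s) x‖ := hx.cond_pos _
    rw [norm_mul, Real.norm_of_nonneg hk.le]
    refine le_trans (mul_le_mul_of_nonneg_left (norm_inner_le_norm _ _) hk.le) ?_
    rw [← mul_assoc]
    exact h1
  have hmeas := S.aestronglyMeasurable_flux_inner (measurable_gradient (p t))
    (measurable_gradient (dt p t))
  have hint : IntegrableOn (fun x => K α a x ‖gradient (p t) x‖ *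
      inner ℝ (gradient (p t) x) (gradient (dt p t) x)) U :=
    hb.mono' hmeas (hle.mono fun x hx => hx t (mem_of_mem_nhds hs))
  refine ⟨hint, ?_⟩
  have hd := hasDerivAt_integral_of_dominated_loc_of_deriv_le (μ := volume.restrict U)
    (F := fun s x => potential α (fun j => a j x) ‖gradient (p s) x‖)
    (F' := fun s x => 2 * (K α a x ‖gradient (p s) x‖ *
      inner ℝ (gradient (p s) x) (gradient (dt p s) x)))
    (bound := fun x => 2 * b x) hs ?_ ?_ (hint.const_mul 2).aestronglyMeasurable ?_
    (hb.const_mul 2) ?_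
  · rw [← integral_const_mul]
    exact hd.2
  · exact Eventually.of_forall fun s =>
      S.aestronglyMeasurable_potential (measurable_gradient _).norm fun _ => norm_nonneg _
  · exact S.integrableOn_potential (measurable_gradient _) (hp.energy t ht)
  · filter_upwards [hle] with x hx s hs
    rw [norm_mul, Real.norm_of_nonneg zero_le_two]
    exact mul_le_mul_of_nonneg_left (hx s hs) zero_le_two
  · filter_upwards [S.ae_coeff, hp.grad_dt] with x hx hg s hs
    exact hx.hasDerivAt_potential (hg s hs.2)

end Setting

/-! ### Constants of the energy inequality -/

theorem add_rpow_le_four_mul {u v q : ℝ} (hu : 0 ≤ u) (hv : 0 ≤ v) (hq0 : 0 ≤ q) (hq : q ≤ 2) :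
    (u + v) ^ q ≤ 4 * (u ^ q + v ^ q) := by
  have h2 : (2 : ℝ) ^ q ≤ 4 := by
    calc (2 : ℝ) ^ q ≤ 2 ^ (2 : ℝ) := Real.rpow_le_rpow_of_exponent_le one_le_two hq
      _ = 4 := by norm_num
  have hm : 0 ≤ max u v := hu.trans (le_max_left _ _)
  calc (u + v) ^ q ≤ (2 * max u v) ^ q :=
        Real.rpow_le_rpow (by positivity) (by linarith [le_max_left u v, le_max_right u v]) hq0
    _ = 2 ^ q * max u v ^ q := Real.mul_rpow zero_le_two hm
    _ ≤ 4 * max u v ^ q := by gcongr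
    _ ≤ 4 * (u ^ q + v ^ q) := by
        have h3 := Real.rpow_nonneg hu q
        have h4 := Real.rpow_nonneg hv q
        rcases max_choice u v with h | h <;> rw [h] <;> linarith

/-- The coefficient of the damping term in the energy inequality. -/
def dampingConst (A cP : ℝ) : ℝ := 1 / (16 * cP ^ (2 - A))

/-- The coefficient of `G[Ψ]` in the energy inequality. -/
def forcingConst (A cP : ℝ) : ℝ :=
  3 / 2 + (1 / (1 / 16)) ^ (1 / (2 - A - 1)) * (2 * cP) ^ ((2 - A) / (2 - A - 1))

namespace Setting

variable {n N : ℕ} {U : Set (E n)} {φ : E n → ℝ} {α : Fin (N + 1) → ℝ}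
  {a : Fin (N + 1) → E n → ℝ} (S : Setting U φ α a)
include S

/-! ### Boundary data -/

theorem weighted_grad_nonneg (z : E n → E n) :
    0 ≤ ∫ x in U, W1 α a x * ‖z x‖ ^ (2 - expo α) :=
  integral_nonneg_of_ae (S.ae_coeff.mono fun _ hx =>
    mul_nonneg hx.weight_pos.le (Real.rpow_nonneg (norm_nonneg _) _))

omit S in
theorem integral_abs_sq_mul_eq_mass (u : E n → ℝ) :
    ∫ x in U, |u x| ^ 2 * φ x = mass U φ u := by
  unfold mass
  congr 1
  ext x
  rw [sq_abs, mul_comm]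

omit S in
theorem G_eq (Ψ : ℝ → E n → ℝ) (t : ℝ) : G U φ α a Ψ t =
    max (∫ x in U, a (Fin.last N) x) 1 + dual U a (gradient (Ψ t))
      + (∫ x in U, W1 α a x * ‖gradient (Ψ t) x‖ ^ (2 - expo α))
      + mass U φ (dt Ψ t) ^ ((2 - expo α) / (2 * (1 - expo α))) := by
  rw [G, integral_abs_sq_mul_eq_mass, dual]

theorem one_le_G (Ψ : ℝ → E n → ℝ) (t : ℝ) : 1 ≤ G U φ α a Ψ t := by
  rw [G_eq]
  have h1 := le_max_right (∫ x in U, a (Fin.last N) x) 1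
  have h2 := S.dual_nonneg (gradient (Ψ t))
  have h3 := S.weighted_grad_nonneg (gradient (Ψ t))
  have h4 := Real.rpow_nonneg (S.mass_nonneg (dt Ψ t)) ((2 - expo α) / (2 * (1 - expo α)))
  linarith

theorem G1_nonneg (Ψ : ℝ → E n → ℝ) (t : ℝ) : 0 ≤ G1 U a Ψ t := S.dual_nonneg _

theorem G2_nonneg (Ψ : ℝ → E n → ℝ) (t : ℝ) : 0 ≤ G2 U φ Ψ t :=
  integral_nonneg_of_ae (S.ae_porosity_nonneg.mono fun _ hx => mul_nonneg (sq_nonneg _) hx)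

/-- The exponent `(2-a) / (2(1-a))` exceeds `1`, so the last term of `G` dominates masses above `1`;
smaller ones are below `1 ≤ G`. -/
theorem mass_dt_le_G (Ψ : ℝ → E n → ℝ) (t : ℝ) : mass U φ (dt Ψ t) ≤ G U φ α a Ψ t := by
  have hA := S.expo_mem
  have h0 := S.one_le_G Ψ t
  rcases le_total (mass U φ (dt Ψ t)) 1 with h | h
  · exact h.trans h0
  · have h5 : mass U φ (dt Ψ t) ≤ mass U φ (dt Ψ t) ^ ((2 - expo α) / (2 * (1 - expo α))) := by
      refine Real.self_le_rpow_of_one_le h ?_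
      rw [le_div_iff₀ (by linarith [hA.2])]
      linarith [hA.1]
    rw [G_eq]
    have h1 := le_max_right (∫ x in U, a (Fin.last N) x) 1
    have h2 := S.dual_nonneg (gradient (Ψ t))
    have h3 := S.weighted_grad_nonneg (gradient (Ψ t))
    linarith

/-! ### Weighted gradient norms -/

theorem integrableOn_weighted_grad {y : E n → E n} (hy : Measurable y)
    (hyE : IntegrableOn (fun x => K α a x ‖y x‖ * ‖y x‖ ^ 2) U) :
    IntegrableOn (fun x => W1 α a x * ‖y x‖ ^ (2 - expo α)) U ∧
      ∫ x in U, W1 α a x * ‖y x‖ ^ (2 - expo α) ≤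
        energy U α a y + ∫ x in U, a (Fin.last N) x := by
  have hB := S.medium.integrable_coeff_last
  have hle : ∀ᵐ x ∂(volume.restrict U), W1 α a x * ‖y x‖ ^ (2 - expo α) ≤
      K α a x ‖y x‖ * ‖y x‖ ^ 2 + a (Fin.last N) x :=
    S.ae_coeff.mono fun x hx => hx.weight_mul_rpow_le (norm_nonneg _)
  have hint : IntegrableOn (fun x => W1 α a x * ‖y x‖ ^ (2 - expo α)) U := by
    refine (hyE.add hB).mono'
      (S.measurable_W1.mul (hy.norm.pow_const _)).aestronglyMeasurable ?_
    filter_upwards [S.ae_coeff, hle] with x hx h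
    have hW : 0 < W1 α a x := hx.weight_pos
    rw [Real.norm_of_nonneg (mul_nonneg hW.le (Real.rpow_nonneg (norm_nonneg _) _))]
    exact h
  refine ⟨hint, ?_⟩
  rw [energy, ← integral_add hyE hB]
  exact integral_mono_ae hint (hyE.add hB) hle

theorem weighted_grad_sub_le {y z w : E n → E n} (hy : Measurable y)
    (hyE : IntegrableOn (fun x => K α a x ‖y x‖ * ‖y x‖ ^ 2) U)
    (hzW : IntegrableOn (fun x => W1 α a x * ‖z x‖ ^ (2 - expo α)) U)
    (hw : ∀ᵐ x ∂(volume.restrict U), w x = y x - z x) :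
    ∫ x in U, W1 α a x * ‖w x‖ ^ (2 - expo α) ≤
      4 * (energy U α a y + (∫ x in U, a (Fin.last N) x)
        + ∫ x in U, W1 α a x * ‖z x‖ ^ (2 - expo α)) := by
  obtain ⟨h1, h2⟩ := S.integrableOn_weighted_grad hy hyE
  have hA := S.expo_mem
  calc ∫ x in U, W1 α a x * ‖w x‖ ^ (2 - expo α)
      ≤ ∫ x in U, 4 * (W1 α a x * ‖y x‖ ^ (2 - expo α) + W1 α a x * ‖z x‖ ^ (2 - expo α)) := by
        refine integral_mono_of_nonneg ?_ ((h1.add hzW).const_mul 4) ?_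
        · exact S.ae_coeff.mono fun x hx =>
            mul_nonneg hx.weight_pos.le (Real.rpow_nonneg (norm_nonneg _) _)
        · filter_upwards [S.ae_coeff, hw] with x hx hwx
          have hW : 0 < W1 α a x := hx.weight_pos
          have h3 : ‖w x‖ ^ (2 - expo α) ≤ (‖y x‖ + ‖z x‖) ^ (2 - expo α) := by
            rw [hwx]
            exact Real.rpow_le_rpow (norm_nonneg _) (norm_sub_le _ _) (by linarith [hA.2])
          have h4 := h3.trans (add_rpow_le_four_mul (norm_nonneg (y x)) (norm_nonneg (z x))
            (by linarith [hA.2] : 0 ≤ 2 - expo α) (by linarith [hA.1]))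
          have := mul_le_mul_of_nonneg_left h4 hW.le
          linarith
    _ = 4 * ((∫ x in U, W1 α a x * ‖y x‖ ^ (2 - expo α))
          + ∫ x in U, W1 α a x * ‖z x‖ ^ (2 - expo α)) := by
        rw [integral_const_mul, integral_add h1 hzW]
    _ ≤ _ := by linarith

/-! ### The energy inequality -/

omit S in
-- Gradients of differences split only almost everywhere; this inserts such a formula into the weak
-- equation.
theorem weak_of_ae {p Ψ : ℝ → E n → ℝ} (hp : IsSolution U φ α a p Ψ) {t : ℝ} (ht : 0 < t)
    {v : E n → ℝ} {w : E n → E n} (hv : ContinuousOn v (closure U)) (hvl : LocallyLipschitzOn U v)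
    (hv0 : ∀ x ∈ frontier U, v x = 0)
    (hw : ∀ᵐ x ∂(volume.restrict U), gradient v x = w x)
    (hint : IntegrableOn
      (fun x => K α a x ‖gradient (p t) x‖ * inner ℝ (gradient (p t) x) (w x)) U) :
    ∫ x in U, φ x * (dt p t x * v x) =
      -∫ x in U, K α a x ‖gradient (p t) x‖ * inner ℝ (gradient (p t) x) (w x) := by
  have he : (fun x => K α a x ‖gradient (p t) x‖ * inner ℝ (gradient (p t) x) (gradient v x))
      =ᵐ[volume.restrict U]
      fun x => K α a x ‖gradient (p t) x‖ * inner ℝ (gradient (p t) x) (w x) := by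
    filter_upwards [hw] with x hx
    rw [hx]
  have h := hp.weak t ht v hv hvl hv0 (hint.congr he.symm)
  rw [integral_congr_ae he] at h
  rw [← h]
  congr 1
  ext x
  ring

/-- Test with `p - Ψ`, which produces `-2 E`. The flux against `∇Ψ` uses up one `E`; the term with
`Ψ_t` and the damping term use `E / 4` each, both through `X ≤ 4 (E + G)` for `X = ∫ W₁ |∇(p -
Ψ)|^(2-a)`, and `E / 2` is left. The multiples of `G` add up to `1 + 1/4 + 1/4 + C₀`. -/
theorem energy_inequality {cP : ℝ} (hcP : 0 < cP) {p Ψ : ℝ → E n → ℝ}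
    (hΨ : IsBoundaryData U φ α a Ψ) (hp : IsSolution U φ α a p Ψ) {t : ℝ} (ht : 0 < t)
    (hPS : PoincareSobolev U φ α a cP (p t - Ψ t)) :
    2 * ∫ x in U, φ x * ((p - Ψ) t x * dt (p - Ψ) t x) ≤
      -(dampingConst (expo α) cP * mass U φ ((p - Ψ) t) ^ ((2 - expo α) / 2))
        - 1 / 2 * energy U α a (gradient (p t))
        + forcingConst (expo α) cP * G U φ α a Ψ t := by
  have hA := S.expo_mem
  have hpt := hp.regular.timeRegular
  have hΨt := hΨ.regular.timeRegular
  have hy := measurable_gradient (p t)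
  have hz := measurable_gradient (Ψ t)
  have hyE := hp.energy t ht
  have hzD := hΨ.integrable_grad t ht
  have hgrad := ae_gradient_sub S.isOpen (hp.regular.lip t ht) (hΨ.regular.lip t ht)
  have hcu : ContinuousOn (p t - Ψ t) (closure U) := (hpt.continuousOn ht).sub (hΨt.continuousOn ht)
  have hflux := S.integrableOn_flux_inner hy hz hyE hzD
  have hyy : (fun x => K α a x ‖gradient (p t) x‖ *
      inner ℝ (gradient (p t) x) (gradient (p t) x - gradient (Ψ t) x)) =
      fun x => K α a x ‖gradient (p t) x‖ * ‖gradient (p t) x‖ ^ 2 -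
        K α a x ‖gradient (p t) x‖ * inner ℝ (gradient (p t) x) (gradient (Ψ t) x) := by
    ext x
    rw [inner_sub_right, real_inner_self_eq_norm_sq]
    ring
  have hweak := weak_of_ae hp ht (v := p t - Ψ t)
    (w := fun x => gradient (p t) x - gradient (Ψ t) x) hcu
    ((hp.regular.lip t ht).sub (hΨ.regular.lip t ht))
    (fun x hx => by simp [hp.boundary t ht x hx]) hgrad
    (by rw [hyy]; exact hyE.sub hflux)
  rw [hyy, integral_sub hyE hflux] at hweak
  have hsplit : ∫ x in U, φ x * ((p - Ψ) t x * dt (p - Ψ) t x) =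
      (∫ x in U, φ x * (dt p t x * (p t - Ψ t) x)) -
        ∫ x in U, φ x * ((p t - Ψ t) x * dt Ψ t x) := by
    rw [← integral_sub
      (S.integrableOn_porosity_mul (f := fun x => dt p t x * (p t - Ψ t) x)
        ((hpt.continuousOn_dt ht).mul hcu))
      (S.integrableOn_porosity_mul (f := fun x => (p t - Ψ t) x * dt Ψ t x)
        (hcu.mul (hΨt.continuousOn_dt ht)))]
    refine integral_congr_ae ?_
    filter_upwards [S.ae_mem] with x hx
    rw [hpt.dt_sub hΨt ht (subset_closure hx)]
    simp only [Pi.sub_apply]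
    ring
  have h1 := S.integral_flux_inner_le hy hz hyE hzD
  have h2 := S.integral_porosity_mul_le hcu (hΨt.continuousOn_dt ht)
  have h3 := neg_le_of_abs_le h2
  set X := ∫ x in U, W1 α a x * ‖gradient (p t - Ψ t) x‖ ^ (2 - expo α) with hX
  have hX0 : 0 ≤ X := S.weighted_grad_nonneg _
  have h4 := S.mass_rpow_le hcP hPS hX.symm.le
  have hGX : X ≤ 4 * (energy U α a (gradient (p t)) + G U φ α a Ψ t) := by
    have h5 := S.weighted_grad_sub_le hy hyE (hΨ.integrable_grad_W1 t ht) hgrad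
    have h6 := G_eq (U := U) (φ := φ) (α := α) (a := a) Ψ t
    have h7 := le_max_left (∫ x in U, a (Fin.last N) x) 1
    have h8 := S.dual_nonneg (gradient (Ψ t))
    have h9 := Real.rpow_nonneg (S.mass_nonneg (dt Ψ t)) ((2 - expo α) / (2 * (1 - expo α)))
    linarith
  have hm0 := S.mass_nonneg (dt Ψ t)
  have hu0 := S.mass_nonneg (p t - Ψ t)
  set m := mass U φ (dt Ψ t) with hm
  set u := mass U φ (p t - Ψ t) with hu
  have hb0 : 0 ≤ m ^ (1 / 2 : ℝ) := Real.rpow_nonneg hm0 _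
  -- `ε = 1 / 16` because `X / 16 ≤ (E + G) / 4`.
  have hy1 := mul_rpow_le_add (b := 2 * cP * m ^ (1 / 2 : ℝ)) (X := X) (q := 2 - expo α)
    (ε := 1 / 16) (by positivity) hX0 (by linarith [hA.2]) (by norm_num)
  have hq0 : 0 < 2 - expo α - 1 := by linarith [hA.2]
  -- The conjugate exponent of `2 - a` turns `m ^ (1/2)` into exactly the power of the mass of `Ψ_t`
  -- that occurs in `G`.
  have e1 : (2 * cP * m ^ (1 / 2 : ℝ)) ^ ((2 - expo α) / (2 - expo α - 1)) =
      (2 * cP) ^ ((2 - expo α) / (2 - expo α - 1)) *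
        m ^ ((2 - expo α) / (2 * (1 - expo α))) := by
    rw [Real.mul_rpow (by positivity) hb0, ← Real.rpow_mul hm0]
    congr 2
    rw [show 2 - expo α - 1 = 1 - expo α by ring]
    have : 1 - expo α ≠ 0 := by linarith [hA.2]
    field_simp
  rw [e1, ← mul_assoc] at hy1
  have hG1 := S.one_le_G Ψ t
  have hGdual : dual U a (gradient (Ψ t)) ≤ G U φ α a Ψ t := by
    rw [G_eq]
    have h7 := le_max_right (∫ x in U, a (Fin.last N) x) 1
    have h8 := S.weighted_grad_nonneg (gradient (Ψ t))
    have h9 := Real.rpow_nonneg hm0 ((2 - expo α) / (2 * (1 - expo α)))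
    linarith
  have hGm : m ^ ((2 - expo α) / (2 * (1 - expo α))) ≤ G U φ α a Ψ t := by
    rw [G_eq]
    have h7 := le_max_right (∫ x in U, a (Fin.last N) x) 1
    have h8 := S.weighted_grad_nonneg (gradient (Ψ t))
    have h9 := S.dual_nonneg (gradient (Ψ t))
    linarith
  set C₀ := (1 / (1 / 16 : ℝ)) ^ (1 / (2 - expo α - 1)) *
    (2 * cP) ^ ((2 - expo α) / (2 - expo α - 1)) with hC₀
  have hC₀0 : 0 ≤ C₀ := by positivity
  have h10 := mul_le_mul_of_nonneg_left hGm hC₀0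
  have h11 : 2 * (u ^ (1 / 2 : ℝ) * m ^ (1 / 2 : ℝ)) ≤
      2 * cP * m ^ (1 / 2 : ℝ) * X ^ (1 / (2 - expo α)) := by
    have := mul_le_mul_of_nonneg_right h4 hb0
    linarith
  have h12 : dampingConst (expo α) cP * u ^ ((2 - expo α) / 2) ≤
      1 / 4 * (energy U α a (gradient (p t)) + G U φ α a Ψ t) := by
    have h13 := Real.rpow_le_rpow (Real.rpow_nonneg hu0 _) h4
      (show 0 ≤ 2 - expo α by linarith [hA.2])
    rw [← Real.rpow_mul hu0, Real.mul_rpow hcP.le (by positivity), ← Real.rpow_mul hX0,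
      one_div_mul_cancel (by linarith [hA.2]), Real.rpow_one,
      show (1 / 2 : ℝ) * (2 - expo α) = (2 - expo α) / 2 by ring] at h13
    have hcq : 0 < cP ^ (2 - expo α) := Real.rpow_pos_of_pos hcP _
    have h14 := h13.trans (mul_le_mul_of_nonneg_left hGX hcq.le)
    rw [dampingConst, one_div_mul_eq_div, div_le_iff₀ (by positivity)]
    linarith
  have e2 : forcingConst (expo α) cP = 3 / 2 + C₀ := rfl
  rw [hsplit, hweak, e2]
  have e3 : energy U α a (gradient (p t)) =
    ∫ x in U, K α a x ‖gradient (p t) x‖ * ‖gradient (p t) x‖ ^ 2 := rfl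
  have e4 : (p - Ψ) t = p t - Ψ t := rfl
  rw [e4, ← hu]
  linarith

/-! ### The inequality for the time derivative of the potential -/

/-- Test with `∂ₜ(p - Ψ)`. The time term is harmless because `-2 p_t (p_t - Ψ_t) ≤ Ψ_t²`; the flux
against `∇Ψ_t` costs `E + G₁`. -/
theorem potential_inequality {p Ψ : ℝ → E n → ℝ} (hΨ : IsBoundaryData U φ α a Ψ)
    (hp : IsSolution U φ α a p Ψ) {t : ℝ} (ht : 0 < t) :
    2 * ∫ x in U, K α a x ‖gradient (p t) x‖ *
        inner ℝ (gradient (p t) x) (gradient (dt p t) x) ≤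
      energy U α a (gradient (p t)) + (G U φ α a Ψ t + G1 U a Ψ t) := by
  have hpt := hp.regular.timeRegular
  have hΨt := hΨ.regular.timeRegular
  have hy := measurable_gradient (p t)
  have hyE := hp.energy t ht
  have hz := measurable_gradient (dt Ψ t)
  have hzD := hΨ.integrable_grad_dt t ht
  have hgrad := ae_gradient_sub S.isOpen (hp.regular.lip_dt t ht) (hΨ.regular.lip_dt t ht)
  have hcp := hpt.continuousOn_dt ht
  have hcΨ := hΨt.continuousOn_dt ht
  have hI := (S.hasDerivAt_integral_potential hp ht).1
  have hflux := S.integrableOn_flux_inner hy hz hyE hzD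
  have hsub : (fun x => K α a x ‖gradient (p t) x‖ *
      inner ℝ (gradient (p t) x) (gradient (dt p t) x - gradient (dt Ψ t) x)) =
      fun x => K α a x ‖gradient (p t) x‖ * inner ℝ (gradient (p t) x) (gradient (dt p t) x) -
        K α a x ‖gradient (p t) x‖ * inner ℝ (gradient (p t) x) (gradient (dt Ψ t) x) := by
    ext x
    rw [inner_sub_right]
    ring
  have hweak := weak_of_ae hp ht (v := dt p t - dt Ψ t)
    (w := fun x => gradient (dt p t) x - gradient (dt Ψ t) x) (hcp.sub hcΨ)
    ((hp.regular.lip_dt t ht).sub (hΨ.regular.lip_dt t ht))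
    (fun x hx => ?_) hgrad (by rw [hsub]; exact hI.sub hflux)
  · rw [hsub, integral_sub hI hflux] at hweak
    have h1 := S.integral_flux_inner_le hy hz hyE hzD
    have h2 : -(2 * ∫ x in U, φ x * (dt p t x * (dt p t - dt Ψ t) x)) ≤ mass U φ (dt Ψ t) := by
      rw [← integral_const_mul, ← integral_neg]
      refine integral_mono_ae ((S.integrableOn_porosity_mul
        (f := fun x => dt p t x * (dt p t - dt Ψ t) x) (hcp.mul (hcp.sub hcΨ))).const_mul 2).neg
        (S.integrableOn_porosity_mul (f := fun x => dt Ψ t x ^ 2) (hcΨ.pow 2)) ?_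
      filter_upwards [S.ae_porosity_nonneg] with x hx
      simp only [Pi.sub_apply]
      have h3 := mul_nonneg hx (sq_nonneg (dt p t x - dt Ψ t x))
      have h4 := mul_nonneg hx (sq_nonneg (dt p t x))
      nlinarith
    have h3 := S.mass_dt_le_G Ψ t
    have e : G1 U a Ψ t = dual U a (gradient (dt Ψ t)) := rfl
    rw [e]
    linarith
  -- The boundary values agree at all nearby times, so their time derivatives agree too and the test
  -- function vanishes on the boundary.
  · have he : (fun s => p s x) =ᶠ[𝓝 t] fun s => Ψ s x := by
      filter_upwards [lt_mem_nhds ht] with s hs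
      exact hp.boundary s hs x hx
    simp only [Pi.sub_apply, dt, he.deriv_eq, sub_self]

/-! ### The difference of two solutions -/

/-- Let `Z` be the integral on the right. Hölder's inequality with weights `(2-a)/2` and `a/2` gives
`∫ W₁ |∇u|^(2-a) ≤ Z^((2-a)/2) Λ^(a/2)`; the Poincaré-Sobolev inequality raises this to the power
`1/(2-a)`, and squaring makes it linear in `Z`. -/
theorem mass_le_of_coercivity {cP Λ : ℝ} (hcP : 0 < cP) (hΛ : 0 < Λ) {u : E n → ℝ} {y z : E n → E n}
    (hu : PoincareSobolev U φ α a cP u)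
    (hyE : IntegrableOn (fun x => K α a x ‖y x‖ * ‖y x‖ ^ 2) U)
    (hzE : IntegrableOn (fun x => K α a x ‖z x‖ * ‖z x‖ ^ 2) U)
    (hI : IntegrableOn (fun x => K α a x (max ‖y x‖ ‖z x‖) * ‖gradient u x‖ ^ 2) U)
    (hle : energy U α a y + energy U α a z + ∫ x in U, a (Fin.last N) x ≤ Λ) :
    mass U φ u ≤ cP ^ 2 * Λ ^ (expo α / (2 - expo α)) *
      ∫ x in U, K α a x (max ‖y x‖ ‖z x‖) * ‖gradient u x‖ ^ 2 := by
  have hA := S.expo_mem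
  have hB := S.medium.integrable_coeff_last
  have hw : 1 - (2 - expo α) / 2 = expo α / 2 := by ring
  have hg0 : ∀ᵐ x ∂(volume.restrict U), 0 ≤
      K α a x ‖y x‖ * ‖y x‖ ^ 2 + K α a x ‖z x‖ * ‖z x‖ ^ 2 + a (Fin.last N) x := by
    filter_upwards [S.ae_coeff] with x hx
    have h1 : 0 < K α a x ‖y x‖ := hx.cond_pos _
    have h2 : 0 < K α a x ‖z x‖ := hx.cond_pos _
    have h3 : 0 < a (Fin.last N) x := hx.last_pos
    positivity
  have hE2 : IntegrableOn (fun x => K α a x ‖y x‖ * ‖y x‖ ^ 2 + K α a x ‖z x‖ * ‖z x‖ ^ 2) U :=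
    hyE.add hzE
  have hE3 : IntegrableOn (fun x => K α a x ‖y x‖ * ‖y x‖ ^ 2 + K α a x ‖z x‖ * ‖z x‖ ^ 2 +
      a (Fin.last N) x) U := hE2.add hB
  have hf0 : ∀ᵐ x ∂(volume.restrict U),
      0 ≤ K α a x (max ‖y x‖ ‖z x‖) * ‖gradient u x‖ ^ 2 :=
    S.ae_coeff.mono fun x hx => mul_nonneg (hx.cond_pos _).le (sq_nonneg _)
  have hH := (integral_le_rpow_mul_rpow (μ := volume.restrict U) (w := (2 - expo α) / 2)
    (F := fun x => W1 α a x * ‖gradient u x‖ ^ (2 - expo α))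
    (f := fun x => K α a x (max ‖y x‖ ‖z x‖) * ‖gradient u x‖ ^ 2)
    (g := fun x => K α a x ‖y x‖ * ‖y x‖ ^ 2 + K α a x ‖z x‖ * ‖z x‖ ^ 2 + a (Fin.last N) x)
    (by linarith [hA.2]) (by linarith [hA.1])
    (S.measurable_W1.mul ((measurable_gradient u).norm.pow_const _)).aestronglyMeasurable
    (S.ae_coeff.mono fun x hx =>
      mul_nonneg hx.weight_pos.le (Real.rpow_nonneg (norm_nonneg _) _))
    hI hE3 hf0 hg0 ?_).2
  · have e1 : ∫ x in U, (K α a x ‖y x‖ * ‖y x‖ ^ 2 + K α a x ‖z x‖ * ‖z x‖ ^ 2 +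
        a (Fin.last N) x) = energy U α a y + energy U α a z + ∫ x in U, a (Fin.last N) x := by
      rw [integral_add hE2 hB, integral_add hyE hzE]
      rfl
    rw [hw, e1] at hH
    set Z := ∫ x in U, K α a x (max ‖y x‖ ‖z x‖) * ‖gradient u x‖ ^ 2 with hZ
    have hZ0 : 0 ≤ Z := integral_nonneg_of_ae hf0
    have h0 : 0 ≤ energy U α a y + energy U α a z + ∫ x in U, a (Fin.last N) x := by
      rw [← e1]; exact integral_nonneg_of_ae hg0
    have h1 := hH.trans (mul_le_mul_of_nonneg_left
      (Real.rpow_le_rpow h0 hle (by linarith [hA.1])) (Real.rpow_nonneg hZ0 _))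
    have h2 := S.mass_rpow_le hcP hu h1
    have hq : (2 - expo α) ≠ 0 := by linarith [hA.2]
    rw [Real.mul_rpow (by positivity) (by positivity), ← Real.rpow_mul hZ0,
      ← Real.rpow_mul hΛ.le, show (2 - expo α) / 2 * (1 / (2 - expo α)) = 1 / 2 by field_simp,
      show expo α / 2 * (1 / (2 - expo α)) = expo α / (2 - expo α) * (1 / 2) by field_simp,
      Real.rpow_mul hΛ.le] at h2
    have h3 := Real.rpow_le_rpow (Real.rpow_nonneg (S.mass_nonneg u) _) h2 zero_le_two
    have hsq : ∀ b : ℝ, 0 ≤ b → (b ^ (1 / 2 : ℝ)) ^ (2 : ℝ) = b := fun b hb => by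
      rw [← Real.rpow_mul hb]; norm_num
    rw [hsq _ (S.mass_nonneg u), Real.mul_rpow hcP.le (by positivity),
      Real.mul_rpow (by positivity) (by positivity), hsq _ hZ0, hsq _ (by positivity),
      Real.rpow_two] at h3
    linarith
  · filter_upwards [S.ae_coeff] with x hx
    have hm : 0 ≤ max ‖y x‖ ‖z x‖ := (norm_nonneg _).trans (le_max_left _ _)
    refine (hx.weight_mul_rpow_le_mul hm (norm_nonneg (gradient u x))).trans ?_
    rw [hw]
    have hk := hx.cond_pos (max ‖y x‖ ‖z x‖)
    have h1 : 0 < K α a x ‖y x‖ := hx.cond_pos _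
    have h2 : 0 < K α a x ‖z x‖ := hx.cond_pos _
    have h3 : 0 < a (Fin.last N) x := hx.last_pos
    refine mul_le_mul_of_nonneg_left (Real.rpow_le_rpow (by positivity) ?_ (by linarith [hA.1]))
      (by positivity)
    refine add_le_add_left ?_ _
    rcases max_choice ‖y x‖ ‖z x‖ with h | h <;> rw [h]
    · exact le_add_of_nonneg_right (by positivity)
    · exact le_add_of_nonneg_left (by positivity)

/-- Here `y, z, w` stand for `∇p₁, ∇p₂, ∇Φ`. Monotonicity controls `y - z`, while the test function
has gradient `y - z - w`; the passage uses `|y - z - w|² ≤ 2 |y - z|² + 2 |w|²` and `K ≤ a₀⁻¹`. -/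
theorem flux_sub_inner_ge {x : E n} (hx : x ∈ U) (y z w : E n) :
    (1 - expo α) * (K α a x (max ‖y‖ ‖z‖) * ‖y - z - w‖ ^ 2) - 2 * ((a 0 x)⁻¹ * ‖w‖ ^ 2)
        - 2 * (K α a x ‖y‖ * (‖y‖ * ‖w‖) + K α a x ‖z‖ * (‖z‖ * ‖w‖)) ≤
      2 * (K α a x ‖y‖ * inner ℝ y (y - z - w) - K α a x ‖z‖ * inner ℝ z (y - z - w)) := by
  have hA := S.expo_mem
  have hc := S.coeff hx
  have h1 : (1 - expo α) * (K α a x (max ‖y‖ ‖z‖) * ‖y - z‖ ^ 2) ≤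
      inner ℝ (K α a x ‖y‖ • y - K α a x ‖z‖ • z) (y - z) := hc.flux_monotone y z
  have hk : 0 < K α a x (max ‖y‖ ‖z‖) := hc.cond_pos _
  have hka : K α a x (max ‖y‖ ‖z‖) ≤ (a 0 x)⁻¹ := hc.cond_le _
  have h2 : 0 < K α a x ‖y‖ := hc.cond_pos _
  have h3 : 0 < K α a x ‖z‖ := hc.cond_pos _
  have h4 := mul_le_mul_of_nonneg_left (real_inner_le_norm y w) h2.le
  have h5 := mul_le_mul_of_nonneg_left (neg_le_of_abs_le (abs_real_inner_le_norm z w)) h3.le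
  have h6 : ‖y - z - w‖ ^ 2 ≤ 2 * ‖y - z‖ ^ 2 + 2 * ‖w‖ ^ 2 := by
    have := parallelogram_law_with_norm ℝ (y - z) w
    nlinarith [sq_nonneg ‖y - z + w‖]
  have h7 := mul_le_mul_of_nonneg_left h6
    (mul_nonneg (sub_nonneg.2 hA.2.le) hk.le : 0 ≤ (1 - expo α) * K α a x (max ‖y‖ ‖z‖))
  have h8 : (1 - expo α) * K α a x (max ‖y‖ ‖z‖) * ‖w‖ ^ 2 ≤ (a 0 x)⁻¹ * ‖w‖ ^ 2 := by
    refine mul_le_mul_of_nonneg_right ?_ (sq_nonneg _)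
    nlinarith [hA.1]
  have e : 2 * (K α a x ‖y‖ * inner ℝ y (y - z - w) - K α a x ‖z‖ * inner ℝ z (y - z - w)) =
      2 * inner ℝ (K α a x ‖y‖ • y - K α a x ‖z‖ • z) (y - z) -
        2 * (K α a x ‖y‖ * inner ℝ y w - K α a x ‖z‖ * inner ℝ z w) := by
    rw [inner_sub_right (x := y) (z := w), inner_sub_right (x := z) (z := w),
      inner_sub_left (x := K α a x ‖y‖ • y), real_inner_smul_left, real_inner_smul_left]
    ring
  rw [e]
  linarith

end Setting

namespace Setting

variable {n N : ℕ} {U : Set (E n)} {φ : E n → ℝ} {α : Fin (N + 1) → ℝ}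
  {a : Fin (N + 1) → E n → ℝ} (S : Setting U φ α a)
include S

theorem integrableOn_dual_sub {y z w : E n → E n} (hw : Measurable w)
    (hy : IntegrableOn (fun x => (a 0 x)⁻¹ * ‖y x‖ ^ 2) U)
    (hz : IntegrableOn (fun x => (a 0 x)⁻¹ * ‖z x‖ ^ 2) U)
    (he : ∀ᵐ x ∂(volume.restrict U), w x = y x - z x) :
    IntegrableOn (fun x => (a 0 x)⁻¹ * ‖w x‖ ^ 2) U := by
  refine ((hy.add hz).const_mul 2).mono'
    ((S.medium.measurable_coeff 0).inv.mul (hw.norm.pow_const 2)).aestronglyMeasurable ?_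
  filter_upwards [S.ae_coeff, he] with x hx hwx
  have h0 : 0 < a 0 x := hx.pos
  rw [Real.norm_of_nonneg (by positivity), hwx]
  have h1 := parallelogram_law_with_norm ℝ (y x) (z x)
  have h2 : ‖y x - z x‖ ^ 2 ≤ 2 * (‖y x‖ ^ 2 + ‖z x‖ ^ 2) := by
    nlinarith [sq_nonneg ‖y x + z x‖]
  have := mul_le_mul_of_nonneg_left h2 (inv_nonneg.2 h0.le)
  simp only [Pi.add_apply]
  linarith

/-- `K` at the larger norm is at most `K(|y|)`, `K(|z|)` and `a₀⁻¹`; each bound serves one of the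
three parts of `v`. -/
theorem integrableOn_K_max_mul_sq {y z w v : E n → E n} (hy : Measurable y) (hz : Measurable z)
    (hv : Measurable v)
    (hyE : IntegrableOn (fun x => K α a x ‖y x‖ * ‖y x‖ ^ 2) U)
    (hzE : IntegrableOn (fun x => K α a x ‖z x‖ * ‖z x‖ ^ 2) U)
    (hwD : IntegrableOn (fun x => (a 0 x)⁻¹ * ‖w x‖ ^ 2) U)
    (he : ∀ᵐ x ∂(volume.restrict U), v x = y x - z x - w x) :
    IntegrableOn (fun x => K α a x (max ‖y x‖ ‖z x‖) * ‖v x‖ ^ 2) U := by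
  refine (((hyE.add hzE).add hwD).const_mul 3).mono'
    ((S.aestronglyMeasurable_K (hy.norm.max hz.norm)
      fun _ => (norm_nonneg _).trans (le_max_left _ _)).mul
      (hv.norm.pow_const 2).aestronglyMeasurable) ?_
  filter_upwards [S.ae_coeff, he] with x hx hvx
  have hk : 0 < K α a x (max ‖y x‖ ‖z x‖) := hx.cond_pos _
  have hka : K α a x (max ‖y x‖ ‖z x‖) ≤ (a 0 x)⁻¹ := hx.cond_le _
  have hky : K α a x (max ‖y x‖ ‖z x‖) ≤ K α a x ‖y x‖ :=
    hx.cond_anti (norm_nonneg _) (le_max_left _ _)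
  have hkz : K α a x (max ‖y x‖ ‖z x‖) ≤ K α a x ‖z x‖ :=
    hx.cond_anti (norm_nonneg _) (le_max_right _ _)
  rw [Real.norm_of_nonneg (by positivity), hvx]
  have h1 : ‖y x - z x - w x‖ ≤ ‖y x‖ + ‖z x‖ + ‖w x‖ :=
    (norm_sub_le _ _).trans (add_le_add_left (norm_sub_le _ _) _)
  have h2 : ‖y x - z x - w x‖ ^ 2 ≤ 3 * (‖y x‖ ^ 2 + ‖z x‖ ^ 2 + ‖w x‖ ^ 2) := by
    have := pow_le_pow_left₀ (norm_nonneg _) h1 2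
    nlinarith [sq_nonneg (‖y x‖ - ‖z x‖), sq_nonneg (‖y x‖ - ‖w x‖), sq_nonneg (‖z x‖ - ‖w x‖)]
  have h3 := mul_le_mul_of_nonneg_left h2 hk.le
  have h4 := mul_le_mul_of_nonneg_right hky (sq_nonneg ‖y x‖)
  have h5 := mul_le_mul_of_nonneg_right hkz (sq_nonneg ‖z x‖)
  have h6 := mul_le_mul_of_nonneg_right hka (sq_nonneg ‖w x‖)
  simp only [Pi.add_apply]
  linarith

theorem integral_flux_sub_ge {y z w v : E n → E n} (hy : Measurable y) (hz : Measurable z)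
    (hw : Measurable w)
    (hyE : IntegrableOn (fun x => K α a x ‖y x‖ * ‖y x‖ ^ 2) U)
    (hzE : IntegrableOn (fun x => K α a x ‖z x‖ * ‖z x‖ ^ 2) U)
    (hwD : IntegrableOn (fun x => (a 0 x)⁻¹ * ‖w x‖ ^ 2) U)
    (hI : IntegrableOn (fun x => K α a x (max ‖y x‖ ‖z x‖) * ‖v x‖ ^ 2) U)
    (he : ∀ᵐ x ∂(volume.restrict U), v x = y x - z x - w x)
    (hIy : IntegrableOn (fun x => K α a x ‖y x‖ * inner ℝ (y x) (v x)) U)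
    (hIz : IntegrableOn (fun x => K α a x ‖z x‖ * inner ℝ (z x) (v x)) U) :
    (1 - expo α) * (∫ x in U, K α a x (max ‖y x‖ ‖z x‖) * ‖v x‖ ^ 2) - 2 * dual U a w
        - 2 * ((energy U α a y ^ (1 / 2 : ℝ) + energy U α a z ^ (1 / 2 : ℝ)) *
          dual U a w ^ (1 / 2 : ℝ)) ≤
      2 * ((∫ x in U, K α a x ‖y x‖ * inner ℝ (y x) (v x)) -
        ∫ x in U, K α a x ‖z x‖ * inner ℝ (z x) (v x)) := by
  obtain ⟨h1, h2⟩ := S.integral_flux_norm_le hy hw hyE hwD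
  obtain ⟨h3, h4⟩ := S.integral_flux_norm_le hz hw hzE hwD
  have hL : IntegrableOn (fun x => (1 - expo α) * (K α a x (max ‖y x‖ ‖z x‖) * ‖v x‖ ^ 2) -
      2 * ((a 0 x)⁻¹ * ‖w x‖ ^ 2)) U := (hI.const_mul _).sub (hwD.const_mul 2)
  have hR : IntegrableOn (fun x => K α a x ‖y x‖ * (‖y x‖ * ‖w x‖) +
      K α a x ‖z x‖ * (‖z x‖ * ‖w x‖)) U := h1.add h3
  have key : ∫ x in U, ((1 - expo α) * (K α a x (max ‖y x‖ ‖z x‖) * ‖v x‖ ^ 2) -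
      2 * ((a 0 x)⁻¹ * ‖w x‖ ^ 2) - 2 * (K α a x ‖y x‖ * (‖y x‖ * ‖w x‖) +
      K α a x ‖z x‖ * (‖z x‖ * ‖w x‖))) ≤
      ∫ x in U, 2 * (K α a x ‖y x‖ * inner ℝ (y x) (v x) -
        K α a x ‖z x‖ * inner ℝ (z x) (v x)) := by
    refine integral_mono_ae (hL.sub (hR.const_mul 2)) ((hIy.sub hIz).const_mul 2) ?_
    filter_upwards [S.ae_mem, he] with x hx hvx
    rw [hvx]
    exact S.flux_sub_inner_ge hx (y x) (z x) (w x)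
  rw [integral_sub hL (hR.const_mul 2), integral_sub (hI.const_mul _) (hwD.const_mul 2),
    integral_const_mul, integral_const_mul, integral_const_mul, integral_const_mul,
    integral_add h1 h3, integral_sub hIy hIz] at key
  have e : dual U a w = ∫ x in U, (a 0 x)⁻¹ * ‖w x‖ ^ 2 := rfl
  rw [← e] at key
  linarith

/-- Subtract the two equations, both tested with `P`. The bound `Λ` acts twice: it weakens the
coercivity by `Λ ^ (a/(2-a))`, and its square root bounds the factors that multiply `∇Φ` and `Φ_t`
in the cross terms. -/
theorem difference_inequality {cP Λ : ℝ} (hcP : 0 < cP) (hΛ : 1 ≤ Λ) {p₁ p₂ Ψ₁ Ψ₂ : ℝ → E n → ℝ}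
    (hΨ₁ : IsBoundaryData U φ α a Ψ₁) (hΨ₂ : IsBoundaryData U φ α a Ψ₂)
    (hp₁ : IsSolution U φ α a p₁ Ψ₁) (hp₂ : IsSolution U φ α a p₂ Ψ₂) {t : ℝ} (ht : 0 < t)
    (hPS : PoincareSobolev U φ α a cP ((p₁ t - Ψ₁ t) - (p₂ t - Ψ₂ t)))
    (hE : energy U α a (gradient (p₁ t)) + energy U α a (gradient (p₂ t)) +
      ∫ x in U, a (Fin.last N) x ≤ Λ)
    (hm : mass U φ (((p₁ - Ψ₁) - (p₂ - Ψ₂)) t) ≤ Λ) :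
    2 * ∫ x in U, φ x * (((p₁ - Ψ₁) - (p₂ - Ψ₂)) t x * dt ((p₁ - Ψ₁) - (p₂ - Ψ₂)) t x) ≤
      -((1 - expo α) / cP ^ 2 * Λ ^ (-(expo α / (2 - expo α))) *
          mass U φ (((p₁ - Ψ₁) - (p₂ - Ψ₂)) t))
        + 4 * (Λ ^ (1 / 2 : ℝ) * D U φ a (Ψ₁ - Ψ₂) t) := by
  have hA := S.expo_mem
  have hΛ0 : 0 < Λ := one_pos.trans_le hΛ
  set P := (p₁ - Ψ₁) - (p₂ - Ψ₂) with hP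
  have hPt : P t = (p₁ t - Ψ₁ t) - (p₂ t - Ψ₂ t) := rfl
  have hp₁t := hp₁.regular.timeRegular
  have hp₂t := hp₂.regular.timeRegular
  have hΨ₁t := hΨ₁.regular.timeRegular
  have hΨ₂t := hΨ₂.regular.timeRegular
  have l₁ := hp₁.regular.lip t ht
  have l₂ := hp₂.regular.lip t ht
  have m₁ := hΨ₁.regular.lip t ht
  have m₂ := hΨ₂.regular.lip t ht
  have hcP' : ContinuousOn (P t) (closure U) := ((hp₁t.sub hΨ₁t).sub (hp₂t.sub hΨ₂t)).continuousOn ht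
  have hlip : LocallyLipschitzOn U (P t) := (l₁.sub m₁).sub (l₂.sub m₂)
  have hy := measurable_gradient (p₁ t)
  have hz := measurable_gradient (p₂ t)
  have hw := measurable_gradient ((Ψ₁ - Ψ₂) t)
  have hv := measurable_gradient (P t)
  have hyE := hp₁.energy t ht
  have hzE := hp₂.energy t ht
  have hwe : ∀ᵐ x ∂(volume.restrict U), gradient ((Ψ₁ - Ψ₂) t) x =
      gradient (Ψ₁ t) x - gradient (Ψ₂ t) x := ae_gradient_sub S.isOpen m₁ m₂
  have hwD := S.integrableOn_dual_sub hw (hΨ₁.integrable_grad t ht) (hΨ₂.integrable_grad t ht) hwe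
  have hgrad : ∀ᵐ x ∂(volume.restrict U), gradient (P t) x =
      gradient (p₁ t) x - gradient (p₂ t) x - gradient ((Ψ₁ - Ψ₂) t) x := by
    filter_upwards [hwe, ae_gradient_sub S.isOpen l₁ m₁, ae_gradient_sub S.isOpen l₂ m₂,
      ae_gradient_sub S.isOpen (u := p₁ t - Ψ₁ t) (v := p₂ t - Ψ₂ t) (l₁.sub m₁)
        (l₂.sub m₂)] with x h1 h2 h3 h4
    rw [hPt, h4, h1, h2, h3]
    abel
  have hI := S.integrableOn_K_max_mul_sq hy hz hv hyE hzE hwD hgrad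
  -- `∇P` has three parts: those from `p₁` and `p₂` are paired using finite energy, the one from `Φ`
  -- using the weight `a₀⁻¹`.
  have hflux : ∀ q : E n → E n, Measurable q →
      IntegrableOn (fun x => K α a x ‖q x‖ * ‖q x‖ ^ 2) U →
      IntegrableOn (fun x => K α a x ‖q x‖ * inner ℝ (q x) (gradient (P t) x)) U := by
    intro q hq hqE
    refine (((S.integrableOn_flux_inner_of_energy hq hy hqE hyE).sub
      (S.integrableOn_flux_inner_of_energy hq hz hqE hzE)).sub
      (S.integrableOn_flux_inner hq hw hqE hwD)).congr ?_
    filter_upwards [hgrad] with x hx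
    simp only [Pi.sub_apply]
    rw [hx, inner_sub_right, inner_sub_right, mul_sub, mul_sub]
    rfl
  have hIy := hflux _ hy hyE
  have hIz := hflux _ hz hzE
  have hb : ∀ x ∈ frontier U, P t x = 0 := fun x hx => by
    rw [hPt]
    simp [hp₁.boundary t ht x hx, hp₂.boundary t ht x hx]
  have w₁ := weak_of_ae hp₁ ht hcP' hlip hb (Eventually.of_forall fun x => rfl) hIy
  have w₂ := weak_of_ae hp₂ ht hcP' hlip hb (Eventually.of_forall fun x => rfl) hIz
  have hcΦ : ContinuousOn (dt (Ψ₁ - Ψ₂) t) (closure U) := (hΨ₁t.sub hΨ₂t).continuousOn_dt ht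
  have i₁ := S.integrableOn_porosity_mul (f := fun x => dt p₁ t x * P t x)
    ((hp₁t.continuousOn_dt ht).mul hcP')
  have i₂ := S.integrableOn_porosity_mul (f := fun x => dt p₂ t x * P t x)
    ((hp₂t.continuousOn_dt ht).mul hcP')
  have i₃ := S.integrableOn_porosity_mul (f := fun x => P t x * dt (Ψ₁ - Ψ₂) t x) (hcP'.mul hcΦ)
  have hsplit : ∫ x in U, φ x * (P t x * dt P t x) =
      (∫ x in U, φ x * (dt p₁ t x * P t x)) - (∫ x in U, φ x * (dt p₂ t x * P t x)) -
        ∫ x in U, φ x * (P t x * dt (Ψ₁ - Ψ₂) t x) := by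
    have i₁₂ : IntegrableOn (fun x => φ x * (dt p₁ t x * P t x) - φ x * (dt p₂ t x * P t x)) U :=
      i₁.sub i₂
    rw [← integral_sub i₁ i₂, ← integral_sub i₁₂ i₃]
    refine integral_congr_ae ?_
    filter_upwards [S.ae_mem] with x hx
    have hx' := subset_closure hx
    rw [hP, (hp₁t.sub hΨ₁t).dt_sub (hp₂t.sub hΨ₂t) ht hx', hp₁t.dt_sub hΨ₁t ht hx',
      hp₂t.dt_sub hΨ₂t ht hx', hΨ₁t.dt_sub hΨ₂t ht hx']
    ring
  have h1 := S.integral_flux_sub_ge hy hz hw hyE hzE hwD hI hgrad hIy hIz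
  have h2 := neg_le_of_abs_le (S.integral_porosity_mul_le hcP' hcΦ)
  have h3 := S.mass_le_of_coercivity hcP hΛ0 hPS hyE hzE hI hE
  rw [← hPt] at h3
  set Z := ∫ x in U, K α a x (max ‖gradient (p₁ t) x‖ ‖gradient (p₂ t) x‖) *
    ‖gradient (P t) x‖ ^ 2
  have hB0 : 0 ≤ ∫ x in U, a (Fin.last N) x :=
    integral_nonneg_of_ae (S.ae_coeff.mono fun x hx => hx.last_pos.le)
  have hE₁ := S.energy_nonneg (gradient (p₁ t))
  have hE₂ := S.energy_nonneg (gradient (p₂ t))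
  have hd := S.dual_nonneg (gradient ((Ψ₁ - Ψ₂) t))
  have hd' := Real.rpow_nonneg hd (1 / 2)
  have hμ := Real.rpow_nonneg (S.mass_nonneg (dt (Ψ₁ - Ψ₂) t)) (1 / 2)
  have r₁ := Real.rpow_le_rpow hE₁ (by linarith : _ ≤ Λ) (by norm_num : (0 : ℝ) ≤ 1 / 2)
  have r₂ := Real.rpow_le_rpow hE₂ (by linarith : _ ≤ Λ) (by norm_num : (0 : ℝ) ≤ 1 / 2)
  have r₃ := Real.rpow_le_rpow (S.mass_nonneg _) hm (by norm_num : (0 : ℝ) ≤ 1 / 2)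
  have r₄ : 1 ≤ Λ ^ (1 / 2 : ℝ) := Real.one_le_rpow hΛ (by norm_num)
  have s₁ := mul_le_mul_of_nonneg_right r₁ hd'
  have s₂ := mul_le_mul_of_nonneg_right r₂ hd'
  have s₃ := mul_le_mul_of_nonneg_right r₃ hμ
  have s₄ := mul_le_mul_of_nonneg_right r₄ hd
  have hDe : D U φ a (Ψ₁ - Ψ₂) t = dual U a (gradient ((Ψ₁ - Ψ₂) t)) +
      dual U a (gradient ((Ψ₁ - Ψ₂) t)) ^ (1 / 2 : ℝ) +
      mass U φ (dt (Ψ₁ - Ψ₂) t) ^ (1 / 2 : ℝ) := by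
    rw [D, integral_abs_sq_mul_eq_mass, dual]
  have h4 : (1 - expo α) / cP ^ 2 * Λ ^ (-(expo α / (2 - expo α))) * mass U φ (P t) ≤
      (1 - expo α) * Z := by
    have hpos : 0 < Λ ^ (expo α / (2 - expo α)) := Real.rpow_pos_of_pos hΛ0 _
    have h5 := mul_le_mul_of_nonneg_left h3
      (show 0 ≤ (1 - expo α) / cP ^ 2 * Λ ^ (-(expo α / (2 - expo α))) from
        mul_nonneg (div_nonneg (by linarith [hA.2]) (by positivity)) (by positivity))
    refine h5.trans (le_of_eq ?_)
    rw [Real.rpow_neg hΛ0.le]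
    field_simp
  have s₅ := mul_nonneg (Real.rpow_nonneg hΛ0.le (1 / 2)) hd
  have s₆ := mul_nonneg (Real.rpow_nonneg hΛ0.le (1 / 2)) hμ
  rw [hsplit, w₁, w₂, hDe]
  linarith

theorem energy_le {cP : ℝ} (hcP : 0 < cP) {p Ψ : ℝ → E n → ℝ}
    (hΨ : IsBoundaryData U φ α a Ψ) (hp : IsSolution U φ α a p Ψ)
    (hPS : ∀ t > 0, PoincareSobolev U φ α a cP (p t - Ψ t)) {t : ℝ} (ht : 1 < t) :
    energy U α a (gradient (p t)) ≤ 8 * mass U φ ((p - Ψ) (t - 1)) +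
      ∫ s in (t - 1)..t, ((G U φ α a Ψ s + G1 U a Ψ s) +
        8 * (forcingConst (expo α) cP * G U φ α a Ψ s)) := by
  have hA := S.expo_mem
  have hu := hp.regular.timeRegular.sub hΨ.regular.timeRegular
  refine (S.energy_le_integral_potential (measurable_gradient _)
    (hp.energy t (by linarith))).trans ?_
  refine le_add_integral_of_deriv_le
    (J := fun s => ∫ x in U, potential α (fun j => a j x) ‖gradient (p s) x‖)
    (y := fun s => mass U φ ((p - Ψ) s)) (A := fun s => G U φ α a Ψ s + G1 U a Ψ s)
    (B := fun s => forcingConst (expo α) cP * G U φ α a Ψ s) ht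
    (fun s hs => (S.hasDerivAt_integral_potential hp hs).2)
    (fun s hs => S.hasDerivAt_mass hu hs) (fun s hs => ?_) (fun s _ => S.mass_nonneg _)
    (fun s _ => ?_) (fun s hs => ?_) (fun s hs => ?_) (hΨ.cont_G.add hΨ.cont_G1)
    (continuousOn_const.mul hΨ.cont_G)
  · exact (S.energy_nonneg _).trans
      (S.energy_le_integral_potential (measurable_gradient _) (hp.energy s hs))
  · linarith [S.one_le_G Ψ s, S.G1_nonneg Ψ s]
  · have h1 := S.potential_inequality hΨ hp hs
    have h2 := S.energy_le_integral_potential (measurable_gradient _) (hp.energy s hs)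
    linarith
  -- The potential integral is at most `2 E`, so `-E / 2` is at most minus a quarter of it.
  · have h1 := S.energy_inequality hcP hΨ hp hs (hPS s hs)
    have h2 := S.integral_potential_le (measurable_gradient _) (hp.energy s hs)
    have h3 : 0 ≤ dampingConst (expo α) cP * mass U φ ((p - Ψ) s) ^ ((2 - expo α) / 2) :=
      mul_nonneg (by unfold dampingConst; positivity) (Real.rpow_nonneg (S.mass_nonneg _) _)
    linarith

end Setting

/-! ### The estimate for an abstract growth function `V` -/

theorem forcingConst_nonneg (A : ℝ) {cP : ℝ} (hcP : 0 < cP) : 0 ≤ forcingConst A cP := by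
  unfold forcingConst; positivity

theorem dampingConst_pos (A : ℝ) {cP : ℝ} (hcP : 0 < cP) : 0 < dampingConst A cP := by
  unfold dampingConst; positivity

/-- The ratio of the bound of `E₁ + E₂ + B₁` to `V`, when the masses and `G[Ψᵢ]` are bounded
by `C₀ V`. -/
def energyConst (A cP C₀ : ℝ) : ℝ := (24 + 16 * forcingConst A cP) * C₀

/-- The constant of the final estimate. -/
def limitConst (A cP C₀ : ℝ) : ℝ :=
  4 * energyConst A cP C₀ ^ (1 / 2 : ℝ) /
    ((1 - A) / cP ^ 2 * energyConst A cP C₀ ^ (-(A / (2 - A))))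

namespace Setting

variable {n N : ℕ} {U : Set (E n)} {φ : E n → ℝ} {α : Fin (N + 1) → ℝ}
  {a : Fin (N + 1) → E n → ℝ} (S : Setting U φ α a)
include S

/-- In `10 + 8 F`, `F` being the forcing constant, `8` comes from the mass at `t - 1`, one unit each
from the integrals of `G` and `G₁`, and `8 F` from the forcing; the window has length one. -/
theorem energy_le_of_bounds {cP C₀ v : ℝ} (hcP : 0 < cP) (hC₀ : 1 ≤ C₀) {p Ψ : ℝ → E n → ℝ}
    (hΨ : IsBoundaryData U φ α a Ψ) (hp : IsSolution U φ α a p Ψ)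
    (hPS : ∀ t > 0, PoincareSobolev U φ α a cP (p t - Ψ t)) {t : ℝ} (ht : 1 < t) (hv : 0 ≤ v)
    (hb : ∀ τ ∈ Icc (t - 1) t, mass U φ ((p - Ψ) τ) ≤ C₀ * v ∧ G U φ α a Ψ τ ≤ C₀ * v)
    (hwin : ∫ τ in (t - 1)..t, G1 U a Ψ τ ≤ v) :
    energy U α a (gradient (p t)) ≤ (10 + 8 * forcingConst (expo α) cP) * C₀ * v := by
  have hF := forcingConst_nonneg (expo α) hcP
  have hle : t - 1 ≤ t := by linarith
  have hpos : Icc (t - 1) t ⊆ Ioi 0 := fun s hs => by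
    have := hs.1
    simp only [mem_Ioi]
    linarith
  have hG : IntervalIntegrable (G U φ α a Ψ) volume (t - 1) t :=
    (hΨ.cont_G.mono hpos).intervalIntegrable_of_Icc hle
  have hG1 : IntervalIntegrable (G1 U a Ψ) volume (t - 1) t :=
    (hΨ.cont_G1.mono hpos).intervalIntegrable_of_Icc hle
  have h1 := S.energy_le hcP hΨ hp hPS ht
  rw [intervalIntegral.integral_add (hG.add hG1) ((hG.const_mul _).const_mul 8),
    intervalIntegral.integral_add hG hG1, intervalIntegral.integral_const_mul,
    intervalIntegral.integral_const_mul] at h1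
  have h2 : ∫ s in (t - 1)..t, G U φ α a Ψ s ≤ C₀ * v := by
    have := intervalIntegral.integral_mono_on (g := fun _ => C₀ * v) hle hG
      intervalIntegrable_const fun s hs => (hb s hs).2
    simpa using this
  have h3 := (hb (t - 1) ⟨le_rfl, hle⟩).1
  have h4 := mul_le_mul_of_nonneg_left h2 hF
  have h5 : v ≤ C₀ * v := le_mul_of_one_le_left hv hC₀
  linarith

/-- The common end of both cases: all that matters about `V` is continuity, `V ≥ 1`, divergence, and
control of the masses, `G` and the integral of `G₁` on the preceding unit window. -/
theorem limsup_mass_le {cP C₀ : ℝ} (hcP : 0 < cP) (hC₀ : 1 ≤ C₀) {p₁ p₂ Ψ₁ Ψ₂ : ℝ → E n → ℝ}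
    (hΨ₁ : IsBoundaryData U φ α a Ψ₁) (hΨ₂ : IsBoundaryData U φ α a Ψ₂)
    (hp₁ : IsSolution U φ α a p₁ Ψ₁) (hp₂ : IsSolution U φ α a p₂ Ψ₂)
    (hPS₁ : ∀ t > 0, PoincareSobolev U φ α a cP (p₁ t - Ψ₁ t))
    (hPS₂ : ∀ t > 0, PoincareSobolev U φ α a cP (p₂ t - Ψ₂ t))
    (hPS : ∀ t > 0, PoincareSobolev U φ α a cP ((p₁ t - Ψ₁ t) - (p₂ t - Ψ₂ t)))
    {V : ℝ → ℝ} (hV : ContinuousOn V (Ioi 1)) (hV1 : ∀ t ≥ 1, 1 ≤ V t)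
    (hb₁ : ∀ᶠ t in atTop, ∀ τ ∈ Icc (t - 1) t,
      mass U φ ((p₁ - Ψ₁) τ) ≤ C₀ * V t ∧ G U φ α a Ψ₁ τ ≤ C₀ * V t)
    (hb₂ : ∀ᶠ t in atTop, ∀ τ ∈ Icc (t - 1) t,
      mass U φ ((p₂ - Ψ₂) τ) ≤ C₀ * V t ∧ G U φ α a Ψ₂ τ ≤ C₀ * V t)
    (hw₁ : ∀ t > 1, ∫ τ in (t - 1)..t, G1 U a Ψ₁ τ ≤ V t)
    (hw₂ : ∀ t > 1, ∫ τ in (t - 1)..t, G1 U a Ψ₂ τ ≤ V t)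
    (hdiv : DivergentIntegral α V) :
    limsupInf (fun t => wnorm U φ 2 ((p₁ t - Ψ₁ t) - (p₂ t - Ψ₂ t)) ^ 2) ≤
      ENNReal.ofReal (limitConst (expo α) cP C₀) *
        limsupInf (fun t => V t ^ kappa α * D U φ a (Ψ₁ - Ψ₂) t) := by
  have hA := S.expo_mem
  have hF := forcingConst_nonneg (expo α) hcP
  have hE1 : 1 ≤ energyConst (expo α) cP C₀ := by
    unfold energyConst
    nlinarith [mul_nonneg hF (zero_le_one.trans hC₀)]
  have hE0 : 0 < energyConst (expo α) cP C₀ := one_pos.trans_le hE1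
  have hu₁ := hp₁.regular.timeRegular.sub hΨ₁.regular.timeRegular
  have hu₂ := hp₂.regular.timeRegular.sub hΨ₂.regular.timeRegular
  have he : (fun t => wnorm U φ 2 ((p₁ t - Ψ₁ t) - (p₂ t - Ψ₂ t)) ^ 2) =
      fun t => mass U φ (((p₁ - Ψ₁) - (p₂ - Ψ₂)) t) := by
    ext t
    exact S.wnorm_sq _
  have hc : 0 < (1 - expo α) / cP ^ 2 * energyConst (expo α) cP C₀ ^ (-(expo α / (2 - expo α))) :=
    mul_pos (div_pos (by linarith [hA.2]) (by positivity)) (Real.rpow_pos_of_pos hE0 _)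
  rw [he]
  refine limsupInf_le_of_differential_inequality (σ := expo α / (2 - expo α)) hc
    (by positivity : 0 < 4 * energyConst (expo α) cP C₀ ^ (1 / 2 : ℝ))
    (div_nonneg hA.1.le (by linarith [hA.2])) (fun t ht => S.hasDerivAt_mass (hu₁.sub hu₂) ht)
    hV hV1 hdiv ?_
  filter_upwards [hb₁, hb₂, eventually_gt_atTop 1] with t h1 h2 ht
  have ht0 : 0 < t := by linarith
  have hVt : 1 ≤ V t := hV1 t ht.le
  have hVt0 : 0 < V t := by linarith
  have htm : t ∈ Icc (t - 1) t := ⟨by linarith, le_rfl⟩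
  have e₁ := S.energy_le_of_bounds hcP hC₀ hΨ₁ hp₁ hPS₁ ht hVt0.le h1 (hw₁ t ht)
  have e₂ := S.energy_le_of_bounds hcP hC₀ hΨ₂ hp₂ hPS₂ ht hVt0.le h2 (hw₂ t ht)
  have hB : ∫ x in U, a (Fin.last N) x ≤ C₀ * V t := by
    refine le_trans ?_ (h1 t htm).2
    rw [G_eq]
    have h7 := le_max_left (∫ x in U, a (Fin.last N) x) 1
    have h8 := S.dual_nonneg (gradient (Ψ₁ t))
    have h9 := Real.rpow_nonneg (S.mass_nonneg (dt Ψ₁ t)) ((2 - expo α) / (2 * (1 - expo α)))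
    have h10 := S.weighted_grad_nonneg (gradient (Ψ₁ t))
    linarith
  have hCV : 0 ≤ C₀ * V t := mul_nonneg (by linarith) hVt0.le
  have hCF : 0 ≤ forcingConst (expo α) cP * (C₀ * V t) := mul_nonneg hF hCV
  have hm := S.mass_sub_le (hu₁.continuousOn ht0) (hu₂.continuousOn ht0)
  have h3 := (h1 t htm).1
  have h4 := (h2 t htm).1
  -- The two energies need `20 + 16 F` multiples of `C₀ V` and `B₁` one more; the mass of the
  -- difference needs only `4`.
  have hΛe : energyConst (expo α) cP C₀ * V t =
      24 * (C₀ * V t) + 16 * (forcingConst (expo α) cP * (C₀ * V t)) := by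
    unfold energyConst; ring
  have key := S.difference_inequality (Λ := energyConst (expo α) cP C₀ * V t) hcP
    (one_le_mul_of_one_le_of_one_le hE1 hVt) hΨ₁ hΨ₂ hp₁ hp₂ ht0 (hPS t ht0)
    (by rw [hΛe]; linarith) (by
      rw [hΛe]
      have hm' : mass U φ (((p₁ - Ψ₁) - (p₂ - Ψ₂)) t) ≤
        2 * (mass U φ ((p₁ - Ψ₁) t) + mass U φ ((p₂ - Ψ₂) t)) := hm
      linarith)
  rw [Real.mul_rpow hE0.le hVt0.le, Real.mul_rpow hE0.le hVt0.le] at key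
  linarith

end Setting

/-! ### Window integrals and the two choices of `V` -/

theorem continuousOn_integral_window {f : ℝ → ℝ} (hf : ContinuousOn f (Ioi 0)) :
    ContinuousOn (fun t => ∫ τ in (t - 1)..t, f τ) (Ioi 1) := by
  have hint : ∀ s > 0, ∀ t > 0, IntervalIntegrable f volume s t := fun s hs t ht =>
    (hf.mono fun τ hτ => (lt_min hs ht).trans_le hτ.1).intervalIntegrable
  have hF : ContinuousOn (fun t => ∫ τ in (1 : ℝ)..t, f τ) (Ioi 0) := fun t ht =>
    (intervalIntegral.integral_hasDerivAt_right (hint 1 one_pos t ht)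
      (hf.stronglyMeasurableAtFilter isOpen_Ioi t ht)
      (hf.continuousAt (Ioi_mem_nhds ht))).continuousAt.continuousWithinAt
  have h1 : ContinuousOn (fun t => (∫ τ in (1 : ℝ)..t, f τ) - ∫ τ in (1 : ℝ)..(t - 1), f τ)
      (Ioi 1) := by
    refine (hF.mono (Ioi_subset_Ioi zero_le_one)).sub
      (hF.comp (f := fun t => t - 1) (by fun_prop) fun t ht => ?_)
    simp only [mem_Ioi] at ht ⊢
    linarith
  refine h1.congr fun t ht => ?_
  have ht' : 1 < t := ht
  exact (intervalIntegral.integral_interval_sub_left (hint 1 one_pos t (by linarith))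
    (hint 1 one_pos (t - 1) (by linarith))).symm

/-- The ratio of the barrier for `‖pᵢ - Ψᵢ‖²` to the power `2 / (2 - a)` of the majorant. -/
def barrierConst (A cP : ℝ) : ℝ :=
  ((forcingConst A cP + 1) / dampingConst A cP) ^ (1 / ((2 - A) / 2))

theorem barrierConst_nonneg (A : ℝ) {cP : ℝ} (hcP : 0 < cP) : 0 ≤ barrierConst A cP := by
  have h1 := forcingConst_nonneg A hcP
  have h2 := dampingConst_pos A hcP
  unfold barrierConst; positivity

/-- The ratio of `‖pᵢ - Ψᵢ‖²` and of `G[Ψᵢ]` to `Vfin`. -/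
def finConst (A cP : ℝ) : ℝ :=
  1 + 2 ^ (1 / (1 - A)) + 16 * barrierConst A cP *
    (1 + 2 ^ (1 / (1 - A)) * (1 + (2 * (1 / ((2 - A) / 2)) * barrierConst A cP) ^ (1 / (1 - A))))

namespace Setting

variable {n N : ℕ} {U : Set (E n)} {φ : E n → ℝ} {α : Fin (N + 1) → ℝ}
  {a : Fin (N + 1) → E n → ℝ} (S : Setting U φ α a)
include S

theorem window_nonneg (Ψ₁ Ψ₂ : ℝ → E n → ℝ) (t : ℝ) : 0 ≤ window U φ a Ψ₁ Ψ₂ t :=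
  intervalIntegral.integral_nonneg (by linarith) fun τ _ => add_nonneg
    (add_nonneg (S.G1_nonneg Ψ₁ τ) (S.G1_nonneg Ψ₂ τ))
    (add_nonneg (S.G2_nonneg Ψ₁ τ) (S.G2_nonneg Ψ₂ τ))

omit S in
theorem continuousOn_window {Ψ₁ Ψ₂ : ℝ → E n → ℝ} (hΨ₁ : IsBoundaryData U φ α a Ψ₁)
    (hΨ₂ : IsBoundaryData U φ α a Ψ₂) : ContinuousOn (window U φ a Ψ₁ Ψ₂) (Ioi 1) :=
  continuousOn_integral_window ((hΨ₁.cont_G1.add hΨ₂.cont_G1).add (hΨ₁.cont_G2.add hΨ₂.cont_G2))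

theorem integral_G1_le_window {Ψ₁ Ψ₂ : ℝ → E n → ℝ} (hΨ₁ : IsBoundaryData U φ α a Ψ₁)
    (hΨ₂ : IsBoundaryData U φ α a Ψ₂) {t : ℝ} (ht : 1 < t) :
    ∫ τ in (t - 1)..t, G1 U a Ψ₁ τ ≤ window U φ a Ψ₁ Ψ₂ t ∧
      ∫ τ in (t - 1)..t, G1 U a Ψ₂ τ ≤ window U φ a Ψ₁ Ψ₂ t := by
  have hle : t - 1 ≤ t := by linarith
  have hpos : Icc (t - 1) t ⊆ Ioi 0 := fun s hs => by
    have := hs.1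
    simp only [mem_Ioi]
    linarith
  have hI : ∀ f : ℝ → ℝ, ContinuousOn f (Ioi 0) → IntervalIntegrable f volume (t - 1) t :=
    fun f hf => (hf.mono hpos).intervalIntegrable_of_Icc hle
  have hw := hI (fun τ => (G1 U a Ψ₁ τ + G1 U a Ψ₂ τ) + (G2 U φ Ψ₁ τ + G2 U φ Ψ₂ τ))
    ((hΨ₁.cont_G1.add hΨ₂.cont_G1).add (hΨ₁.cont_G2.add hΨ₂.cont_G2))
  refine ⟨intervalIntegral.integral_mono_on hle (hI _ hΨ₁.cont_G1) hw fun τ _ => ?_,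
    intervalIntegral.integral_mono_on hle (hI _ hΨ₂.cont_G1) hw fun τ _ => ?_⟩ <;>
  linarith [S.G1_nonneg Ψ₁ τ, S.G1_nonneg Ψ₂ τ, S.G2_nonneg Ψ₁ τ, S.G2_nonneg Ψ₂ τ]

theorem mass_deriv_le {cP : ℝ} (hcP : 0 < cP) {p Ψ : ℝ → E n → ℝ}
    (hΨ : IsBoundaryData U φ α a Ψ) (hp : IsSolution U φ α a p Ψ)
    (hPS : ∀ t > 0, PoincareSobolev U φ α a cP (p t - Ψ t)) {t : ℝ} (ht : 0 < t) :
    2 * ∫ x in U, φ x * ((p - Ψ) t x * dt (p - Ψ) t x) ≤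
      -(dampingConst (expo α) cP * mass U φ ((p - Ψ) t) ^ ((2 - expo α) / 2))
        + forcingConst (expo α) cP * G U φ α a Ψ t := by
  have h1 := S.energy_inequality hcP hΨ hp ht (hPS t ht)
  have h2 := S.energy_nonneg (gradient (p t))
  linarith

/-! ### The general growth function -/

/-- A majorant is increasing, so its value at `t` serves the whole window `[t - 1, t]`; as it is at
least `1`, it lies below its power `2 / (2 - a)`. -/
theorem eventually_le_of_isMajorant {cP : ℝ} (hcP : 0 < cP) {p Ψ : ℝ → E n → ℝ}
    (hΨ : IsBoundaryData U φ α a Ψ) (hp : IsSolution U φ α a p Ψ)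
    (hPS : ∀ t > 0, PoincareSobolev U φ α a cP (p t - Ψ t)) {M V : ℝ → ℝ}
    (hM : IsMajorant M (G U φ α a Ψ)) (hV : ∀ t > 0, M t ^ (2 / (2 - expo α)) ≤ V t) :
    ∀ᶠ t in atTop, ∀ τ ∈ Icc (t - 1) t,
      mass U φ ((p - Ψ) τ) ≤ (1 + barrierConst (expo α) cP) * V t ∧
        G U φ α a Ψ τ ≤ (1 + barrierConst (expo α) cP) * V t := by
  have hA := S.expo_mem
  have hF := forcingConst_nonneg (expo α) hcP
  have hd := dampingConst_pos (expo α) hcP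
  have hb := barrierConst_nonneg (expo α) hcP
  have hr : 1 / ((2 - expo α) / 2) = 2 / (2 - expo α) := one_div_div _ _
  have hr1 : 1 ≤ 2 / (2 - expo α) := by
    rw [le_div_iff₀ (by linarith [hA.2])]; linarith [hA.1]
  have hu := hp.regular.timeRegular.sub hΨ.regular.timeRegular
  have hev := eventually_le_of_majorant (y := fun t => mass U φ ((p - Ψ) t))
    (θ := (2 - expo α) / 2) (by linarith [hA.2]) hd hF
    (fun t ht => S.hasDerivAt_mass hu ht) (fun t _ => S.one_le_G Ψ t) hM
    (fun t ht => S.mass_deriv_le hcP hΨ hp hPS ht)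
  obtain ⟨T, hT⟩ := eventually_atTop.1 hev
  filter_upwards [eventually_ge_atTop (max T 1 + 1)] with t ht τ hτ
  have hT1 := le_max_left T 1
  have hT2 := le_max_right T 1
  have hτ1 : 1 ≤ τ := by linarith [hτ.1]
  have h1 := hT τ (by linarith [hτ.1])
  have hMτ := (S.one_le_G Ψ τ).trans (hM.le τ (by linarith))
  have hMle : M τ ≤ M t := hM.mono (show (0 : ℝ) ≤ τ by linarith)
    (show (0 : ℝ) ≤ t by linarith) hτ.2
  have hκ : 0 < (forcingConst (expo α) cP + 1) / dampingConst (expo α) cP := by positivity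
  have hpow : M τ ^ (2 / (2 - expo α)) ≤ V t :=
    (Real.rpow_le_rpow (by linarith) hMle (by linarith)).trans (hV t (by linarith))
  have hMV : M τ ≤ V t := (Real.self_le_rpow_of_one_le hMτ hr1).trans hpow
  constructor
  · rw [Real.mul_rpow hκ.le (by linarith)] at h1
    have h2 : barrierConst (expo α) cP * M τ ^ (2 / (2 - expo α)) ≤
        barrierConst (expo α) cP * V t := mul_le_mul_of_nonneg_left hpow hb
    rw [← hr] at h2
    have h3 : mass U φ ((p - Ψ) τ) ≤ barrierConst (expo α) cP * V t := h1.trans h2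
    linarith
  · have h2 := hM.le τ (by linarith)
    have := mul_nonneg hb (by linarith : 0 ≤ V t)
    linarith

theorem limsup_le_Vgen {cP : ℝ} (hcP : 0 < cP) {p₁ p₂ Ψ₁ Ψ₂ : ℝ → E n → ℝ}
    (hΨ₁ : IsBoundaryData U φ α a Ψ₁) (hΨ₂ : IsBoundaryData U φ α a Ψ₂)
    (hp₁ : IsSolution U φ α a p₁ Ψ₁) (hp₂ : IsSolution U φ α a p₂ Ψ₂)
    (hPS₁ : ∀ t > 0, PoincareSobolev U φ α a cP (p₁ t - Ψ₁ t))
    (hPS₂ : ∀ t > 0, PoincareSobolev U φ α a cP (p₂ t - Ψ₂ t))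
    (hPS : ∀ t > 0, PoincareSobolev U φ α a cP ((p₁ t - Ψ₁ t) - (p₂ t - Ψ₂ t)))
    {M₁ M₂ : ℝ → ℝ} (hM₁ : IsMajorant M₁ (G U φ α a Ψ₁)) (hM₂ : IsMajorant M₂ (G U φ α a Ψ₂))
    (hdiv : DivergentIntegral α (Vgen U φ α a Ψ₁ Ψ₂ M₁ M₂)) :
    limsupInf (fun t => wnorm U φ 2 ((p₁ t - Ψ₁ t) - (p₂ t - Ψ₂ t)) ^ 2) ≤
      ENNReal.ofReal (limitConst (expo α) cP (1 + barrierConst (expo α) cP)) *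
        limsupInf (fun t => Vgen U φ α a Ψ₁ Ψ₂ M₁ M₂ t ^ kappa α * D U φ a (Ψ₁ - Ψ₂) t) := by
  have hA := S.expo_mem
  have hr0 : 0 ≤ 2 / (2 - expo α) := div_nonneg zero_le_two (by linarith [hA.2])
  have h1 : ∀ t > 0, 1 ≤ M₁ t := fun t ht => (S.one_le_G Ψ₁ t).trans (hM₁.le t ht)
  have h2 : ∀ t > 0, 1 ≤ M₂ t := fun t ht => (S.one_le_G Ψ₂ t).trans (hM₂.le t ht)
  have hmain : ∀ t > 0, ∀ u, 0 ≤ u → u ≤ M₁ t + M₂ t →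
      u ^ (2 / (2 - expo α)) ≤ Vgen U φ α a Ψ₁ Ψ₂ M₁ M₂ t := fun t _ u hu hle => by
    have h3 := Real.rpow_le_rpow hu hle hr0
    have h4 := S.window_nonneg Ψ₁ Ψ₂ t
    unfold Vgen
    linarith
  have hwin : ∀ t > 1, window U φ a Ψ₁ Ψ₂ t ≤ Vgen U φ α a Ψ₁ Ψ₂ M₁ M₂ t := fun t ht => by
    have h3 := h1 t (by linarith)
    have h4 := h2 t (by linarith)
    exact le_add_of_nonneg_left (Real.rpow_nonneg (by linarith) _)
  refine S.limsup_mass_le hcP (le_add_of_nonneg_right (barrierConst_nonneg _ hcP))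
    hΨ₁ hΨ₂ hp₁ hp₂ hPS₁ hPS₂ hPS ?_ ?_ ?_ ?_ ?_ ?_ hdiv
  · have hc : ContinuousOn (fun t => M₁ t + M₂ t) (Ioi 1) :=
      (hM₁.cont.add hM₂.cont).mono ((Ioi_subset_Ioi zero_le_one).trans Ioi_subset_Ici_self)
    exact (hc.rpow_const fun _ _ => Or.inr hr0).add (continuousOn_window hΨ₁ hΨ₂)
  · intro t ht
    have h3 := h1 t (by linarith)
    have h4 := h2 t (by linarith)
    have := hmain t (by linarith) 1 zero_le_one (by linarith)
    rwa [Real.one_rpow] at this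
  · refine S.eventually_le_of_isMajorant hcP hΨ₁ hp₁ hPS₁ hM₁ fun t ht => ?_
    have h3 := h1 t ht
    have h4 := h2 t ht
    exact hmain t ht _ (by linarith) (by linarith)
  · refine S.eventually_le_of_isMajorant hcP hΨ₂ hp₂ hPS₂ hM₂ fun t ht => ?_
    have h3 := h1 t ht
    have h4 := h2 t ht
    exact hmain t ht _ (by linarith) (by linarith)
  · exact fun t ht => (S.integral_G1_le_window hΨ₁ hΨ₂ ht).1.trans (hwin t ht)
  · exact fun t ht => (S.integral_G1_le_window hΨ₁ hΨ₂ ht).2.trans (hwin t ht)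

/-! ### The growth function for finite `Btilde` -/

/-- Eventually `G' ≥ -(b + 1)`, so `eventually_le_of_deriv_ge` applies. Its shift `L`, raised to the
barrier exponent, is a multiple of `(b + 1) ^ (1/(1-a))`, which explains the constant term of
`Vfin`. -/
theorem eventually_le_of_limsup_lt {cP b : ℝ} (hcP : 0 < cP) (hb : 0 ≤ b) {p Ψ : ℝ → E n → ℝ}
    (hΨ : IsBoundaryData U φ α a Ψ) (hp : IsSolution U φ α a p Ψ)
    (hPS : ∀ t > 0, PoincareSobolev U φ α a cP (p t - Ψ t)) {V : ℝ → ℝ}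
    (hGd : ContDiffOn ℝ 1 (G U φ α a Ψ) (Ioi 0))
    (hlim : limsupInf (fun t => max (-deriv (G U φ α a Ψ) t) 0) < ENNReal.ofReal (b + 1))
    (hVb : ∀ t > 0, b ^ (1 / (1 - expo α)) ≤ V t)
    (hVG : ∀ t > 0, G U φ α a Ψ t ^ (2 / (2 - expo α)) ≤ V t) :
    ∀ᶠ t in atTop, ∀ τ ∈ Icc (t - 1) t,
      mass U φ ((p - Ψ) τ) ≤ finConst (expo α) cP * V t ∧
        G U φ α a Ψ τ ≤ finConst (expo α) cP * V t := by
  have hA := S.expo_mem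
  have hF := forcingConst_nonneg (expo α) hcP
  have hd := dampingConst_pos (expo α) hcP
  have hB := barrierConst_nonneg (expo α) hcP
  set β := b + 1 with hβ
  have hβ1 : 1 ≤ β := by linarith
  set A := expo α with hAdef
  set r := 1 / ((2 - A) / 2) with hr
  have hre : r = 2 / (2 - A) := one_div_div _ _
  have hr1 : 1 ≤ r := by
    rw [hre, le_div_iff₀ (by linarith [hA.2])]; linarith [hA.1]
  have hr2 : r < 2 := by
    rw [hre, div_lt_iff₀ (by linarith [hA.2])]; linarith [hA.2]
  set s := 1 / (1 - A) with hs
  have hs1 : 1 ≤ s := by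
    rw [hs, le_div_iff₀ (by linarith [hA.2])]; linarith [hA.1]
  have hrs : r ≤ s := by
    rw [hre, hs, div_le_div_iff₀ (by linarith [hA.2]) (by linarith [hA.2])]; linarith [hA.1]
  -- `2 - r = 2 (1 - a) / (2 - a)`: the shift exponent `1/(2-r)` times the barrier exponent `r` is
  -- `1/(1-a)`.
  have hrs' : 1 / (2 - r) * r = s := by
    have h1 : 2 - A ≠ 0 := by linarith [hA.2]
    have h2 : 1 - A ≠ 0 := by linarith [hA.2]
    have h3 : 2 - r = 2 * (1 - A) / (2 - A) := by
      rw [hre]; field_simp; ring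
    rw [h3, hre, hs]
    field_simp
  have hu := hp.regular.timeRegular.sub hΨ.regular.timeRegular
  have hGder : ∀ t > 0, HasDerivAt (G U φ α a Ψ) (deriv (G U φ α a Ψ) t) t := fun t ht =>
    ((hGd.differentiableOn one_ne_zero).differentiableAt (Ioi_mem_nhds ht)).hasDerivAt
  have hG' : ∀ᶠ t in atTop, -β ≤ deriv (G U φ α a Ψ) t := by
    filter_upwards [eventually_lt_of_limsup_lt hlim] with t ht
    have h1 := (ENNReal.ofReal_lt_ofReal_iff' .. |>.1 ht).1
    have h2 := le_max_left (-deriv (G U φ α a Ψ) t) 0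
    linarith
  have hev := eventually_le_of_deriv_ge (y := fun t => mass U φ ((p - Ψ) t))
    (θ := (2 - A) / 2) (by linarith [hA.2]) (by linarith [hA.1]) hd hF
    (by linarith : 0 ≤ β) (fun t ht => S.hasDerivAt_mass hu ht) (fun t _ => S.one_le_G Ψ t)
    hGder hG' (fun t ht => S.mass_deriv_le hcP hΨ hp hPS ht)
  have hκ : 0 < (forcingConst A cP + 1) / dampingConst A cP := by positivity
  have hBe : ((forcingConst A cP + 1) / dampingConst A cP) ^ r = barrierConst A cP := rfl
  rw [← hr, hBe] at hev
  set L := (2 * r * barrierConst A cP * β) ^ (1 / (2 - r)) with hL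
  have hL0 : 0 ≤ L := by positivity
  obtain ⟨T, hT⟩ := eventually_atTop.1 (hev.and hG')
  filter_upwards [eventually_ge_atTop (max T 1 + 1)] with t ht τ hτ
  have hT1 := le_max_left T 1
  have hT2 := le_max_right T 1
  have ht0 : 0 < t := by linarith
  have hy := (hT τ (by linarith [hτ.1])).1
  have hGt := S.one_le_G Ψ t
  have hVGt := hVG t ht0
  rw [← hre] at hVGt
  have hV1 : 1 ≤ V t := (Real.one_le_rpow hGt (by linarith)).trans hVGt
  -- `G` need not increase, but it loses at most `β` over a time of length at most one.
  have hGτ : G U φ α a Ψ τ ≤ G U φ α a Ψ t + β := by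
    have h1 := sub_le_of_hasDerivAt_le (w := fun t => -G U φ α a Ψ t) (m := β) hτ.2
      (fun σ hσ => (hGder σ (by linarith [hτ.1, hσ.1])).fun_neg)
      (fun σ hσ => by linarith [(hT σ (by linarith [hτ.1, hσ.1])).2])
    have h2 : β * (t - τ) ≤ β * 1 :=
      mul_le_mul_of_nonneg_left (by linarith [hτ.1]) (by linarith)
    linarith
  -- The `+ 1` in `β = b + 1` is absorbed by `V ≥ 1`.
  have hβs : β ^ s ≤ 2 ^ s * V t := by
    have h1 : β ≤ 2 * max b 1 := by linarith [le_max_left b 1, le_max_right b 1]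
    have h2 : max b 1 ^ s ≤ V t := by
      rcases max_choice b 1 with h | h <;> rw [h]
      · exact hVb t ht0
      · rw [Real.one_rpow]; exact hV1
    calc β ^ s ≤ (2 * max b 1) ^ s := Real.rpow_le_rpow (by linarith) h1 (by linarith)
      _ = 2 ^ s * max b 1 ^ s := Real.mul_rpow zero_le_two (le_max_of_le_left hb)
      _ ≤ 2 ^ s * V t := mul_le_mul_of_nonneg_left h2 (by positivity)
  have hβr : β ^ r ≤ β ^ s := Real.rpow_le_rpow_of_exponent_le hβ1 hrs
  have hβ' : β ≤ β ^ s := Real.self_le_rpow_of_one_le hβ1 hs1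
  have hGle : G U φ α a Ψ t ≤ V t := (Real.self_le_rpow_of_one_le hGt hr1).trans hVGt
  set B := barrierConst A cP with hBdef
  have hq0 : 0 ≤ 2 * r * B := by positivity
  have hLr : L ^ r = (2 * r * B) ^ s * β ^ s := by
    rw [hL, ← Real.rpow_mul (by positivity), hrs', Real.mul_rpow hq0 (by linarith)]
  have hqs : 0 ≤ (2 * r * B) ^ s := Real.rpow_nonneg hq0 _
  have hfin : finConst A cP = 1 + 2 ^ s + 16 * B * (1 + 2 ^ s * (1 + (2 * r * B) ^ s)) := rfl
  have hV0 : 0 ≤ V t := by linarith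
  have h2V : 0 ≤ 2 ^ s * V t := by positivity
  have hX0 : 0 ≤ 16 * B * (1 + 2 ^ s * (1 + (2 * r * B) ^ s)) := by positivity
  constructor
  · have h1 : (G U φ α a Ψ τ + L) ^ r ≤ 4 * (V t + 4 * (β ^ s + (2 * r * B) ^ s * β ^ s)) := by
      calc (G U φ α a Ψ τ + L) ^ r ≤ (G U φ α a Ψ t + (β + L)) ^ r :=
            Real.rpow_le_rpow (by linarith [S.one_le_G Ψ τ]) (by linarith) (by linarith)
        _ ≤ 4 * (G U φ α a Ψ t ^ r + (β + L) ^ r) :=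
            add_rpow_le_four_mul (by linarith) (by linarith) (by linarith) hr2.le
        _ ≤ _ := by
            have h2 := add_rpow_le_four_mul (u := β) (v := L) (q := r) (by linarith) hL0
              (by linarith) hr2.le
            rw [hLr] at h2
            linarith
    have h2 : (G U φ α a Ψ τ + L) ^ r ≤ 16 * (1 + 2 ^ s * (1 + (2 * r * B) ^ s)) * V t := by
      have h3 := mul_le_mul_of_nonneg_left hβs hqs
      nlinarith
    rw [Real.mul_rpow hκ.le (by linarith [S.one_le_G Ψ τ]), hBe] at hy
    have h3 := mul_le_mul_of_nonneg_left h2 hB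
    rw [hfin]
    linarith
  · have h4 := mul_nonneg hX0 hV0
    rw [hfin]
    linarith

theorem limsup_le_Vfin {cP : ℝ} (hcP : 0 < cP) {p₁ p₂ Ψ₁ Ψ₂ : ℝ → E n → ℝ}
    (hΨ₁ : IsBoundaryData U φ α a Ψ₁) (hΨ₂ : IsBoundaryData U φ α a Ψ₂)
    (hp₁ : IsSolution U φ α a p₁ Ψ₁) (hp₂ : IsSolution U φ α a p₂ Ψ₂)
    (hPS₁ : ∀ t > 0, PoincareSobolev U φ α a cP (p₁ t - Ψ₁ t))
    (hPS₂ : ∀ t > 0, PoincareSobolev U φ α a cP (p₂ t - Ψ₂ t))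
    (hPS : ∀ t > 0, PoincareSobolev U φ α a cP ((p₁ t - Ψ₁ t) - (p₂ t - Ψ₂ t)))
    (hG₁ : ContDiffOn ℝ 1 (G U φ α a Ψ₁) (Ioi 0)) (hG₂ : ContDiffOn ℝ 1 (G U φ α a Ψ₂) (Ioi 0))
    (hB : Btilde U φ α a Ψ₁ Ψ₂ < ⊤) (hdiv : DivergentIntegral α (Vfin U φ α a Ψ₁ Ψ₂)) :
    limsupInf (fun t => wnorm U φ 2 ((p₁ t - Ψ₁ t) - (p₂ t - Ψ₂ t)) ^ 2) ≤
      ENNReal.ofReal (limitConst (expo α) cP (finConst (expo α) cP)) *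
        limsupInf (fun t => Vfin U φ α a Ψ₁ Ψ₂ t ^ kappa α * D U φ a (Ψ₁ - Ψ₂) t) := by
  have hA := S.expo_mem
  have hr0 : 0 ≤ 2 / (2 - expo α) := div_nonneg zero_le_two (by linarith [hA.2])
  set b := (Btilde U φ α a Ψ₁ Ψ₂).toReal with hb
  have hb0 : 0 ≤ b := ENNReal.toReal_nonneg
  have hbs : 0 ≤ b ^ (1 / (1 - expo α)) := Real.rpow_nonneg hb0 _
  -- A strict bound is needed to turn a limsup into an eventual inequality; adding `1` also covers
  -- `b = 0`.
  have hBlt : Btilde U φ α a Ψ₁ Ψ₂ < ENNReal.ofReal (b + 1) := by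
    rw [← ENNReal.ofReal_toReal hB.ne, ← hb]
    exact (ENNReal.ofReal_lt_ofReal_iff (by linarith)).2 (by linarith)
  have h1 := S.one_le_G Ψ₁
  have h2 := S.one_le_G Ψ₂
  have hsum : ∀ t, 0 ≤ (G U φ α a Ψ₁ t + G U φ α a Ψ₂ t) ^ (2 / (2 - expo α)) := fun t =>
    Real.rpow_nonneg (by linarith [h1 t, h2 t]) _
  have hmain : ∀ t u, 0 ≤ u → u ≤ G U φ α a Ψ₁ t + G U φ α a Ψ₂ t →
      u ^ (2 / (2 - expo α)) ≤ Vfin U φ α a Ψ₁ Ψ₂ t := fun t u hu hle => by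
    have h3 := Real.rpow_le_rpow hu hle hr0
    have h4 := S.window_nonneg Ψ₁ Ψ₂ t
    unfold Vfin
    linarith
  have hVb : ∀ t > 0, b ^ (1 / (1 - expo α)) ≤ Vfin U φ α a Ψ₁ Ψ₂ t := fun t _ => by
    have h3 := hsum t
    have h4 := S.window_nonneg Ψ₁ Ψ₂ t
    unfold Vfin
    linarith
  have hwin : ∀ t > 1, window U φ a Ψ₁ Ψ₂ t ≤ Vfin U φ α a Ψ₁ Ψ₂ t := fun t ht => by
    have h3 := hsum t
    unfold Vfin
    linarith
  have hC : 1 ≤ finConst (expo α) cP := by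
    have h3 := barrierConst_nonneg (expo α) hcP
    have h4 : 0 ≤ 2 * (1 / ((2 - expo α) / 2)) * barrierConst (expo α) cP :=
      mul_nonneg (mul_nonneg zero_le_two (one_div_nonneg.2 (by linarith [hA.2]))) h3
    have h5 : (0 : ℝ) ≤ 2 ^ (1 / (1 - expo α)) := by positivity
    unfold finConst
    have : 0 ≤ 16 * barrierConst (expo α) cP * (1 + 2 ^ (1 / (1 - expo α)) *
      (1 + (2 * (1 / ((2 - expo α) / 2)) * barrierConst (expo α) cP) ^ (1 / (1 - expo α)))) := by
      positivity
    linarith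
  refine S.limsup_mass_le hcP hC hΨ₁ hΨ₂ hp₁ hp₂ hPS₁ hPS₂ hPS ?_ ?_ ?_ ?_ ?_ ?_ hdiv
  · have hc : ContinuousOn (fun t => G U φ α a Ψ₁ t + G U φ α a Ψ₂ t) (Ioi 1) :=
      (hΨ₁.cont_G.add hΨ₂.cont_G).mono (Ioi_subset_Ioi zero_le_one)
    exact (continuousOn_const.add (hc.rpow_const fun _ _ => Or.inr hr0)).add
      (continuousOn_window hΨ₁ hΨ₂)
  · intro t ht
    have := hmain t 1 zero_le_one (by linarith [h1 t, h2 t])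
    rwa [Real.one_rpow] at this
  · exact S.eventually_le_of_limsup_lt hcP hb0 hΨ₁ hp₁ hPS₁ hG₁
      ((le_self_add).trans_lt hBlt) hVb fun t _ =>
        hmain t _ (by linarith [h1 t]) (by linarith [h2 t])
  · exact S.eventually_le_of_limsup_lt hcP hb0 hΨ₂ hp₂ hPS₂ hG₂
      ((le_add_self).trans_lt hBlt) hVb fun t _ =>
        hmain t _ (by linarith [h2 t]) (by linarith [h1 t])
  · exact fun t ht => (S.integral_G1_le_window hΨ₁ hΨ₂ ht).1.trans (hwin t ht)
  · exact fun t ht => (S.integral_G1_le_window hΨ₁ hΨ₂ ht).2.trans (hwin t ht)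

end Setting

end

end Forchheimer

/-! ### The main theorem -/

theorem mainTheorem8 (n : ℕ) (hn : 2 ≤ n) (U : Set (Forchheimer.E n)) (hUo : IsOpen U)
    (hUc : IsConnected U) (hUb : Bornology.IsBounded U) (N : ℕ) (hN : 1 ≤ N)
    (α : Fin (N + 1) → ℝ) (hα0 : α 0 = 0) (hα : StrictMono α) (cP : ℝ) (hcP : 0 < cP) :
    ∃ C : ℝ, 0 < C ∧
      ∀ (φ : Forchheimer.E n → ℝ) (a : Fin (N + 1) → Forchheimer.E n → ℝ)
        (p₁ p₂ Ψ₁ Ψ₂ : ℝ → Forchheimer.E n → ℝ),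
        Forchheimer.IsMedium U φ a →
        Forchheimer.IsBoundaryData U φ α a Ψ₁ →
        Forchheimer.IsBoundaryData U φ α a Ψ₂ →
        Forchheimer.IsSolution U φ α a p₁ Ψ₁ →
        Forchheimer.IsSolution U φ α a p₂ Ψ₂ →
        (∀ t > 0, Forchheimer.PoincareSobolev U φ α a cP (p₁ t - Ψ₁ t)) →
        (∀ t > 0, Forchheimer.PoincareSobolev U φ α a cP (p₂ t - Ψ₂ t)) →
        (∀ t > 0, Forchheimer.PoincareSobolev U φ α a cP
          ((p₁ t - Ψ₁ t) - (p₂ t - Ψ₂ t))) →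
        Forchheimer.Atilde U φ α a Ψ₁ Ψ₂ = ⊤ →
        (∀ M₁ M₂ : ℝ → ℝ,
          Forchheimer.IsMajorant M₁ (Forchheimer.G U φ α a Ψ₁) →
          Forchheimer.IsMajorant M₂ (Forchheimer.G U φ α a Ψ₂) →
          Forchheimer.DivergentIntegral α (Forchheimer.Vgen U φ α a Ψ₁ Ψ₂ M₁ M₂) →
          Forchheimer.limsupInf (fun t =>
              Forchheimer.wnorm U φ 2 ((p₁ t - Ψ₁ t) - (p₂ t - Ψ₂ t)) ^ 2) ≤
            ENNReal.ofReal C * Forchheimer.limsupInf (fun t =>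
              Forchheimer.Vgen U φ α a Ψ₁ Ψ₂ M₁ M₂ t ^ Forchheimer.kappa α *
                Forchheimer.D U φ a (Ψ₁ - Ψ₂) t)) ∧
        (ContDiffOn ℝ 1 (Forchheimer.G U φ α a Ψ₁) (Ioi 0) →
          ContDiffOn ℝ 1 (Forchheimer.G U φ α a Ψ₂) (Ioi 0) →
          Forchheimer.Btilde U φ α a Ψ₁ Ψ₂ < ⊤ →
          Forchheimer.DivergentIntegral α (Forchheimer.Vfin U φ α a Ψ₁ Ψ₂) →
          Forchheimer.limsupInf (fun t =>
              Forchheimer.wnorm U φ 2 ((p₁ t - Ψ₁ t) - (p₂ t - Ψ₂ t)) ^ 2) ≤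
            ENNReal.ofReal C * Forchheimer.limsupInf (fun t =>
              Forchheimer.Vfin U φ α a Ψ₁ Ψ₂ t ^ Forchheimer.kappa α *
                Forchheimer.D U φ a (Ψ₁ - Ψ₂) t)) := by
  -- One constant for both choices of `V`, built only from `a` and `cP`; the `1` ensures positivity.
  refine ⟨max 1 (max
    (Forchheimer.limitConst (Forchheimer.expo α) cP
      (1 + Forchheimer.barrierConst (Forchheimer.expo α) cP))
    (Forchheimer.limitConst (Forchheimer.expo α) cP
      (Forchheimer.finConst (Forchheimer.expo α) cP))),
    one_pos.trans_le (le_max_left _ _), ?_⟩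
  intro φ a p₁ p₂ Ψ₁ Ψ₂ hmed hΨ₁ hΨ₂ hp₁ hp₂ hPS₁ hPS₂ hPS _
  have S : Forchheimer.Setting U φ α a := ⟨hUo, hUb, hα0, hα, hN, hmed⟩
  refine ⟨fun M₁ M₂ hM₁ hM₂ hdiv => ?_, fun hG₁ hG₂ hB hdiv => ?_⟩
  · refine (S.limsup_le_Vgen hcP hΨ₁ hΨ₂ hp₁ hp₂ hPS₁ hPS₂ hPS hM₁ hM₂ hdiv).trans ?_
    gcongr
    exact (le_max_left _ _).trans (le_max_right _ _)
  · refine (S.limsup_le_Vfin hcP hΨ₁ hΨ₂ hp₁ hp₂ hPS₁ hPS₂ hPS hG₁ hG₂ hB hdiv).trans ?_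
    gcongr
    exact (le_max_right _ _).trans (le_max_right _ _)
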